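/- **Setting.** Let $V:\mathbb R\to\mathbb R$ vanish on $(0,\infty)$, be left-continuous at $0$ with $V(0)=V(0^-)=\lambda>0$, and be Lipschitz on $(-\infty,0]$. Let $v:\mathbb R\to\mathbb R$ be Lipschitz and suppose that there is $b>0$ with $$v(r_2)-v(r_1)\le -b\,(r_2-r_1)\qquad\text{for all } r_2\ge r_1 \text{ such that } r_1\ge V(x)\text{ for some }x\in\mathbb R$$ (if $V\ge 0$ this is the condition for all $r_2\ge r_1\ge 0$). Put $U=V$ on $(-\infty,0]$ and $U=\lambda$ on $(0,\infty)$. For a probability measure $\mu$ on $\mathbb R$ with distribution function $F_\mu(x)=\mu((-\infty,x])$ let $X_\mu(z)=\inf\{x: F_\mu(x)\ge z\}$ for $0<z\le 1$ and $X_\mu(0)=\inf\{x:F_\mu(x)>0\}$ (the limit of $X_\mu(z)$ as $z\downarrow 0$). For $p\in[1,\infty]$ let $\mathcal P_p(\mathbb R)$ be the set of probability measures on $\mathbb R$ with finite $p$-moment (bounded support if $p=\infty$), with the distance $\mathcal W_p(\mu,\nu)=\|X_\mu-X_\nu\|_{L^p([0,1])}$. A *dissipative measure solution* with initial datum $\rho_0\in\mathcal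 P_p(\mathbb R)$ is a curve $\rho\in C([0,\infty);\mathcal P_p(\mathbb R))$ with $\rho(\cdot,0)=\rho_0$, such that for every $t>0$ the measure $\rho(\cdot,t)$ has a density in $L^\infty(\mathbb R)$, and $$\int_0^\infty\!\!\int_{\mathbb R}\rho\,\partial_t\varphi\,dx\,dt+\int_0^\infty\!\!\int_{\mathbb R}\rho\, v(V*\rho)\,\partial_x\varphi\,dx\,dt=0\qquad\text{for all }\varphi\in C^1_c(\mathbb R\times(0,\infty)).$$ **Theorem.** Let $\rho_0$ be a compactly supported probability measure on $\mathbb R$. For every integer $N\ge1$ put $m_N=1/N$ and $\bar x_i=X_{\rho_0}(i/N)$, $i=0,\dots,N$. 1. The system $$\dot x_i(t)=v\Big(m_N\sum_{k=0}^N U(x_i(t)-x_k(t))-m_N\lambda(i+1)\Big),\quad x_i(0)=\bar x_i,\qquad i=0,\dots,N,$$ has a unique solution on $[0,\infty)$. It satisfies $x_i(t)<x_{i+1}(t)$ for all $t>0$ and $0\le i<N$, and it also solves $$\dot x_i(t)=v\Big(m_N\sum_{k=i+1}^N V(x_i(t)-x_k(t))\Big),\quad x_i(0)=\bar x_i,\qquad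 i=0,\dots,N.$$ 2. For $t>0$ let $$\rho^N(x,t)=\sum_{i=0}^{N-1}\frac{m_N}{x_{i+1}(t)-x_i(t)}\mathbf 1_{[x_i(t),x_{i+1}(t))}(x).$$ For every $\delta>0$ there is a constant $C$ such that $0\le\rho^N(x,t)\le C$ for all $N\ge1$, $t\ge\delta$, $x\in\mathbb R$; in particular, for each $t>0$, $\rho^N(\cdot,t)$ is bounded in $L^\infty(\mathbb R)$ uniformly in $N$. 3. For every $p\in[1,\infty]$ there is exactly one dissipative measure solution with initial datum $\rho_0$. It is the same curve $\rho$ for all $p$, and at positive times it has a jointly measurable density, again written $\rho$. For every $\delta>0$, $\rho^N$ and $\rho$ belong to $L^\infty(\mathbb R\times[\delta,\infty))$ and $\rho^N\to\rho$ weakly-$*$ in $L^\infty(\mathbb R\times[\delta,\infty))$ as $N\to\infty$. -/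

import Mathlib

open Set Filter Topology MeasureTheory ProbabilityTheory
open scoped NNReal ENNReal

noncomputable section

namespace NonlocalCL

/-- Standing assumptions on the interaction kernel: `V` vanishes on the positive half-line, it is
left-continuous at the origin with `V 0 = V (0-) = lam > 0`, and it is Lipschitz on `(-∞, 0]`. -/
structure InteractionKernel (V : ℝ → ℝ) (lam : ℝ) : Prop where
  support_subset : Function.support V ⊆ Iic 0
  left_continuous : ContinuousWithinAt V (Iic 0) 0
  at_zero : V 0 = lam
  lam_pos : 0 < lam
  lipschitz : ∃ K : ℝ≥0, LipschitzOnWith K V (Iic 0)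

/-- Standing assumptions on the velocity map: `v` is globally Lipschitz and strongly decreasing on
the half-line of values above the infimum of the kernel `V`. Since `V` vanishes on `(0, ∞)`, this
half-line contains `[0, ∞)`, and it is exactly `[0, ∞)` when `V` is nonnegative. -/
structure VelocityMap (V v : ℝ → ℝ) : Prop where
  lipschitz : ∃ K : ℝ≥0, LipschitzWith K v
  decreasing : ∃ b : ℝ, 0 < b ∧ ∀ r₁ r₂ : ℝ, r₁ ≤ r₂ → (∃ x, V x ≤ r₁) →
    v r₂ - v r₁ ≤ -b * (r₂ - r₁)

/-- The Lipschitz modification `U` of the kernel: `V` on `(-∞, 0]` and `lam` on `(0, ∞)`. -/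
def U (V : ℝ → ℝ) (lam : ℝ) (x : ℝ) : ℝ := if x ≤ 0 then V x else lam

/-- The quantile function (pseudo-inverse of the cumulative distribution function) of `μ`:
`inf {x | F x ≥ z}` for `z > 0`, and its right limit `inf {x | F x > 0}` at `z = 0`. -/
def quantile (μ : Measure ℝ) (z : ℝ) : ℝ :=
  if z ≤ 0 then sInf {x | 0 < cdf μ x} else sInf {x | z ≤ cdf μ x}

/-- The one-dimensional `p`-Wasserstein distance, `1 ≤ p ≤ ∞`, as the `L^p([0,1])` distance of the
quantile functions. -/
def wassersteinDist (p : ℝ≥0∞) (μ ν : Measure ℝ) : ℝ≥0∞ :=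
  eLpNorm (fun z => quantile μ z - quantile ν z) p (volume.restrict (Icc (0 : ℝ) 1))

/-- `μ` is absolutely continuous with a density in `L^∞(ℝ)`. -/
def HasBoundedDensity (μ : Measure ℝ) : Prop :=
  ∃ f : ℝ → ℝ, (∀ x, 0 ≤ f x) ∧ MemLp f ∞ volume ∧
    μ = volume.withDensity (fun x => ENNReal.ofReal (f x))

/-- The nonlocal velocity `W[μ](x) = v ((V ∗ μ) (x))`. -/
def W (V v : ℝ → ℝ) (μ : Measure ℝ) (x : ℝ) : ℝ := v (∫ y, V (x - y) ∂μ)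

/-- `ρ ∈ C([0,∞); P_p(ℝ))` is a dissipative measure solution of `∂ₜ ρ + ∂ₓ (ρ W[ρ]) = 0` with
initial datum `ρ₀`. Only the values of `ρ` at times `t ≥ 0` matter. -/
structure IsDissipativeSolution (V v : ℝ → ℝ) (p : ℝ≥0∞) (ρ₀ : Measure ℝ)
    (ρ : ℝ → Measure ℝ) : Prop where
  prob : ∀ t, 0 ≤ t → IsProbabilityMeasure (ρ t)
  moment : ∀ t, 0 ≤ t → MemLp (fun x : ℝ => x) p (ρ t)
  continuous : ∀ s, 0 ≤ s →
    Tendsto (fun t => wassersteinDist p (ρ t) (ρ s)) (𝓝[Ici 0] s) (𝓝 0)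
  bounded : ∀ t, 0 < t → HasBoundedDensity (ρ t)
  weak : ∀ φ : ℝ × ℝ → ℝ, ContDiff ℝ 1 φ → HasCompactSupport φ →
    tsupport φ ⊆ {q | 0 < q.2} →
    (∫ t in Ioi (0 : ℝ), ∫ x, deriv (fun s => φ (x, s)) t ∂(ρ t)) +
      (∫ t in Ioi (0 : ℝ), ∫ x, W V v (ρ t) x * deriv (fun ξ => φ (ξ, t)) x ∂(ρ t)) = 0
  initial : ρ 0 = ρ₀

/-- The curves `x 0, …, x N` solve, on `[0, ∞)`, the particle system written with `U`, starting
from the quantiles `i / N` of `ρ₀`. -/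
def SolvesDPAU (V v : ℝ → ℝ) (lam : ℝ) (ρ₀ : Measure ℝ) (N : ℕ)
    (x : Fin (N + 1) → ℝ → ℝ) : Prop :=
  ∀ i : Fin (N + 1), x i 0 = quantile ρ₀ ((i : ℝ) / N) ∧
    ∀ t, 0 ≤ t → HasDerivWithinAt (x i)
      (v ((1 / (N : ℝ)) * ∑ k, U V lam (x i t - x k t) - (1 / (N : ℝ)) * lam * ((i : ℝ) + 1)))
      (Ici 0) t

/-- The curves `x 0, …, x N` solve, on `[0, ∞)`, the particle system written with `V`, where the
particle `i` interacts with the particles `k > i` only, starting from the same positions. -/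
def SolvesDPAV (V v : ℝ → ℝ) (ρ₀ : Measure ℝ) (N : ℕ) (x : Fin (N + 1) → ℝ → ℝ) : Prop :=
  ∀ i : Fin (N + 1), x i 0 = quantile ρ₀ ((i : ℝ) / N) ∧
    ∀ t, 0 ≤ t → HasDerivWithinAt (x i)
      (v ((1 / (N : ℝ)) * ∑ k ∈ Finset.Ioi i, V (x i t - x k t))) (Ici 0) t

/-- The piecewise constant density with mass `1 / N` on each `[x i t, x (i+1) t)`, as a function of
`q = (position, time)`. -/
def reconstruction (N : ℕ) (x : Fin (N + 1) → ℝ → ℝ) (q : ℝ × ℝ) : ℝ :=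
  ∑ i : Fin N, (Ico (x i.castSucc q.2) (x i.succ q.2)).indicator
    (fun _ => (1 / (N : ℝ)) / (x i.succ q.2 - x i.castSucc q.2)) q.1

/-- Weak-star convergence in `L^∞(S)`, the dual of `L^1(S)`, for `S ⊆ ℝ × ℝ`. -/
def TendstoWeakStar (S : Set (ℝ × ℝ)) (f : ℕ → ℝ × ℝ → ℝ) (g : ℝ × ℝ → ℝ) : Prop :=
  (∀ N, MemLp (f N) ∞ (volume.restrict S)) ∧ MemLp g ∞ (volume.restrict S) ∧
    ∀ h : ℝ × ℝ → ℝ, IntegrableOn h S →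
      Tendsto (fun N => ∫ q in S, f N q * h q) atTop (𝓝 (∫ q in S, g q * h q))

end NonlocalCL

end

namespace NonlocalCL

/-! ### The modified kernel and velocity -/

/-! Let X(t, ·) be the quantile function of ρ(·, t). One has V = U - λ 1_{(0,∞)}. If ρ(·, t) has no
atoms, X is strictly increasing and the mass to the left of X(z) is z, so the nonlocal velocity at
X(z) is v(∫ U(X(z) - X(y)) dy - λ z). The jump of V has become the smooth term λ z, and the
conservation law becomes an ordinary differential equation for X with a Lipschitz field. In the
particle system Lebesgue measure is replaced by an empirical sum. Both are instances of one equation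
on C(S, ℝ), where S is a compact space of labels (initial position, mass coordinate); only the
measure on S differs (`IsMeanFieldFlow`).

The regularisation comes from the mass coordinate. For two labels with ordered positions and mass
coordinates at distance Δ > 0, strong monotonicity of the velocity gives D' ≥ bλΔ - M|D| for the
difference D of the trajectories, hence D ≥ c(t) Δ with c(t) > 0 for t > 0, even if both start at
the same point (`IsMeanFieldFlow.sub_ge`). This orders the particles strictly and bounds all
densities by 1 / c(t), uniformly in N. Monotonicity is needed on the whole line, so v is replaced by
a function w that agrees with it on all values an average of V can take
(`VelocityMap.exists_strongly_decreasing`).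

Existence: the image of Lebesgue measure under X(t, ·) is a solution, by change of variables and the
chain rule (`IsQuantileFlow.weak_formulation`). Uniqueness: the quantile functions of any solution
form a continuous curve in L¹(0, 1). By Legendre duality ∫₀ᶻ X is the maximum over x of xz - ∫ (x -
X)⁺, and the latter integrals evolve according to the weak formulation; so ∫₀ᶻ X is touched from
below by differentiable functions of time, and X solves an equation in L¹ with a Lipschitz field
(`IsWeakQuantileCurve.setIntegral_sub`).

Convergence: Grönwall stability with respect to the measure on labels (`IsMeanFieldFlow.dist_le`)
and a quadrature estimate (`abs_integral_quantileLabel_sub_le`) give uniform convergence of the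
flows at each time. Together with the uniform density bound this yields weak-* convergence. -/

theorem U_eq_comp_min {V : ℝ → ℝ} {lam : ℝ} (hV : InteractionKernel V lam) (x : ℝ) :
    U V lam x = V (min x 0) := by
  unfold U
  split_ifs with h
  · rw [min_eq_left h]
  · rw [min_eq_right (le_of_not_ge h), hV.at_zero]

theorem InteractionKernel.exists_lipschitzWith_U {V : ℝ → ℝ} {lam : ℝ}
    (hV : InteractionKernel V lam) : ∃ K : ℝ≥0, LipschitzWith K (U V lam) := by
  obtain ⟨K, hK⟩ := hV.lipschitz
  refine ⟨K, LipschitzWith.of_dist_le_mul fun x y => ?_⟩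
  rw [U_eq_comp_min hV, U_eq_comp_min hV]
  refine (hK.dist_le_mul _ (mem_Iic.2 (min_le_right x 0)) _ (mem_Iic.2 (min_le_right y 0))).trans ?_
  gcongr
  simpa [Real.dist_eq] using abs_min_sub_min_le_max x 0 y 0

theorem InteractionKernel.eq_zero_of_pos {V : ℝ → ℝ} {lam : ℝ} (hV : InteractionKernel V lam)
    {x : ℝ} (hx : 0 < x) : V x = 0 := by
  by_contra h
  exact absurd (hV.support_subset (Function.mem_support.2 h)) (not_le.2 hx)

theorem InteractionKernel.U_of_nonpos (V : ℝ → ℝ) (lam : ℝ) {x : ℝ} (hx : x ≤ 0) :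
    U V lam x = V x := if_pos hx

theorem InteractionKernel.U_of_nonneg {V : ℝ → ℝ} {lam : ℝ} (hV : InteractionKernel V lam)
    {x : ℝ} (hx : 0 ≤ x) : U V lam x = lam := by
  rw [U_eq_comp_min hV, min_eq_right hx, hV.at_zero]

theorem InteractionKernel.measurable {V : ℝ → ℝ} {lam : ℝ} (hV : InteractionKernel V lam) :
    Measurable V := by
  obtain ⟨K, hK⟩ := hV.exists_lipschitzWith_U
  have : V = (Iic (0 : ℝ)).indicator (U V lam) := by
    ext x
    by_cases hx : x ≤ 0
    · rw [indicator_of_mem (mem_Iic.2 hx), InteractionKernel.U_of_nonpos V lam hx]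
    · rw [indicator_of_notMem (by simpa using hx), hV.eq_zero_of_pos (not_le.1 hx)]
  rw [this]
  exact hK.continuous.measurable.indicator measurableSet_Iic

/-- A velocity map can be changed outside the range that averages of the kernel can reach, so that
it becomes strongly decreasing on the whole line. -/
theorem VelocityMap.exists_strongly_decreasing {V v : ℝ → ℝ} (hv : VelocityMap V v) :
    ∃ w : ℝ → ℝ, (∃ L : ℝ≥0, LipschitzWith L w) ∧
      (∃ b : ℝ, 0 < b ∧ ∀ r₁ r₂ : ℝ, r₁ ≤ r₂ → b * (r₂ - r₁) ≤ w r₁ - w r₂) ∧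
      ∀ r, (∃ x, V x ≤ r) → w r = v r := by
  obtain ⟨L, hL⟩ := hv.lipschitz
  obtain ⟨b, hb, hdec⟩ := hv.decreasing
  by_cases hbdd : BddBelow {r | ∃ x, V x ≤ r}
  · set c := sInf {r | ∃ x, V x ≤ r}
    have hne : {r | ∃ x, V x ≤ r}.Nonempty := ⟨V 0, 0, le_rfl⟩
    have hgt : ∀ r, c < r → ∃ x, V x ≤ r := fun r hr => by
      obtain ⟨s, ⟨x, hx⟩, hs⟩ := exists_lt_of_csInf_lt hne hr
      exact ⟨x, hx.trans hs.le⟩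
    -- The infimum `c` need not belong to the admissible set, so the inequality at `c` is a limit
    -- from the right.
    have hdec' : ∀ r₁ r₂, c ≤ r₁ → r₁ ≤ r₂ → b * (r₂ - r₁) ≤ v r₁ - v r₂ := by
      intro r₁ r₂ h1 h12
      have hlim1 : Tendsto (fun e : ℝ => v (r₁ + e) - v (r₂ + e)) (𝓝[>] 0)
          (𝓝 (v (r₁ + 0) - v (r₂ + 0))) := by
        have : Continuous (fun e : ℝ => v (r₁ + e) - v (r₂ + e)) := by
          have := hL.continuous
          fun_prop
        exact (this.tendsto 0).mono_left nhdsWithin_le_nhds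
      rw [add_zero, add_zero] at hlim1
      refine ge_of_tendsto hlim1 ?_
      filter_upwards [self_mem_nhdsWithin] with e (he : 0 < e)
      have := hdec (r₁ + e) (r₂ + e) (by linarith) (hgt _ (by linarith))
      linarith
    -- Below `c` the function is continued with slope `-b`.
    refine ⟨fun r => v (max r c) + b * max (c - r) 0, ⟨L + ⟨b, hb.le⟩, ?_⟩, ⟨b, hb, ?_⟩, ?_⟩
    · refine (((hL.comp (LipschitzWith.id.max_const c)).weaken (by simp)).add
        (LipschitzWith.of_dist_le_mul fun x y => ?_))
      rw [Real.dist_eq, Real.dist_eq, ← mul_sub, abs_mul, abs_of_pos hb]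
      refine mul_le_mul_of_nonneg_left ?_ hb.le
      refine (abs_max_sub_max_le_max _ _ _ _).trans ?_
      rw [sub_sub_sub_cancel_left, abs_sub_comm]
      simp
    · intro r₁ r₂ h12
      beta_reduce
      rcases le_total c r₁ with h1 | h1
      · rw [max_eq_left h1, max_eq_left (h1.trans h12), max_eq_right (by linarith),
          max_eq_right (by linarith)]
        linarith [hdec' r₁ r₂ h1 h12]
      · rcases le_total c r₂ with h2 | h2
        · rw [max_eq_right h1, max_eq_left h2, max_eq_left (by linarith),
            max_eq_right (by linarith)]
          linarith [hdec' c r₂ le_rfl h2]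
        · rw [max_eq_right h1, max_eq_right h2, max_eq_left (by linarith),
            max_eq_left (by linarith)]
          linarith
    · intro r hr
      have : c ≤ r := csInf_le hbdd hr
      simp only [max_eq_left this]
      rw [max_eq_right (by linarith)]
      ring
  -- If `V` is unbounded below, every real number dominates a value of `V` and `v` itself is
  -- strongly decreasing everywhere.
  · refine ⟨v, ⟨L, hL⟩, ⟨b, hb, fun r₁ r₂ h12 => ?_⟩, fun _ _ => rfl⟩
    have : ∃ x, V x ≤ r₁ := by
      by_contra h
      push Not at h
      exact hbdd ⟨r₁, fun r ⟨x, hx⟩ => ((h x).trans_le hx).le⟩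
    linarith [hdec r₁ r₂ h12 this]

/-! ### Global solutions of Lipschitz differential equations -/

section ODE

variable {E : Type*} [NormedAddCommGroup E] [NormedSpace ℝ E]

/-- On the ball of radius ‖f x₀‖ around x₀ the field is at most (K + 1)‖f x₀‖, so in time 1 / (2(K +
1)) a solution covers at most half the radius. The step does not depend on `x₀`, so it can be
iterated indefinitely. -/
theorem exists_hasDerivWithinAt_Icc_add [CompleteSpace E] {K : ℝ≥0} {f : E → E}
    (hf : LipschitzWith K f) (x₀ : E) (T : ℝ) :
    ∃ α : ℝ → E, α T = x₀ ∧ ∀ t ∈ Icc T (T + 1 / (2 * (K + 1))),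
      HasDerivWithinAt α (f (α t)) (Icc T (T + 1 / (2 * (K + 1)))) t := by
  have hτ : (0 : ℝ) < 1 / (2 * (K + 1)) := by positivity
  let t₀ : Icc T (T + 1 / (2 * ((K : ℝ) + 1))) := ⟨T, le_rfl, by linarith⟩
  have h : IsPicardLindelof (fun _ => f) t₀ x₀ ‖f x₀‖₊ 0 ((K + 1) * ‖f x₀‖₊) K := by
    refine IsPicardLindelof.of_time_independent (fun x hx => ?_) hf.lipschitzOnWith ?_
    · have h1 : ‖f x - f x₀‖ ≤ K * ‖x - x₀‖ := by
        simpa [dist_eq_norm] using hf.dist_le_mul x x₀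
      have h2 : ‖x - x₀‖ ≤ ‖f x₀‖ := by simpa [dist_eq_norm] using hx
      have h3 : ‖f x‖ ≤ ‖f x - f x₀‖ + ‖f x₀‖ := by
        simpa using norm_add_le (f x - f x₀) (f x₀)
      have h4 : (K : ℝ) * ‖x - x₀‖ ≤ K * ‖f x₀‖ := by gcongr
      push_cast
      linarith
    · have : max (T + 1 / (2 * ((K : ℝ) + 1)) - t₀) (t₀ - T) = 1 / (2 * ((K : ℝ) + 1)) := by
        simp only [t₀, add_sub_cancel_left, sub_self]
        exact max_eq_left hτ.le
      rw [this]
      push_cast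
      have hK : (0 : ℝ) < (K : ℝ) + 1 := by positivity
      have : ((K : ℝ) + 1) * ‖f x₀‖ * (1 / (2 * (K + 1))) = ‖f x₀‖ / 2 := by
        field_simp
      rw [this]
      linarith [norm_nonneg (f x₀)]
  exact h.exists_eq_forall_mem_Icc_hasDerivWithinAt₀

theorem hasDerivWithinAt_ite_of_Icc {α β : ℝ → E} {f : E → E} {a b c : ℝ} (hab : a ≤ b)
    (hbc : b ≤ c) (hα : ∀ t ∈ Icc a b, HasDerivWithinAt α (f (α t)) (Icc a b) t)
    (hβ : ∀ t ∈ Icc b c, HasDerivWithinAt β (f (β t)) (Icc b c) t) (h : β b = α b) :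
    ∀ t ∈ Icc a c, HasDerivWithinAt (fun t => if t ≤ b then α t else β t)
      (f (if t ≤ b then α t else β t)) (Icc a c) t := by
  intro t ht
  set γ : ℝ → E := fun t => if t ≤ b then α t else β t with hγ
  have e1 : ∀ s ∈ Icc a b, γ s = α s := fun s hs => if_pos hs.2
  have e2 : ∀ s ∈ Icc b c, γ s = β s := fun s hs => by
    rcases eq_or_lt_of_le hs.1 with rfl | h'
    · simp [γ, h]
    · exact if_neg (not_le.2 h')
  rw [← Icc_union_Icc_eq_Icc hab hbc]
  refine HasDerivWithinAt.union (t := Icc b c) ?_ ?_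
  · by_cases h1 : t ∈ Icc a b
    · have := hα t h1
      rw [← e1 t h1] at this
      exact this.congr e1 (e1 t h1)
    · exact HasFDerivWithinAt.of_notMem_closure (by rwa [isClosed_Icc.closure_eq])
  · by_cases h1 : t ∈ Icc b c
    · have := hβ t h1
      rw [← e2 t h1] at this
      exact this.congr e2 (e2 t h1)
    · exact HasFDerivWithinAt.of_notMem_closure (by rwa [isClosed_Icc.closure_eq])

theorem eqOn_Icc_of_hasDerivWithinAt {K : ℝ≥0} {f : E → E} (hf : LipschitzWith K f)
    {α β : ℝ → E} {T : ℝ} (hα : ∀ t ∈ Icc 0 T, HasDerivWithinAt α (f (α t)) (Icc 0 T) t)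
    (hβ : ∀ t ∈ Icc 0 T, HasDerivWithinAt β (f (β t)) (Icc 0 T) t) (h : α 0 = β 0) :
    EqOn α β (Icc 0 T) := by
  refine ODE_solution_unique (v := fun _ => f) (fun _ => hf)
    (fun t ht => (hα t ht).continuousWithinAt) (fun t ht => ?_)
    (fun t ht => (hβ t ht).continuousWithinAt) (fun t ht => ?_) h
  · exact (hα t (Ico_subset_Icc_self ht)).mono_of_mem_nhdsWithin (Icc_mem_nhdsGE_of_mem ht)
  · exact (hβ t (Ico_subset_Icc_self ht)).mono_of_mem_nhdsWithin (Icc_mem_nhdsGE_of_mem ht)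

/-- A globally Lipschitz vector field on a Banach space has a solution on `[0, ∞)`, which is
extended by a constant to negative times. -/
theorem exists_global_solution [CompleteSpace E] {K : ℝ≥0} {f : E → E} (hf : LipschitzWith K f)
    (x₀ : E) : ∃ α : ℝ → E, Continuous α ∧ α 0 = x₀ ∧
      ∀ t, 0 ≤ t → HasDerivWithinAt α (f (α t)) (Ici 0) t := by
  set τ : ℝ := 1 / (2 * (K + 1)) with hτdef
  have hτ : 0 < τ := by positivity
  have key : ∀ n : ℕ, ∃ α : ℝ → E, α 0 = x₀ ∧
      ∀ t ∈ Icc 0 (n * τ), HasDerivWithinAt α (f (α t)) (Icc 0 (n * τ)) t := by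
    intro n
    induction n with
    | zero =>
      refine ⟨fun _ => x₀, rfl, fun t ht => ?_⟩
      simp only [Nat.cast_zero, zero_mul, Icc_self] at ht ⊢
      rw [mem_singleton_iff.1 ht]
      exact HasFDerivWithinAt.of_subsingleton subsingleton_singleton
    | succ n ih =>
      obtain ⟨α, h0, hα⟩ := ih
      obtain ⟨β, h1, hβ⟩ := exists_hasDerivWithinAt_Icc_add hf (α (n * τ)) (n * τ)
      rw [← hτdef] at hβ
      have hn : (0 : ℝ) ≤ n * τ := by positivity
      refine ⟨fun t => if t ≤ n * τ then α t else β t, by simp only [if_pos hn, h0], ?_⟩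
      rw [show ((n + 1 : ℕ) : ℝ) * τ = n * τ + τ by push_cast; ring]
      exact hasDerivWithinAt_ite_of_Icc hn (by linarith) hα hβ h1
  choose α h0 hα using key
  have hmono : ∀ m n : ℕ, m ≤ n → EqOn (α m) (α n) (Icc 0 (m * τ)) := by
    intro m n hmn
    have hsub : Icc (0 : ℝ) (m * τ) ⊆ Icc 0 (n * τ) := Icc_subset_Icc_right (by gcongr)
    exact eqOn_Icc_of_hasDerivWithinAt hf (hα m)
      (fun t ht => (hα n t (hsub ht)).mono hsub) (by rw [h0, h0])
  -- The summand 1 makes the chosen solution live on an interval that extends strictly to the right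
  -- of `t`, so that derivatives can be read off locally.
  set γ : ℝ → E := fun t => α (⌈t / τ⌉₊ + 1) t with hγ
  have hmem : ∀ t, 0 ≤ t → t ∈ Ico 0 (((⌈t / τ⌉₊ + 1 : ℕ) : ℝ) * τ) := by
    intro t ht
    refine ⟨ht, ?_⟩
    rw [← div_lt_iff₀ hτ]
    push_cast
    linarith [Nat.le_ceil (t / τ)]
  have hγeq : ∀ n : ℕ, EqOn γ (α n) (Icc 0 (n * τ)) := by
    intro n t ht
    rcases le_total n (⌈t / τ⌉₊ + 1) with h | h
    · exact (hmono _ _ h ht).symm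
    · exact hmono _ _ h (Ico_subset_Icc_self (hmem t ht.1))
  have hder : ∀ t, 0 ≤ t → HasDerivWithinAt γ (f (γ t)) (Ici 0) t := by
    intro t ht
    have hm := hmem t ht
    have h1 := hα _ t (Ico_subset_Icc_self hm)
    rw [← hγeq _ (Ico_subset_Icc_self hm)] at h1
    refine (h1.congr (hγeq _) (hγeq _ (Ico_subset_Icc_self hm))).mono_of_mem_nhdsWithin ?_
    exact mem_nhdsWithin.2 ⟨Iio _, isOpen_Iio, hm.2, fun s hs => ⟨hs.2, hs.1.le⟩⟩
  refine ⟨fun t => γ (max 0 t), ?_, ?_, ?_⟩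
  · have : ContinuousOn γ (Ici 0) := fun t ht => (hder t ht).continuousWithinAt
    exact this.comp_continuous (by fun_prop) (fun t => le_max_left 0 t)
  · simp [γ, h0]
  · intro t ht
    beta_reduce
    rw [max_eq_right ht]
    exact (hder t ht).congr (fun s hs => by rw [max_eq_right (mem_Ici.1 hs)])
      (by rw [max_eq_right ht])

theorem eq_of_hasDerivWithinAt_Ici {K : ℝ≥0} {f : E → E} (hf : LipschitzWith K f)
    {α β : ℝ → E} (hα : ∀ t, 0 ≤ t → HasDerivWithinAt α (f (α t)) (Ici 0) t)
    (hβ : ∀ t, 0 ≤ t → HasDerivWithinAt β (f (β t)) (Ici 0) t) (h : α 0 = β 0) {t : ℝ}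
    (ht : 0 ≤ t) : α t = β t :=
  eqOn_Icc_of_hasDerivWithinAt hf (fun s hs => (hα s hs.1).mono Icc_subset_Ici_self)
    (fun s hs => (hβ s hs.1).mono Icc_subset_Ici_self) h (right_mem_Icc.2 ht)

end ODE

/-! ### A scalar comparison principle -/

/-- Barrier argument: where `D` meets B(t) = c/(2M) (1 - exp(-Mt)) its derivative is at least c - M
B, which exceeds B' = (c/2) exp(-Mt) by c/2. The factor 2 in the denominator is what makes the
comparison strict. -/
theorem le_of_deriv_ge_sub_mul_abs {D D' : ℝ → ℝ} {c M : ℝ} (hc : 0 < c) (hM : 0 < M)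
    (hD : ∀ t, 0 ≤ t → HasDerivWithinAt D (D' t) (Ici 0) t) (h0 : 0 ≤ D 0)
    (hD' : ∀ t, 0 ≤ t → c - M * |D t| ≤ D' t) {t : ℝ} (ht : 0 ≤ t) :
    c / (2 * M) * (1 - Real.exp (-(M * t))) ≤ D t := by
  have h1 : ∀ s, HasDerivAt (fun s => -(c / (2 * M) * (1 - Real.exp (-(M * s)))))
      (-(c / 2 * Real.exp (-(M * s)))) s := by
    intro s
    have e1 : HasDerivAt (fun s : ℝ => -(M * s)) (-M) s := by
      exact (hasDerivAt_const_mul M).neg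
    convert! ((e1.exp.const_sub 1).const_mul (c / (2 * M))).neg using 1
    field_simp
  have key := image_le_of_deriv_right_lt_deriv_boundary' (f := fun s => -D s)
    (f' := fun s => -D' s) (a := 0) (b := t)
    (B := fun s => -(c / (2 * M) * (1 - Real.exp (-(M * s)))))
    (B' := fun s => -(c / 2 * Real.exp (-(M * s))))
    (fun s hs => ((hD s hs.1).neg.continuousWithinAt).mono Icc_subset_Ici_self)
    (fun s hs => (hD s hs.1).neg.mono (Ici_subset_Ici.2 hs.1)) (by simpa using h0)
    (fun s _ => (h1 s).continuousAt.continuousWithinAt)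
    (fun s _ => (h1 s).hasDerivWithinAt) ?_ (right_mem_Icc.2 ht)
  · linarith
  · intro s hs hEq
    have hexp : Real.exp (-(M * s)) ≤ 1 := Real.exp_le_one_iff.2 (by
      have := mul_nonneg hM.le hs.1
      linarith)
    have hEq' : D s = c / (2 * M) * (1 - Real.exp (-(M * s))) := by linarith
    have hpos : 0 ≤ D s := by
      rw [hEq']
      exact mul_nonneg (by positivity) (by linarith)
    have h2 := hD' s hs.1
    rw [abs_of_nonneg hpos, hEq'] at h2
    have h3 : M * (c / (2 * M) * (1 - Real.exp (-(M * s)))) =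
        c / 2 * (1 - Real.exp (-(M * s))) := by
      field_simp
    rw [h3] at h2
    have := mul_pos hc (Real.exp_pos (-(M * s)))
    linarith

/-! ### The mean-field flow

Both the particle system and the Lagrangian form of the conservation law are differential equations
`∂ₜ f s = w (∫ u (f s - f s') dσ(s') - a s)` for `f : C(S, ℝ)`, where `S` is a compact space of
labels with a finite measure `σ`. -/

section Flow

variable {S : Type*} [TopologicalSpace S] [CompactSpace S] [MeasurableSpace S]
  {u w : ℝ → ℝ} {K L : ℝ≥0}

/-- `Φ` is the mean-field flow on `[0, ∞)` with initial datum `p`. -/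
structure IsMeanFieldFlow (u w : ℝ → ℝ) (σ : Measure S) (a p : C(S, ℝ)) (Φ : ℝ → C(S, ℝ)) :
    Prop where
  continuous : Continuous Φ
  initial : Φ 0 = p
  hasDeriv : ∀ t, 0 ≤ t → ∃ F : C(S, ℝ), (∀ s, F s = w (∫ s', u (Φ t s - Φ t s') ∂σ - a s)) ∧
    HasDerivWithinAt Φ F (Ici 0) t

namespace IsMeanFieldFlow

variable {σ : Measure S} {a p : C(S, ℝ)} {Φ : ℝ → C(S, ℝ)}

theorem hasDerivWithinAt_apply (h : IsMeanFieldFlow u w σ a p Φ) {t : ℝ} (ht : 0 ≤ t) (s : S) :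
    HasDerivWithinAt (fun t => Φ t s) (w (∫ s', u (Φ t s - Φ t s') ∂σ - a s)) (Ici 0) t := by
  obtain ⟨F, hF, hd⟩ := h.hasDeriv t ht
  rw [← hF s]
  exact (ContinuousMap.evalCLM ℝ s).hasFDerivAt.comp_hasDerivWithinAt t hd

theorem continuous_uncurry (h : IsMeanFieldFlow u w σ a p Φ) :
    Continuous fun q : ℝ × S => Φ q.1 q.2 :=
  continuous_eval.comp ((h.continuous.comp continuous_fst).prodMk continuous_snd)

end IsMeanFieldFlow

variable [BorelSpace S]

theorem integrable_of_continuous_compactSpace (σ : Measure S) [IsFiniteMeasure σ] {g : S → ℝ}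
    (hg : Continuous g) : Integrable g σ :=
  hg.integrable_of_hasCompactSupport (HasCompactSupport.of_compactSpace g)

theorem integrable_comp_sub (hu : LipschitzWith K u) (σ : Measure S) [IsFiniteMeasure σ]
    (f : C(S, ℝ)) (x : ℝ) : Integrable (fun s => u (x - f s)) σ :=
  integrable_of_continuous_compactSpace σ (hu.continuous.comp (by fun_prop))

theorem abs_integral_comp_sub_sub_le (hu : LipschitzWith K u) (σ : Measure S) [IsFiniteMeasure σ]
    (f g : C(S, ℝ)) (x y C : ℝ) (h : ∀ s, |(x - f s) - (y - g s)| ≤ C) :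
    |∫ s, u (x - f s) ∂σ - ∫ s, u (y - g s) ∂σ| ≤ K * C * σ.real univ := by
  rw [← integral_sub (integrable_comp_sub hu σ f x) (integrable_comp_sub hu σ g y),
    ← Real.norm_eq_abs]
  refine norm_integral_le_of_norm_le_const (ae_of_all _ fun s => ?_)
  refine (hu.dist_le_mul (x - f s) (y - g s)).trans ?_
  rw [Real.dist_eq]
  exact mul_le_mul_of_nonneg_left (h s) K.coe_nonneg

theorem continuous_integral_comp_sub (hu : LipschitzWith K u) (σ : Measure S) [IsFiniteMeasure σ]
    (f : C(S, ℝ)) : Continuous fun x => ∫ s, u (x - f s) ∂σ := by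
  refine (LipschitzWith.of_dist_le_mul (K := K * (σ.real univ).toNNReal)
    fun x y => ?_).continuous
  have := abs_integral_comp_sub_sub_le hu σ f f x y |x - y| (fun s => by
    rw [sub_sub_sub_cancel_right])
  rw [Real.dist_eq, Real.dist_eq]
  refine this.trans (le_of_eq ?_)
  rw [NNReal.coe_mul, Real.coe_toNNReal _ measureReal_nonneg]
  ring

/-- The vector field of the mean-field flow. -/
noncomputable def meanField (hu : LipschitzWith K u) (hw : LipschitzWith L w) (σ : Measure S)
    [IsFiniteMeasure σ] (a f : C(S, ℝ)) : C(S, ℝ) where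
  toFun s := w (∫ s', u (f s - f s') ∂σ - a s)
  continuous_toFun := hw.continuous.comp
    (((continuous_integral_comp_sub hu σ f).comp f.continuous).sub a.continuous)

theorem meanField_apply (hu : LipschitzWith K u) (hw : LipschitzWith L w) (σ : Measure S)
    [IsFiniteMeasure σ] (a f : C(S, ℝ)) (s : S) :
    meanField hu hw σ a f s = w (∫ s', u (f s - f s') ∂σ - a s) := rfl

/-- Each difference f s - f s' moves by at most twice the uniform distance, and the mass is at most
2; this gives the factor 4. Mass 2 leaves room for the (N + 1)/N of the particle measure. -/
theorem lipschitzWith_meanField (hu : LipschitzWith K u) (hw : LipschitzWith L w) (σ : Measure S)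
    [IsFiniteMeasure σ] (hσ : σ.real univ ≤ 2) (a : C(S, ℝ)) :
    LipschitzWith (4 * L * K) (meanField hu hw σ a) := by
  refine LipschitzWith.of_dist_le_mul fun f g => ?_
  rw [ContinuousMap.dist_le (by positivity)]
  intro s
  rw [meanField_apply, meanField_apply]
  refine (hw.dist_le_mul _ _).trans ?_
  rw [Real.dist_eq, sub_sub_sub_cancel_right]
  have h := abs_integral_comp_sub_sub_le hu σ f g (f s) (g s) (2 * dist f g) (fun s' => by
    have h1 := ContinuousMap.dist_apply_le_dist (f := f) (g := g) s
    have h2 := ContinuousMap.dist_apply_le_dist (f := f) (g := g) s'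
    rw [Real.dist_eq] at h1 h2
    rw [abs_le] at h1 h2 ⊢
    constructor <;> linarith)
  have h3 : (K : ℝ) * (2 * dist f g) * σ.real univ ≤ K * (2 * dist f g) * 2 := by gcongr
  calc (L : ℝ) * |∫ s', u (f s - f s') ∂σ - ∫ s', u (g s - g s') ∂σ|
      ≤ L * (K * (2 * dist f g) * 2) := by gcongr; exact h.trans h3
    _ = ((4 * L * K : ℝ≥0) : ℝ) * dist f g := by push_cast; ring

theorem exists_isMeanFieldFlow (hu : LipschitzWith K u) (hw : LipschitzWith L w) (σ : Measure S)
    [IsFiniteMeasure σ] (hσ : σ.real univ ≤ 2) (a p : C(S, ℝ)) :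
    ∃ Φ, IsMeanFieldFlow u w σ a p Φ := by
  obtain ⟨Φ, h1, h2, h3⟩ := exists_global_solution (lipschitzWith_meanField hu hw σ hσ a) p
  exact ⟨Φ, h1, h2, fun t ht => ⟨_, fun s => meanField_apply hu hw σ a _ s, h3 t ht⟩⟩

namespace IsMeanFieldFlow

variable {σ : Measure S} {a p : C(S, ℝ)} {Φ : ℝ → C(S, ℝ)}

/-- The difference of two trajectories with ordered labels is bounded below, uniformly in the
initial distance. -/
theorem sub_ge [IsFiniteMeasure σ] (h : IsMeanFieldFlow u w σ a p Φ) (hu : LipschitzWith K u)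
    (hw : LipschitzWith L w) (hσ : σ.real univ ≤ 2) {b : ℝ} (hb : 0 < b)
    (hdec : ∀ r₁ r₂ : ℝ, r₁ ≤ r₂ → b * (r₂ - r₁) ≤ w r₁ - w r₂) {s₁ s₂ : S}
    (hp : p s₁ ≤ p s₂) (ha : a s₁ < a s₂) {t : ℝ} (ht : 0 ≤ t) :
    b * (a s₂ - a s₁) / (2 * (2 * L * K + 1)) * (1 - Real.exp (-((2 * L * K + 1) * t))) ≤
      Φ t s₂ - Φ t s₁ := by
  refine le_of_deriv_ge_sub_mul_abs (D := fun t => Φ t s₂ - Φ t s₁)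
    (mul_pos hb (sub_pos.2 ha)) (by positivity)
    (fun t ht => (h.hasDerivWithinAt_apply ht s₂).sub (h.hasDerivWithinAt_apply ht s₁))
    (by rw [h.initial]; exact sub_nonneg.2 hp) (fun t _ => ?_) ht
  set A₁ := ∫ s', u (Φ t s₁ - Φ t s') ∂σ
  set A₂ := ∫ s', u (Φ t s₂ - Φ t s') ∂σ
  have h1 : |A₂ - A₁| ≤ K * |Φ t s₂ - Φ t s₁| * 2 := by
    refine (abs_integral_comp_sub_sub_le hu σ (Φ t) (Φ t) (Φ t s₂) (Φ t s₁)
      |Φ t s₂ - Φ t s₁| (fun s => by rw [sub_sub_sub_cancel_right])).trans ?_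
    gcongr
  have h2 : |w (A₂ - a s₁) - w (A₁ - a s₁)| ≤ L * |A₂ - A₁| := by
    simpa [Real.dist_eq] using hw.dist_le_mul (A₂ - a s₁) (A₁ - a s₁)
  -- Strong monotonicity is used with the convolution frozen at `A₂`, which isolates the gain from
  -- the mass coordinates; passing from `A₂` to `A₁` costs only a Lipschitz error in the distance of
  -- the trajectories.
  have h3 := hdec (A₂ - a s₂) (A₂ - a s₁) (by linarith)
  have h4 : (L : ℝ) * |A₂ - A₁| ≤ L * (K * |Φ t s₂ - Φ t s₁| * 2) := by gcongr
  have h5 := neg_abs_le (w (A₂ - a s₁) - w (A₁ - a s₁))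
  have h6 := abs_nonneg (Φ t s₂ - Φ t s₁)
  have h7 : A₂ - a s₁ - (A₂ - a s₂) = a s₂ - a s₁ := by ring
  rw [h7] at h3
  linarith

/-- Grönwall for two trajectories of the same flow: it makes the flow Lipschitz in the label, as the
quadrature estimate requires. The summand 1 in the exponent ensures a rate at least 1, so the
division by the rate in the Grönwall bound can be dropped. -/
theorem abs_sub_le [IsFiniteMeasure σ] (h : IsMeanFieldFlow u w σ a p Φ) (hu : LipschitzWith K u)
    (hw : LipschitzWith L w) (hσ : σ.real univ ≤ 2) (s₁ s₂ : S) {t : ℝ} (ht : 0 ≤ t) :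
    |Φ t s₂ - Φ t s₁| ≤
      (|p s₂ - p s₁| + L * |a s₂ - a s₁|) * Real.exp ((2 * L * K + 1) * t) := by
  set M : ℝ := 2 * L * K + 1 with hM
  have hM1 : 1 ≤ M := by
    have : (0 : ℝ) ≤ 2 * L * K := by positivity
    linarith
  have key := norm_le_gronwallBound_of_norm_deriv_right_le
    (f := fun t => Φ t s₂ - Φ t s₁) (δ := |p s₂ - p s₁|) (K := M) (ε := L * |a s₂ - a s₁|)
    (a := 0) (b := t)
    (fun r hr => (((h.hasDerivWithinAt_apply hr.1 s₂).sub
      (h.hasDerivWithinAt_apply hr.1 s₁)).continuousWithinAt).mono Icc_subset_Ici_self)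
    (fun r hr => ((h.hasDerivWithinAt_apply hr.1 s₂).sub
      (h.hasDerivWithinAt_apply hr.1 s₁)).mono (Ici_subset_Ici.2 hr.1))
    (by rw [h.initial, Real.norm_eq_abs]) ?_ t (right_mem_Icc.2 ht)
  · rw [Real.norm_eq_abs, sub_zero, gronwallBound_of_K_ne_0 (by linarith)] at key
    refine key.trans ?_
    have h1 : L * |a s₂ - a s₁| / M ≤ L * |a s₂ - a s₁| := div_le_self (by positivity) hM1
    have h2 : 0 ≤ Real.exp (M * t) - 1 := by
      have := Real.one_le_exp (x := M * t) (by positivity)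
      linarith
    have h3 := mul_le_mul_of_nonneg_right h1 h2
    have h4 : 0 ≤ L * |a s₂ - a s₁| := by positivity
    linarith
  · intro r _
    set A₁ := ∫ s', u (Φ r s₁ - Φ r s') ∂σ
    set A₂ := ∫ s', u (Φ r s₂ - Φ r s') ∂σ
    have h1 : |A₂ - A₁| ≤ K * |Φ r s₂ - Φ r s₁| * 2 := by
      refine (abs_integral_comp_sub_sub_le hu σ (Φ r) (Φ r) (Φ r s₂) (Φ r s₁)
        |Φ r s₂ - Φ r s₁| (fun s => by rw [sub_sub_sub_cancel_right])).trans ?_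
      gcongr
    have h2 : |w (A₂ - a s₂) - w (A₁ - a s₁)| ≤ L * |(A₂ - a s₂) - (A₁ - a s₁)| := by
      exact hw.dist_le_mul (A₂ - a s₂) (A₁ - a s₁)
    have h3 : |(A₂ - a s₂) - (A₁ - a s₁)| ≤ |A₂ - A₁| + |a s₂ - a s₁| := by
      rw [show (A₂ - a s₂) - (A₁ - a s₁) = (A₂ - A₁) - (a s₂ - a s₁) by ring]
      exact abs_sub _ _
    rw [Real.norm_eq_abs, Real.norm_eq_abs]
    have h6 := abs_nonneg (Φ r s₂ - Φ r s₁)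
    calc _ ≤ _ := h2
      _ ≤ L * (K * |Φ r s₂ - Φ r s₁| * 2 + |a s₂ - a s₁|) := by gcongr; linarith
      _ ≤ _ := by rw [hM]; linarith

/-- Stability of the flow with respect to the measure on the labels. -/
theorem dist_le [IsFiniteMeasure σ] {τ : Measure S} [IsFiniteMeasure τ]
    {Ψ : ℝ → C(S, ℝ)} (hΦ : IsMeanFieldFlow u w σ a p Φ) (hΨ : IsMeanFieldFlow u w τ a p Ψ)
    (hu : LipschitzWith K u) (hw : LipschitzWith L w) (hτ : τ.real univ ≤ 2) {T ε : ℝ}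
    (hT : 0 ≤ T) (hε : 0 ≤ ε) (hclose : ∀ t ∈ Icc 0 T, ∀ s,
      |∫ s', u (Φ t s - Φ t s') ∂σ - ∫ s', u (Φ t s - Φ t s') ∂τ| ≤ ε) :
    dist (Φ T) (Ψ T) ≤ gronwallBound 0 (4 * L * K : ℝ≥0) (L * ε + 0) T := by
  -- `Φ` is treated as an approximate trajectory of the field of `τ`. Hence the two convolutions
  -- need to be close only along `Φ`, not along both flows.
  have key := dist_le_of_approx_trajectories_ODE (f := Φ) (g := Ψ) (a := 0) (b := T)
    (f' := fun t => meanField hu hw σ a (Φ t)) (g' := fun t => meanField hu hw τ a (Ψ t))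
    (v := fun _ => meanField hu hw τ a) (εf := L * ε) (εg := 0) (δ := 0)
    (fun _ => lipschitzWith_meanField hu hw τ hτ a) hΦ.continuous.continuousOn ?_ ?_
    hΨ.continuous.continuousOn ?_ (fun t _ => by rw [dist_self])
    (by rw [hΦ.initial, hΨ.initial, dist_self]) T (right_mem_Icc.2 hT)
  · simpa using key
  · intro t ht
    obtain ⟨F, hF, hd⟩ := hΦ.hasDeriv t ht.1
    have : F = meanField hu hw σ a (Φ t) := ContinuousMap.ext fun s => hF s
    exact (this ▸ hd).mono (Ici_subset_Ici.2 ht.1)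
  · intro t ht
    rw [ContinuousMap.dist_le (by positivity)]
    intro s
    rw [meanField_apply, meanField_apply]
    refine (hw.dist_le_mul _ _).trans ?_
    rw [Real.dist_eq, sub_sub_sub_cancel_right]
    gcongr
    exact hclose t (Ico_subset_Icc_self ht) s
  · intro t ht
    obtain ⟨F, hF, hd⟩ := hΨ.hasDeriv t ht.1
    have : F = meanField hu hw τ a (Ψ t) := ContinuousMap.ext fun s => hF s
    exact (this ▸ hd).mono (Ici_subset_Ici.2 ht.1)

end IsMeanFieldFlow

end Flow

/-! ### Quantile functions -/

/-- Lebesgue measure on `[0, 1]`. -/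
noncomputable abbrev unitVolume : Measure ℝ := volume.restrict (Icc (0 : ℝ) 1)

instance isProbabilityMeasure_unitVolume : IsProbabilityMeasure unitVolume :=
  ⟨by simp [unitVolume]⟩

theorem unitVolume_eq_restrict_Ioo : unitVolume = volume.restrict (Ioo (0 : ℝ) 1) :=
  (Measure.restrict_congr_set Ioo_ae_eq_Icc).symm

theorem ae_unitVolume_mem_Ioo : ∀ᵐ z ∂unitVolume, z ∈ Ioo (0 : ℝ) 1 := by
  rw [unitVolume_eq_restrict_Ioo]
  exact ae_restrict_mem measurableSet_Ioo

theorem unitVolume_apply_of_subset {s : Set ℝ} (hs : MeasurableSet s) (h : s ⊆ Icc 0 1) :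
    unitVolume s = volume s := by
  rw [Measure.restrict_apply hs, inter_eq_left.2 h]

theorem unitVolume_Ioo {a b : ℝ} (ha : 0 ≤ a) (hb : b ≤ 1) :
    unitVolume (Ioo a b) = ENNReal.ofReal (b - a) := by
  rw [unitVolume_apply_of_subset measurableSet_Ioo
    (fun x hx => ⟨ha.trans hx.1.le, hx.2.le.trans hb⟩), Real.volume_Ioo]

theorem unitVolume_Ioc_zero {b : ℝ} (hb : b ≤ 1) :
    unitVolume (Ioc 0 b) = ENNReal.ofReal b := by
  rw [unitVolume_apply_of_subset measurableSet_Ioc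
    (fun x hx => ⟨hx.1.le, hx.2.trans hb⟩), Real.volume_Ioc, sub_zero]

theorem aemeasurable_unitVolume_of_monotoneOn {X : ℝ → ℝ} (hX : MonotoneOn X (Ioo 0 1)) :
    AEMeasurable X unitVolume := by
  rw [unitVolume_eq_restrict_Ioo]
  exact aemeasurable_restrict_of_monotoneOn measurableSet_Ioo hX

section Quantile

variable {μ : Measure ℝ}

theorem quantile_of_pos {z : ℝ} (hz : 0 < z) : quantile μ z = sInf {x | z ≤ cdf μ x} :=
  if_neg (not_le.2 hz)

/-- The set {z ≤ F} is a half-line because F is monotone with limits 0 and 1, and it contains its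
left endpoint because F is right-continuous. -/
theorem quantile_le_iff {z x : ℝ} (hz : z ∈ Ioo (0 : ℝ) 1) :
    quantile μ z ≤ x ↔ z ≤ cdf μ x := by
  rw [quantile_of_pos hz.1]
  have hbdd : BddBelow {x | z ≤ cdf μ x} := by
    obtain ⟨y, hy⟩ := ((tendsto_cdf_atBot μ).eventually (gt_mem_nhds hz.1)).exists
    refine ⟨y, fun x hx => ?_⟩
    by_contra h
    exact absurd ((hx.trans (monotone_cdf μ (not_le.1 h).le)).trans_lt hy) (lt_irrefl _)
  have hne : {x | z ≤ cdf μ x}.Nonempty := by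
    obtain ⟨y, hy⟩ := ((tendsto_cdf_atTop μ).eventually (lt_mem_nhds hz.2)).exists
    exact ⟨y, hy.le⟩
  refine ⟨fun h => ?_, fun h => csInf_le hbdd h⟩
  have hgt : ∀ y, x < y → z ≤ cdf μ y := fun y hy => by
    obtain ⟨s, hs, hsy⟩ := exists_lt_of_csInf_lt hne (h.trans_lt hy)
    exact hs.trans (monotone_cdf μ hsy.le)
  have hlim : Tendsto (cdf μ) (𝓝[>] x) (𝓝 (cdf μ x)) :=
    ((cdf μ).right_continuous x).mono_left (nhdsWithin_mono _ Ioi_subset_Ici_self)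
  refine ge_of_tendsto hlim ?_
  filter_upwards [self_mem_nhdsWithin] with y hy using hgt y hy

theorem monotoneOn_quantile : MonotoneOn (quantile μ) (Ioo 0 1) := fun _ hz₁ _ hz₂ h =>
  (quantile_le_iff hz₁).2 (h.trans ((quantile_le_iff hz₂).1 le_rfl))

theorem aemeasurable_quantile : AEMeasurable (quantile μ) unitVolume :=
  aemeasurable_unitVolume_of_monotoneOn monotoneOn_quantile

/-- Inverse transform sampling: by `quantile_le_iff` the preimage of (-∞, x] is (0, F(x)] up to a
null set. -/
theorem map_quantile [IsProbabilityMeasure μ] : unitVolume.map (quantile μ) = μ := by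
  have : IsProbabilityMeasure (unitVolume.map (quantile μ)) :=
    Measure.isProbabilityMeasure_map aemeasurable_quantile
  refine Measure.ext_of_Iic _ _ fun x => ?_
  rw [Measure.map_apply_of_aemeasurable aemeasurable_quantile measurableSet_Iic,
    ← ofReal_cdf μ x, ← unitVolume_Ioc_zero (cdf_le_one μ x)]
  refine measure_congr ?_
  filter_upwards [ae_unitVolume_mem_Ioo] with z hz
  refine propext ?_
  change quantile μ z ≤ x ↔ 0 < z ∧ z ≤ cdf μ x
  rw [quantile_le_iff hz]
  exact ⟨fun h => ⟨hz.1, h⟩, fun h => h.2⟩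

theorem integral_eq_integral_quantile [IsProbabilityMeasure μ] {f : ℝ → ℝ} (hf : Measurable f) :
    ∫ x, f x ∂μ = ∫ z, f (quantile μ z) ∂unitVolume := by
  conv_lhs => rw [← map_quantile (μ := μ)]
  exact integral_map aemeasurable_quantile hf.aestronglyMeasurable

theorem memLp_quantile [IsProbabilityMeasure μ] {p : ℝ≥0∞} (h : MemLp (fun x : ℝ => x) p μ) :
    MemLp (quantile μ) p unitVolume := by
  rw [← map_quantile (μ := μ)] at h
  exact (memLp_map_measure_iff measurable_id.aestronglyMeasurable aemeasurable_quantile).1 h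

/-- A monotone function with equal values at z₁ < z₂ is constant in between, and its law then has an
atom of mass at least z₂ - z₁. -/
theorem strictMonoOn_of_map_noAtoms {X : ℝ → ℝ} (hX : MonotoneOn X (Ioo 0 1))
    (h : ∀ x, unitVolume.map X {x} = 0) : StrictMonoOn X (Ioo 0 1) := by
  intro z₁ hz₁ z₂ hz₂ h12
  refine (hX hz₁ hz₂ h12.le).lt_of_ne fun heq => ?_
  have h0 := h (X z₁)
  rw [Measure.map_apply_of_aemeasurable (aemeasurable_unitVolume_of_monotoneOn hX)
    (measurableSet_singleton _)] at h0
  have hsub : Ioo z₁ z₂ ⊆ X ⁻¹' {X z₁} := fun z hz => by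
    have hz' : z ∈ Ioo (0 : ℝ) 1 := ⟨hz₁.1.trans hz.1, hz.2.trans hz₂.2⟩
    exact le_antisymm ((hX hz' hz₂ hz.2.le).trans heq.ge) (hX hz₁ hz' hz.1.le)
  have h1 := measure_mono_null hsub h0
  rw [unitVolume_Ioo hz₁.1.le hz₂.2.le, ENNReal.ofReal_eq_zero] at h1
  linarith

/-- A monotone function on `(0, 1)` is, up to a countable set, the quantile function of its law. -/
theorem quantile_map_ae_eq {X : ℝ → ℝ} (hX : MonotoneOn X (Ioo 0 1)) :
    quantile (unitVolume.map X) =ᵐ[unitVolume] X := by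
  have hm := aemeasurable_unitVolume_of_monotoneOn hX
  have hP : IsProbabilityMeasure (unitVolume.map X) := Measure.isProbabilityMeasure_map hm
  have hcdf : ∀ x, ENNReal.ofReal (cdf (unitVolume.map X) x) = unitVolume (X ⁻¹' Iic x) :=
    fun x => by
      rw [ofReal_cdf, Measure.map_apply_of_aemeasurable hm measurableSet_Iic]
  have hle : ∀ z ∈ Ioo (0 : ℝ) 1, quantile (unitVolume.map X) z ≤ X z := fun z hz => by
    rw [quantile_le_iff hz, ← ENNReal.ofReal_le_ofReal_iff (cdf_nonneg _ _), hcdf]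
    calc ENNReal.ofReal z = unitVolume (Ioo 0 z) := by
          rw [unitVolume_Ioo le_rfl hz.2.le, sub_zero]
      _ ≤ _ := measure_mono fun y hy => hX ⟨hy.1, hy.2.trans hz.2⟩ hz hy.2.le
  -- Otherwise `X` could stay below the quantile at `z` only on (0, y], a set of measure less than
  -- `z`.
  have hge : ∀ z ∈ Ioo (0 : ℝ) 1, ∀ y ∈ Ioo (0 : ℝ) z, X y ≤ quantile (unitVolume.map X) z := by
    intro z hz y hy
    by_contra hlt
    rw [not_le] at hlt
    have h1 := (quantile_le_iff hz).1 (le_refl (quantile (unitVolume.map X) z))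
    rw [← ENNReal.ofReal_le_ofReal_iff (cdf_nonneg _ _), hcdf] at h1
    have h2 : unitVolume (X ⁻¹' Iic (quantile (unitVolume.map X) z)) ≤ unitVolume (Ioc 0 y) := by
      refine measure_mono_ae ?_
      filter_upwards [ae_unitVolume_mem_Ioo] with w hw hwq
      refine ⟨hw.1, ?_⟩
      by_contra hyw
      rw [not_le] at hyw
      exact absurd (((hX ⟨hy.1, hy.2.trans hz.2⟩ hw hyw.le).trans hwq).trans_lt hlt) (lt_irrefl _)
    rw [unitVolume_Ioc_zero (hy.2.trans hz.2).le] at h2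
    exact absurd ((ENNReal.ofReal_le_ofReal_iff hy.1.le).1 (h1.trans h2)) (not_le.2 hy.2)
  filter_upwards [ae_unitVolume_mem_Ioo, hX.countable_not_continuousWithinAt.ae_notMem unitVolume]
    with z hz hcont
  have hc : ContinuousWithinAt X (Ioo 0 1) z := by
    by_contra h
    exact hcont ⟨hz, h⟩
  refine le_antisymm (hle z hz) ?_
  -- At a continuity point of `X` the bounds at y < z pass to the limit.
  have hlim : Tendsto X (𝓝[<] z) (𝓝 (X z)) :=
    hc.mono_left (nhdsWithin_le_of_mem (mem_of_superset (Ioo_mem_nhdsLT hz.1)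
      (Ioo_subset_Ioo_right hz.2.le)))
  refine le_of_tendsto hlim ?_
  filter_upwards [Ioo_mem_nhdsLT hz.1] with y hy using hge z hz y hy

/-- Compact support keeps the quantile function finite and monotone up to the endpoints 0 and 1,
where the two extreme particles start. -/
theorem exists_quantile_mem_Icc [IsProbabilityMeasure μ] (hμ : IsCompact μ.support) :
    ∃ R : ℝ, (∀ z ∈ Icc (0 : ℝ) 1, quantile μ z ∈ Icc (-R) R) ∧
      MonotoneOn (quantile μ) (Icc 0 1) := by
  obtain ⟨R, hR⟩ := hμ.isBounded.subset_closedBall 0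
  rw [Real.closedBall_eq_Icc, zero_sub, zero_add] at hR
  have hnull : μ (Icc (-R) R)ᶜ = 0 :=
    measure_mono_null (compl_subset_compl.2 hR) Measure.measure_compl_support
  have h1 : cdf μ R = 1 := by
    have : μ (Iic R) = 1 := by
      rw [← prob_compl_eq_zero_iff measurableSet_Iic]
      exact measure_mono_null (compl_subset_compl.2 Icc_subset_Iic_self) hnull
    rw [cdf_eq_real, measureReal_def, this, ENNReal.toReal_one]
  have h0 : ∀ x, 0 < cdf μ x → -R ≤ x := by
    intro x hx
    by_contra h
    have : μ (Iic x) = 0 := by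
      refine measure_mono_null (fun y hy => ?_) hnull
      exact fun hy' => h (hy'.1.trans hy)
    rw [cdf_eq_real, measureReal_def, this, ENNReal.toReal_zero] at hx
    exact lt_irrefl _ hx
  have hbdd : BddBelow {x | 0 < cdf μ x} := ⟨-R, fun x hx => h0 x hx⟩
  have hbdd' : ∀ z, 0 < z → BddBelow {x | z ≤ cdf μ x} :=
    fun z hz => ⟨-R, fun x hx => h0 x (hz.trans_le hx)⟩
  have hmem : R ∈ {x | 0 < cdf μ x} := by simp [h1]
  have hmem' : ∀ z, z ≤ 1 → R ∈ {x | z ≤ cdf μ x} := fun z hz => by simpa [h1] using hz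
  refine ⟨R, fun z hz => ?_, fun z₁ hz₁ z₂ hz₂ h12 => ?_⟩
  · rcases hz.1.eq_or_lt with rfl | hpos
    · rw [quantile, if_pos le_rfl]
      exact ⟨le_csInf ⟨R, hmem⟩ fun x hx => h0 x hx, csInf_le hbdd hmem⟩
    · rw [quantile_of_pos hpos]
      exact ⟨le_csInf ⟨R, hmem' z hz.2⟩ fun x hx => h0 x (hpos.trans_le hx),
        csInf_le (hbdd' z hpos) (hmem' z hz.2)⟩
  · rcases hz₂.1.eq_or_lt with rfl | hpos₂
    · rw [le_antisymm h12 hz₁.1]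
    · rw [quantile_of_pos hpos₂]
      rcases hz₁.1.eq_or_lt with rfl | hpos₁
      · rw [quantile, if_pos le_rfl]
        exact csInf_le_csInf hbdd ⟨R, hmem' z₂ hz₂.2⟩ fun x hx => hpos₂.trans_le hx
      · rw [quantile_of_pos hpos₁]
        exact csInf_le_csInf (hbdd' z₁ hpos₁) ⟨R, hmem' z₂ hz₂.2⟩ fun x hx => h12.trans hx

end Quantile

/-! ### The nonlocal velocity along quantile functions -/

/-- An average dominates some value of the averaged function; if the kernel is not integrable its
integral is 0 by convention, and 0 = V(1). So `w` and `v` agree at every convolution with a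
probability measure. -/
theorem exists_le_integral_kernel {V : ℝ → ℝ} {lam : ℝ} (hV : InteractionKernel V lam)
    (μ : Measure ℝ) [IsProbabilityMeasure μ] (x : ℝ) : ∃ y, V y ≤ ∫ y, V (x - y) ∂μ := by
  by_cases h : Integrable (fun y => V (x - y)) μ
  · obtain ⟨y, hy⟩ := exists_le_integral h
    exact ⟨x - y, hy⟩
  · rw [integral_undef h]
    exact ⟨1, (hV.eq_zero_of_pos one_pos).le⟩

/-- V = U - λ 1_{(0,∞)}, and strict monotonicity makes X z - X y positive exactly for y < z, a set
of measure z. -/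
theorem integral_kernel_eq {V : ℝ → ℝ} {lam : ℝ} (hV : InteractionKernel V lam) {X : ℝ → ℝ}
    (hX : StrictMonoOn X (Ioo 0 1)) (hint : Integrable X unitVolume) {z : ℝ}
    (hz : z ∈ Ioo (0 : ℝ) 1) :
    ∫ y, V (X z - y) ∂(unitVolume.map X) =
      ∫ y, U V lam (X z - X y) ∂unitVolume - lam * z := by
  obtain ⟨K, hK⟩ := hV.exists_lipschitzWith_U
  have hm := aemeasurable_unitVolume_of_monotoneOn hX.monotoneOn
  rw [integral_map (f := fun y => V (X z - y)) hm (hV.measurable.comp (by fun_prop)).aestronglyMeasurable]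
  have hU : Integrable (fun y => U V lam (X z - X y)) unitVolume := by
    have h1 : Integrable (fun y => |U V lam 0| + K * |X z - X y|) unitVolume :=
      (integrable_const _).add (((integrable_const _).sub hint).abs.const_mul _)
    refine h1.mono' (hK.continuous.measurable.comp_aemeasurable
      (aemeasurable_const.sub hm)).aestronglyMeasurable (ae_of_all _ fun y => ?_)
    have := hK.dist_le_mul (X z - X y) 0
    rw [Real.dist_eq, Real.dist_eq, sub_zero] at this
    rw [Real.norm_eq_abs]
    linarith [abs_sub_abs_le_abs_sub (U V lam (X z - X y)) (U V lam 0)]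
  have hI : Integrable ((Ioo 0 z).indicator fun _ => lam) unitVolume :=
    (integrable_const lam).indicator measurableSet_Ioo
  have h2 : ∫ y, (Ioo 0 z).indicator (fun _ => lam) y ∂unitVolume = lam * z := by
    rw [integral_indicator measurableSet_Ioo, setIntegral_const, measureReal_def,
      unitVolume_Ioo le_rfl hz.2.le, sub_zero, ENNReal.toReal_ofReal hz.1.le, smul_eq_mul, mul_comm]
  rw [← h2, ← integral_sub hU hI]
  refine integral_congr_ae ?_
  filter_upwards [ae_unitVolume_mem_Ioo] with y hy
  rcases lt_or_ge y z with h | h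
  · have := hX hy hz h
    rw [indicator_of_mem (show y ∈ Ioo 0 z from ⟨hy.1, h⟩), hV.eq_zero_of_pos (sub_pos.2 this),
      hV.U_of_nonneg (sub_pos.2 this).le, sub_self]
  · have := hX.monotoneOn hz hy h
    rw [indicator_of_notMem (fun hy' => absurd hy'.2 (not_lt.2 h)),
      InteractionKernel.U_of_nonpos V lam (sub_nonpos.2 this), sub_zero]

/-! ### Lagrangian flow of the continuum equation -/

/-- `X` is the Lagrangian flow on `[0, 1]` issued from the quantile function `q`; `c` is a lower
bound for its expansion. -/
structure IsQuantileFlow (V w : ℝ → ℝ) (lam : ℝ) (q c : ℝ → ℝ) (X : ℝ → ℝ → ℝ) : Prop where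
  measurable : Measurable (Function.uncurry X)
  initial : ∀ z ∈ Icc (0 : ℝ) 1, X 0 z = q z
  nonneg : ∀ t, 0 ≤ t → 0 ≤ c t
  pos : ∀ t, 0 < t → 0 < c t
  expanding : ∀ t, 0 ≤ t → ∀ z₁ ∈ Icc (0 : ℝ) 1, ∀ z₂ ∈ Icc (0 : ℝ) 1, z₁ ≤ z₂ →
    c t * (z₂ - z₁) ≤ X t z₂ - X t z₁
  hasDeriv : ∀ t, 0 ≤ t → ∀ z ∈ Icc (0 : ℝ) 1, HasDerivWithinAt (fun s => X s z)
    (w (∫ y, U V lam (X t z - X t y) ∂unitVolume - lam * z)) (Ici 0) t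
  uniform : ∀ s ε, 0 < ε → ∀ᶠ t in 𝓝 s, ∀ z, |X t z - X s z| ≤ ε
  bounded : ∀ T, ∃ B, ∀ t ∈ Icc 0 T, ∀ z, |X t z| ≤ B

/-- Labels: an initial position in `[-R, R]` and a mass coordinate. -/
abbrev Label (R : ℝ) : Type := Icc (-R) R × Icc (0 : ℝ) 2

/-- The position of a label. -/
def Label.position (R : ℝ) : C(Label R, ℝ) := ⟨fun s => s.1, by fun_prop⟩

/-- The mass coordinate of a label, scaled by `lam`. -/
def Label.mass (R lam : ℝ) : C(Label R, ℝ) := ⟨fun s => lam * s.2, by fun_prop⟩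

/-- The label with position `x` and mass coordinate `m`, projected to the allowed range. -/
noncomputable def Label.mk {R : ℝ} (hR : -R ≤ R) (x m : ℝ) : Label R :=
  (projIcc (-R) R hR x, projIcc 0 2 zero_le_two m)

theorem Label.position_mk {R : ℝ} (hR : -R ≤ R) {x : ℝ} (m : ℝ) (hx : x ∈ Icc (-R) R) :
    Label.position R (Label.mk hR x m) = x := by
  simp [Label.position, Label.mk, projIcc_of_mem hR hx]

theorem Label.mass_mk {R : ℝ} (lam : ℝ) (hR : -R ≤ R) (x : ℝ) {m : ℝ} (hm : m ∈ Icc (0 : ℝ) 2) :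
    Label.mass R lam (Label.mk hR x m) = lam * m := by
  simp [Label.mass, Label.mk, projIcc_of_mem _ hm]

/-- The curve of labels belonging to a quantile function. -/
noncomputable def quantileLabel {R : ℝ} (hR : -R ≤ R) (q : ℝ → ℝ) (z : ℝ) : Label R :=
  Label.mk hR (q (projIcc 0 1 zero_le_one z)) (projIcc 0 1 zero_le_one z)

section QuantileFlow

variable {R : ℝ} {hR : -R ≤ R} {q : ℝ → ℝ}

theorem quantileLabel_of_mem {z : ℝ} (hz : z ∈ Icc (0 : ℝ) 1) :
    quantileLabel hR q z = Label.mk hR (q z) z := by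
  rw [quantileLabel, projIcc_of_mem _ hz]

theorem measurable_quantileLabel (hq : MonotoneOn q (Icc 0 1)) :
    Measurable (quantileLabel hR q) := by
  have h1 : Monotone fun z : ℝ => q (projIcc 0 1 zero_le_one z) := fun a b hab =>
    hq (projIcc 0 1 zero_le_one a).2 (projIcc 0 1 zero_le_one b).2 (monotone_projIcc _ hab)
  have h2 : Measurable fun z : ℝ => ((projIcc 0 1 zero_le_one z : Icc (0 : ℝ) 1) : ℝ) :=
    (continuous_subtype_val.comp continuous_projIcc).measurable
  exact (continuous_projIcc.measurable.comp h1.measurable).prodMk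
    (continuous_projIcc.measurable.comp h2)

/-- Along the curve of labels the mass coordinate is z itself, so the separation of labels in
`IsMeanFieldFlow.sub_ge` becomes expansion in z, and integrals over labels become integrals over [0,
1]. -/
theorem isQuantileFlow_of_isMeanFieldFlow {V w : ℝ → ℝ} {lam : ℝ} {K L : ℝ≥0} {b : ℝ}
    {Φ : ℝ → C(Label R, ℝ)} (hq : MonotoneOn q (Icc 0 1)) (hqR : ∀ z ∈ Icc (0 : ℝ) 1, q z ∈ Icc (-R) R)
    (hu : LipschitzWith K (U V lam)) (hw : LipschitzWith L w) (hb : 0 < b) (hlam : 0 < lam)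
    (hdec : ∀ r₁ r₂ : ℝ, r₁ ≤ r₂ → b * (r₂ - r₁) ≤ w r₁ - w r₂)
    (hΦ : IsMeanFieldFlow (U V lam) w (unitVolume.map (quantileLabel hR q)) (Label.mass R lam)
      (Label.position R) Φ) :
    IsQuantileFlow V w lam q
      (fun t => b * lam / (2 * (2 * L * K + 1)) * (1 - Real.exp (-((2 * L * K + 1) * t))))
      (fun t z => Φ t (quantileLabel hR q z)) := by
  have hmeas := measurable_quantileLabel (hR := hR) hq
  have hprob : IsProbabilityMeasure (unitVolume.map (quantileLabel hR q)) :=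
    Measure.isProbabilityMeasure_map hmeas.aemeasurable
  have hσ : (unitVolume.map (quantileLabel hR q)).real univ ≤ 2 := by
    rw [probReal_univ]; norm_num
  have hM : (0 : ℝ) < 2 * L * K + 1 := by positivity
  have hmass : ∀ z ∈ Icc (0 : ℝ) 1, Label.mass R lam (quantileLabel hR q z) = lam * z :=
    fun z hz => by
      rw [quantileLabel_of_mem hz, Label.mass_mk _ _ _ ⟨hz.1, hz.2.trans one_le_two⟩]
  have hpos : ∀ z ∈ Icc (0 : ℝ) 1, Label.position R (quantileLabel hR q z) = q z :=
    fun z hz => by rw [quantileLabel_of_mem hz, Label.position_mk _ _ (hqR z hz)]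
  refine ⟨?_, ?_, ?_, ?_, ?_, ?_, ?_, ?_⟩
  · exact hΦ.continuous_uncurry.measurable.comp
      (measurable_fst.prodMk (hmeas.comp measurable_snd))
  · intro z hz
    rw [hΦ.initial, hpos z hz]
  · intro t ht
    have : Real.exp (-((2 * L * K + 1) * t)) ≤ 1 := Real.exp_le_one_iff.2 (by
      have := mul_nonneg hM.le ht
      linarith)
    exact mul_nonneg (by positivity) (by linarith)
  · intro t ht
    have : Real.exp (-((2 * L * K + 1) * t)) < 1 := Real.exp_lt_one_iff.2 (by
      have := mul_pos hM ht
      linarith)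
    exact mul_pos (by positivity) (by linarith)
  · intro t ht z₁ hz₁ z₂ hz₂ h12
    rcases h12.eq_or_lt with rfl | hlt
    · simp
    · have := hΦ.sub_ge hu hw hσ hb hdec (s₁ := quantileLabel hR q z₁)
        (s₂ := quantileLabel hR q z₂) (by rw [hpos _ hz₁, hpos _ hz₂]; exact hq hz₁ hz₂ h12)
        (by rw [hmass _ hz₁, hmass _ hz₂]; exact mul_lt_mul_of_pos_left hlt hlam) ht
      rw [hmass _ hz₁, hmass _ hz₂] at this
      refine le_trans (le_of_eq ?_) this
      ring
  · intro t ht z hz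
    have := hΦ.hasDerivWithinAt_apply ht (quantileLabel hR q z)
    rw [hmass z hz, integral_map (f := fun s => U V lam (Φ t (quantileLabel hR q z) - Φ t s))
      hmeas.aemeasurable (hu.continuous.comp (by fun_prop)).aestronglyMeasurable] at this
    exact this
  · intro s ε hε
    filter_upwards [(hΦ.continuous.tendsto s).eventually (Metric.ball_mem_nhds _ hε)] with t ht z
    refine le_trans ?_ (le_of_lt (Metric.mem_ball.1 ht))
    have := ContinuousMap.dist_apply_le_dist (f := Φ t) (g := Φ s) (quantileLabel hR q z)
    rwa [Real.dist_eq] at this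
  · intro T
    obtain ⟨B, hB⟩ := (isCompact_Icc.image hΦ.continuous).isBounded.exists_norm_le
      (s := Φ '' Icc 0 T)
    exact ⟨B, fun t ht z =>
      ((Φ t).norm_coe_le_norm _).trans (hB _ (mem_image_of_mem _ ht))⟩

end QuantileFlow

/-! ### Densities -/

/-- Continued with slope `c` outside [0, 1], the function expands distances by at least `c` on the
whole line. Taking preimages then multiplies one-dimensional Hausdorff measure by at most 1 / c. -/
theorem map_unitVolume_le_of_expanding {X : ℝ → ℝ} (hm : Measurable X) {c : ℝ} (hc : 0 < c)
    (hX : ∀ z₁ ∈ Icc (0 : ℝ) 1, ∀ z₂ ∈ Icc (0 : ℝ) 1, z₁ ≤ z₂ → c * (z₂ - z₁) ≤ X z₂ - X z₁) :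
    unitVolume.map X ≤ ENNReal.ofReal c⁻¹ • volume := by
  set π : ℝ → ℝ := fun z => (projIcc 0 1 zero_le_one z : Icc (0 : ℝ) 1)
  set Y : ℝ → ℝ := fun z => X (π z) + c * (z - π z) with hY
  have hπ : ∀ z, π z ∈ Icc (0 : ℝ) 1 := fun z => (projIcc 0 1 zero_le_one z).2
  have hmono : ∀ a b, a ≤ b → c * (b - a) ≤ Y b - Y a := fun a b hab => by
    have h1 : π a ≤ π b := monotone_projIcc _ hab
    have h2 := hX _ (hπ a) _ (hπ b) h1
    simp only [hY]
    linarith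
  have hanti : AntilipschitzWith c⁻¹.toNNReal Y := by
    refine AntilipschitzWith.of_le_mul_dist fun a b => ?_
    rw [Real.coe_toNNReal _ (inv_nonneg.2 hc.le), Real.dist_eq, Real.dist_eq,
      ← div_eq_inv_mul, le_div_iff₀ hc]
    rcases le_total a b with h | h
    · have := hmono a b h
      rw [abs_sub_comm, abs_of_nonneg (sub_nonneg.2 h), abs_sub_comm (Y a)]
      linarith [le_abs_self (Y b - Y a)]
    · have := hmono b a h
      rw [abs_of_nonneg (sub_nonneg.2 h)]
      linarith [le_abs_self (Y a - Y b)]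
  refine Measure.le_iff.2 fun B hB => ?_
  rw [Measure.map_apply hm hB, Measure.restrict_apply (hm hB)]
  have h1 := hanti.hausdorffMeasure_preimage_le zero_le_one B
  rw [hausdorffMeasure_real, ENNReal.rpow_one] at h1
  refine (measure_mono fun z hz => ?_).trans h1
  have : π z = z := by
    simp only [π]
    rw [projIcc_of_mem _ hz.2]
  change X (π z) + c * (z - π z) ∈ B
  rw [this, sub_self, mul_zero, add_zero]
  exact hz.1

/-- The upper right derivative of the distribution function of `μ` along the sequence
`1 / (n + 1)`. -/
noncomputable def rightDensity (μ : Measure ℝ) (x : ℝ) : ℝ :=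
  (limsup (fun n : ℕ => ENNReal.ofReal ((n + 1) * (cdf μ (x + 1 / (n + 1)) - cdf μ x)))
    atTop).toReal

theorem rightDensity_nonneg (μ : Measure ℝ) (x : ℝ) : 0 ≤ rightDensity μ x :=
  ENNReal.toReal_nonneg

/-- An explicit formula for the density inherits joint measurability in space and time from the
distribution function; densities chosen separately at each time need not have it. -/
theorem measurable_rightDensity {β : Type*} [MeasurableSpace β] {μ : β → Measure ℝ}
    (h : Measurable fun q : ℝ × β => cdf (μ q.2) q.1) :
    Measurable fun q : ℝ × β => rightDensity (μ q.2) q.1 := by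
  refine Measurable.ennreal_toReal (Measurable.limsup fun n => ?_)
  have h1 : Measurable fun q : ℝ × β => cdf (μ q.2) (q.1 + 1 / ((n : ℝ) + 1)) :=
    h.comp ((measurable_fst.add_const _).prodMk measurable_snd)
  exact ((h1.sub h).const_mul _).ennreal_ofReal

theorem rightDensity_le {μ : Measure ℝ} [IsProbabilityMeasure μ] {C : ℝ} (hC : 0 ≤ C)
    (h : μ ≤ ENNReal.ofReal C • volume) (x : ℝ) : rightDensity μ x ≤ C := by
  refine ENNReal.toReal_le_of_le_ofReal hC ?_
  refine limsup_le_of_le (h := Eventually.of_forall fun n => ENNReal.ofReal_le_ofReal ?_)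
  have hn : (0 : ℝ) < n + 1 := by positivity
  have h1 : μ (Ioc x (x + 1 / ((n : ℝ) + 1))) ≤ ENNReal.ofReal (C * (1 / (n + 1))) := by
    refine (h _).trans (le_of_eq ?_)
    rw [Measure.smul_apply, Real.volume_Ioc, smul_eq_mul, add_sub_cancel_left,
      ENNReal.ofReal_mul hC]
  have h2 : ENNReal.ofReal (cdf μ (x + 1 / ((n : ℝ) + 1)) - cdf μ x) =
      μ (Ioc x (x + 1 / ((n : ℝ) + 1))) := by
    conv_rhs => rw [← measure_cdf μ]
    rw [StieltjesFunction.measure_Ioc]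
  rw [← h2] at h1
  have h3 := (ENNReal.ofReal_le_ofReal_iff (by positivity)).1 h1
  calc (n + 1) * (cdf μ (x + 1 / ((n : ℝ) + 1)) - cdf μ x)
      ≤ (n + 1) * (C * (1 / (n + 1))) := by gcongr
    _ = C := by field_simp

/-- The distribution function is differentiable almost everywhere with derivative the Radon–Nikodym
derivative, so almost everywhere the upper limit is a limit. -/
theorem eq_withDensity_rightDensity {μ : Measure ℝ} [IsProbabilityMeasure μ] (h : μ ≪ volume) :
    μ = volume.withDensity fun x => ENNReal.ofReal (rightDensity μ x) := by
  have key : (fun x => ENNReal.ofReal (rightDensity μ x)) =ᵐ[volume] μ.rnDeriv volume := by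
    have h1 := (cdf μ).ae_hasDerivAt
    rw [measure_cdf] at h1
    filter_upwards [h1, μ.rnDeriv_ne_top volume] with x hx htop
    have hseq : Tendsto (fun n : ℕ => (1 / ((n : ℝ) + 1))) atTop (𝓝[≠] 0) := by
      refine tendsto_nhdsWithin_iff.2 ⟨tendsto_one_div_add_atTop_nhds_zero_nat,
        Eventually.of_forall fun n => ?_⟩
      have : (0 : ℝ) < 1 / ((n : ℝ) + 1) := by positivity
      exact this.ne'
    have h2 := (hasDerivAt_iff_tendsto_slope_zero.1 hx).comp hseq
    have h3 : Tendsto (fun n : ℕ =>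
        ENNReal.ofReal ((n + 1) * (cdf μ (x + 1 / (n + 1)) - cdf μ x))) atTop
        (𝓝 (ENNReal.ofReal (μ.rnDeriv volume x).toReal)) := by
      refine ENNReal.tendsto_ofReal (h2.congr fun n => ?_)
      simp
    rw [rightDensity, h3.limsup_eq, ENNReal.toReal_ofReal ENNReal.toReal_nonneg,
      ENNReal.ofReal_toReal htop]
  rw [withDensity_congr_ae key, Measure.withDensity_rnDeriv_eq _ _ h]

theorem hasBoundedDensity_of_le {μ : Measure ℝ} [IsProbabilityMeasure μ] {C : ℝ} (hC : 0 ≤ C)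
    (h : μ ≤ ENNReal.ofReal C • volume) : HasBoundedDensity μ := by
  refine ⟨rightDensity μ, rightDensity_nonneg μ, ?_,
    eq_withDensity_rightDensity (Measure.absolutelyContinuous_of_le_smul h)⟩
  have hm : Measurable (rightDensity μ) := by
    have h1 : Measurable fun q : ℝ × Unit => cdf μ q.1 :=
      (monotone_cdf μ).measurable.comp measurable_fst
    have h2 : Measurable fun q : ℝ × Unit => rightDensity μ q.1 :=
      measurable_rightDensity (μ := fun _ : Unit => μ) h1
    exact Measurable.comp (f := fun x : ℝ => (x, ())) h2 measurable_prodMk_right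
  exact memLp_top_of_bound hm.aestronglyMeasurable C (ae_of_all _ fun x => by
    rw [Real.norm_eq_abs, abs_of_nonneg (rightDensity_nonneg μ x)]
    exact rightDensity_le hC h x)

/-! ### The Lagrangian flow yields a dissipative solution -/

theorem measurable_integral_kernel {V : ℝ → ℝ} {lam : ℝ} (hV : InteractionKernel V lam)
    (μ : Measure ℝ) [SFinite μ] : Measurable fun x => ∫ y, V (x - y) ∂μ := by
  have h : StronglyMeasurable (Function.uncurry fun x y : ℝ => V (x - y)) :=
    (hV.measurable.comp (measurable_fst.sub measurable_snd)).stronglyMeasurable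
  exact h.integral_prod_right.measurable

theorem deriv_fst_eq_fderiv {φ : ℝ × ℝ → ℝ} (hφ : ContDiff ℝ 1 φ) (x t : ℝ) :
    deriv (fun ξ => φ (ξ, t)) x = fderiv ℝ φ (x, t) (1, 0) := by
  have h1 := (hφ.differentiable one_ne_zero (x, t)).hasFDerivAt
  exact (h1.comp_hasDerivAt x ((hasDerivAt_id x).prodMk (hasDerivAt_const x t))).deriv

theorem deriv_snd_eq_fderiv {φ : ℝ × ℝ → ℝ} (hφ : ContDiff ℝ 1 φ) (x t : ℝ) :
    deriv (fun s => φ (x, s)) t = fderiv ℝ φ (x, t) (0, 1) := by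
  have h1 := (hφ.differentiable one_ne_zero (x, t)).hasFDerivAt
  exact (h1.comp_hasDerivAt t ((hasDerivAt_const t x).prodMk (hasDerivAt_id t))).deriv

namespace IsQuantileFlow

variable {V v w : ℝ → ℝ} {lam : ℝ} {q c : ℝ → ℝ} {X : ℝ → ℝ → ℝ} {K L : ℝ≥0}

theorem measurable_apply (h : IsQuantileFlow V w lam q c X) (t : ℝ) : Measurable (X t) :=
  h.measurable.comp (measurable_const.prodMk measurable_id)

theorem monotoneOn (h : IsQuantileFlow V w lam q c X) {t : ℝ} (ht : 0 ≤ t) :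
    MonotoneOn (X t) (Ioo 0 1) := fun a ha b hb hab => by
  have h1 := h.expanding t ht a (Ioo_subset_Icc_self ha) b (Ioo_subset_Icc_self hb) hab
  have h2 := mul_nonneg (h.nonneg t ht) (sub_nonneg.2 hab)
  linarith

theorem strictMonoOn (h : IsQuantileFlow V w lam q c X) {t : ℝ} (ht : 0 < t) :
    StrictMonoOn (X t) (Ioo 0 1) := fun a ha b hb hab => by
  have h1 := h.expanding t ht.le a (Ioo_subset_Icc_self ha) b (Ioo_subset_Icc_self hb) hab.le
  have h2 := mul_pos (h.pos t ht) (sub_pos.2 hab)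
  linarith

theorem memLp (h : IsQuantileFlow V w lam q c X) (p : ℝ≥0∞) {t : ℝ} (ht : 0 ≤ t) :
    MemLp (X t) p unitVolume := by
  obtain ⟨B, hB⟩ := h.bounded t
  exact MemLp.of_bound (h.measurable_apply t).aestronglyMeasurable B
    (ae_of_all _ fun z => hB t ⟨ht, le_rfl⟩ z)

theorem isProbabilityMeasure_map (h : IsQuantileFlow V w lam q c X) (t : ℝ) :
    IsProbabilityMeasure (unitVolume.map (X t)) :=
  Measure.isProbabilityMeasure_map (h.measurable_apply t).aemeasurable

theorem map_le (h : IsQuantileFlow V w lam q c X) {t : ℝ} (ht : 0 < t) :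
    unitVolume.map (X t) ≤ ENNReal.ofReal (c t)⁻¹ • volume :=
  map_unitVolume_le_of_expanding (h.measurable_apply t) (h.pos t ht) (h.expanding t ht.le)

/-- The distribution function at (x, t) is the measure of the slice {z : X t z ≤ x} of a measurable
set. -/
theorem measurable_cdf (h : IsQuantileFlow V w lam q c X) :
    Measurable fun x : ℝ × ℝ => cdf (unitVolume.map (X x.2)) x.1 := by
  have hS : MeasurableSet {y : (ℝ × ℝ) × ℝ | X y.1.2 y.2 ≤ y.1.1} :=
    measurableSet_le (h.measurable.comp ((measurable_snd.comp measurable_fst).prodMk measurable_snd))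
      (measurable_fst.comp measurable_fst)
  have h1 := (measurable_measure_prodMk_left (ν := unitVolume) hS).ennreal_toReal
  convert! h1 using 2 with x
  have := h.isProbabilityMeasure_map x.2
  rw [cdf_eq_real, measureReal_def,
    Measure.map_apply (h.measurable_apply x.2) measurableSet_Iic]
  rfl

/-- This links the Lagrangian velocity, written with `U` and `w`, to the Eulerian one, written with
`V` and `v`. Positive time matters: the initial measure may have atoms, and then its quantile
function is not strictly increasing. -/
theorem nonlocal_velocity_eq (h : IsQuantileFlow V w lam q c X) (hV : InteractionKernel V lam)
    (hwv : ∀ r, (∃ x, V x ≤ r) → w r = v r) {t : ℝ} (ht : 0 < t) {z : ℝ}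
    (hz : z ∈ Ioo (0 : ℝ) 1) :
    W V v (unitVolume.map (X t)) (X t z) =
      w (∫ y, U V lam (X t z - X t y) ∂unitVolume - lam * z) := by
  have := h.isProbabilityMeasure_map t
  rw [W, ← hwv _ (exists_le_integral_kernel hV _ _), integral_kernel_eq hV (h.strictMonoOn ht)
    ((memLp_one_iff_integrable).1 (h.memLp 1 ht.le)) hz]

theorem measurable_velocity (h : IsQuantileFlow V w lam q c X)
    (hu : LipschitzWith K (U V lam)) (hw : LipschitzWith L w) :
    Measurable fun x : ℝ × ℝ =>
      w (∫ y, U V lam (X x.1 x.2 - X x.1 y) ∂unitVolume - lam * x.2) := by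
  have h1 : StronglyMeasurable (Function.uncurry fun (x : ℝ × ℝ) (y : ℝ) =>
      U V lam (X x.1 x.2 - X x.1 y)) :=
    (hu.continuous.measurable.comp ((h.measurable.comp measurable_fst).sub
      (h.measurable.comp ((measurable_fst.comp measurable_fst).prodMk measurable_snd)))
      ).stronglyMeasurable
  exact hw.continuous.measurable.comp
    (h1.integral_prod_right.measurable.sub (measurable_snd.const_mul lam))

theorem exists_abs_velocity_le (h : IsQuantileFlow V w lam q c X)
    (hu : LipschitzWith K (U V lam)) (hw : LipschitzWith L w) (T : ℝ) :
    ∃ G : ℝ, ∀ t ∈ Icc 0 T, ∀ z ∈ Icc (0 : ℝ) 1,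
      |w (∫ y, U V lam (X t z - X t y) ∂unitVolume - lam * z)| ≤ G := by
  obtain ⟨B, hB⟩ := h.bounded T
  obtain ⟨C, hC⟩ := (isCompact_Icc (a := -(2 * B)) (b := 2 * B)).exists_bound_of_continuousOn
    hu.continuous.continuousOn
  obtain ⟨G, hG⟩ := (isCompact_Icc (a := -(C + |lam|)) (b := C + |lam|)).exists_bound_of_continuousOn
    hw.continuous.continuousOn
  refine ⟨G, fun t ht z hz => hG _ ?_⟩
  have h1 : ‖∫ y, U V lam (X t z - X t y) ∂unitVolume‖ ≤ C * unitVolume.real univ := by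
    refine norm_integral_le_of_norm_le_const (ae_of_all _ fun y => hC _ ?_)
    have h2 := abs_le.1 (hB t ht z)
    have h3 := abs_le.1 (hB t ht y)
    constructor <;> linarith
  rw [probReal_univ, mul_one, Real.norm_eq_abs] at h1
  have h2 : |lam * z| ≤ |lam| := by
    rw [abs_mul, abs_of_nonneg hz.1]
    exact mul_le_of_le_one_right (abs_nonneg _) hz.2
  rw [abs_le] at h1 h2
  constructor <;> linarith

/-- The quantile function of the law of X(t, ·) is X(t, ·) almost everywhere, and on a probability
space the uniform bound controls every `p`-norm with constant 1. Hence the same curve is continuous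
for all `p`. -/
theorem wassersteinDist_le (h : IsQuantileFlow V w lam q c X) (p : ℝ≥0∞) {t s ε : ℝ}
    (ht : 0 ≤ t) (hs : 0 ≤ s) (hε : ∀ z, |X t z - X s z| ≤ ε) :
    wassersteinDist p (unitVolume.map (X t)) (unitVolume.map (X s)) ≤ ENNReal.ofReal ε := by
  have h1 : (fun z => quantile (unitVolume.map (X t)) z - quantile (unitVolume.map (X s)) z)
      =ᵐ[unitVolume] fun z => X t z - X s z :=
    (quantile_map_ae_eq (h.monotoneOn ht)).sub (quantile_map_ae_eq (h.monotoneOn hs))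
  rw [wassersteinDist, eLpNorm_congr_ae h1]
  refine (eLpNorm_le_of_ae_bound (ae_of_all _ hε)).trans ?_
  rw [measure_univ, ENNReal.one_rpow, one_mul]

/-- In Lagrangian variables the two integrands add up to d/dt φ(X(t, z), t). After Fubini, the time
integral is a difference of boundary values, which vanish because the support of φ avoids t = 0 and
t ≥ T. -/
theorem weak_formulation (h : IsQuantileFlow V w lam q c X) (hV : InteractionKernel V lam)
    (hv : Continuous v) (hu : LipschitzWith K (U V lam)) (hw : LipschitzWith L w)
    (hwv : ∀ r, (∃ x, V x ≤ r) → w r = v r) {φ : ℝ × ℝ → ℝ} (hφ : ContDiff ℝ 1 φ)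
    (hcomp : HasCompactSupport φ) (hsupp : tsupport φ ⊆ {q | 0 < q.2}) :
    (∫ t in Ioi (0 : ℝ), ∫ x, deriv (fun s => φ (x, s)) t ∂(unitVolume.map (X t))) +
      (∫ t in Ioi (0 : ℝ), ∫ x, W V v (unitVolume.map (X t)) x *
        deriv (fun ξ => φ (ξ, t)) x ∂(unitVolume.map (X t))) = 0 := by
  obtain ⟨T, hT0, hT⟩ : ∃ T : ℝ, 0 < T ∧ ∀ x t, T ≤ t → (x, t) ∉ tsupport φ := by
    obtain ⟨T, hT⟩ := (hcomp.isCompact.image continuous_snd).bddAbove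
    refine ⟨max (T + 1) 1, lt_max_of_lt_right one_pos, fun x t ht hmem => ?_⟩
    have h1 : t ≤ T := hT (mem_image_of_mem Prod.snd hmem)
    linarith [(le_max_left (T + 1) 1).trans ht]
  have hf0 : ∀ x t, T ≤ t → fderiv ℝ φ (x, t) = 0 := fun x t ht => by
    by_contra hne
    exact hT x t ht (support_fderiv_subset ℝ (Function.mem_support.2 hne))
  have hcont : Continuous (fderiv ℝ φ) := hφ.continuous_fderiv one_ne_zero
  obtain ⟨D, hD⟩ := (hcomp.fderiv ℝ).exists_bound_of_continuous hcont
  obtain ⟨G, hG⟩ := h.exists_abs_velocity_le hu hw T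
  set g : ℝ → ℝ → ℝ := fun t z => w (∫ y, U V lam (X t z - X t y) ∂unitVolume - lam * z) with hg
  have hgm : Measurable (Function.uncurry g) := h.measurable_velocity hu hw
  have hpt : Measurable fun x : ℝ × ℝ => (X x.1 x.2, x.1) := h.measurable.prodMk measurable_fst
  have hm1 : Measurable fun x : ℝ × ℝ => fderiv ℝ φ (X x.1 x.2, x.1) (1, 0) :=
    Measurable.comp (g := fun y : ℝ × ℝ => fderiv ℝ φ y (1, 0))
      (hcont.clm_apply continuous_const).measurable hpt
  have hm2 : Measurable fun x : ℝ × ℝ => fderiv ℝ φ (X x.1 x.2, x.1) (0, 1) :=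
    Measurable.comp (g := fun y : ℝ × ℝ => fderiv ℝ φ y (0, 1))
      (hcont.clm_apply continuous_const).measurable hpt
  have hb1 : ∀ y, |fderiv ℝ φ y (1, 0)| ≤ D := fun y => by
    refine ((fderiv ℝ φ y).le_of_opNorm_le (hD y) _).trans ?_
    simp [Prod.norm_def]
  have hb2 : ∀ y, |fderiv ℝ φ y (0, 1)| ≤ D := fun y => by
    refine ((fderiv ℝ φ y).le_of_opNorm_le (hD y) _).trans ?_
    simp [Prod.norm_def]
  have hD0 : 0 ≤ D := (abs_nonneg _).trans (hb1 0)
  set ν := (volume.restrict (Ioc (0 : ℝ) T)).prod unitVolume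
  have hae : ∀ᵐ x ∂ν, x.1 ∈ Ioc 0 T ∧ x.2 ∈ Icc (0 : ℝ) 1 := by
    simp only [ν, unitVolume]
    rw [Measure.prod_restrict]
    exact ae_restrict_mem (measurableSet_Ioc.prod measurableSet_Icc)
  have hint1 : Integrable (fun x : ℝ × ℝ => g x.1 x.2 * fderiv ℝ φ (X x.1 x.2, x.1) (1, 0)) ν := by
    refine Integrable.of_bound (hgm.mul hm1).aestronglyMeasurable (G * D) ?_
    filter_upwards [hae] with x hx
    rw [norm_mul]
    have hg1 := hG x.1 (Ioc_subset_Icc_self hx.1) x.2 hx.2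
    exact mul_le_mul hg1 (hb1 _) (norm_nonneg _) ((abs_nonneg _).trans hg1)
  have hint2 : Integrable (fun x : ℝ × ℝ => fderiv ℝ φ (X x.1 x.2, x.1) (0, 1)) ν :=
    Integrable.of_bound hm2.aestronglyMeasurable D (ae_of_all _ fun x => hb2 _)
  have e2 : (∫ t in Ioi (0 : ℝ), ∫ x, deriv (fun s => φ (x, s)) t ∂(unitVolume.map (X t))) =
      ∫ t in Ioc 0 T, ∫ z, fderiv ℝ φ (X t z, t) (0, 1) ∂unitVolume := by
    rw [setIntegral_eq_of_subset_of_forall_sdiff_eq_zero measurableSet_Ioi Ioc_subset_Ioi_self]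
    · refine setIntegral_congr_fun measurableSet_Ioc fun t _ => ?_
      simp only [deriv_snd_eq_fderiv hφ]
      exact integral_map (f := fun x => fderiv ℝ φ (x, t) (0, 1))
        (h.measurable_apply t).aemeasurable (by fun_prop)
    · intro t ht
      have ht' : T ≤ t := le_of_not_gt fun hlt => ht.2 ⟨ht.1, hlt.le⟩
      simp [deriv_snd_eq_fderiv hφ, hf0 _ t ht']
  have e1 : (∫ t in Ioi (0 : ℝ), ∫ x, W V v (unitVolume.map (X t)) x *
        deriv (fun ξ => φ (ξ, t)) x ∂(unitVolume.map (X t))) =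
      ∫ t in Ioc 0 T, ∫ z, g t z * fderiv ℝ φ (X t z, t) (1, 0) ∂unitVolume := by
    rw [setIntegral_eq_of_subset_of_forall_sdiff_eq_zero measurableSet_Ioi Ioc_subset_Ioi_self]
    · refine setIntegral_congr_fun measurableSet_Ioc fun t ht => ?_
      simp only [deriv_fst_eq_fderiv hφ]
      have hWm : Measurable (W V v (unitVolume.map (X t))) :=
        hv.measurable.comp (measurable_integral_kernel hV _)
      have hfm : Measurable fun x => fderiv ℝ φ (x, t) (1, 0) :=
        Continuous.measurable (by fun_prop)
      rw [integral_map (f := fun x => W V v (unitVolume.map (X t)) x * fderiv ℝ φ (x, t) (1, 0))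
        (h.measurable_apply t).aemeasurable (hWm.mul hfm).aestronglyMeasurable]
      refine integral_congr_ae ?_
      filter_upwards [ae_unitVolume_mem_Ioo] with z hz
      rw [h.nonlocal_velocity_eq hV hwv ht.1 hz]
    · intro t ht
      have ht' : T ≤ t := le_of_not_gt fun hlt => ht.2 ⟨ht.1, hlt.le⟩
      simp [deriv_fst_eq_fderiv hφ, hf0 _ t ht']
  rw [e1, e2, ← integral_prod _ hint2, ← integral_prod _ hint1, ← integral_add hint2 hint1,
    integral_prod_symm (fun x : ℝ × ℝ => fderiv ℝ φ (X x.1 x.2, x.1) (0, 1) +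
      g x.1 x.2 * fderiv ℝ φ (X x.1 x.2, x.1) (1, 0)) (hint2.add hint1)]
  refine integral_eq_zero_of_ae ?_
  filter_upwards [ae_unitVolume_mem_Ioo] with z hz
  have hz' := Ioo_subset_Icc_self hz
  have hder : ∀ t ∈ Ioo 0 T, HasDerivAt (fun s => φ (X s z, s))
      (fderiv ℝ φ (X t z, t) (0, 1) + g t z * fderiv ℝ φ (X t z, t) (1, 0)) t := by
    intro t ht
    have hX := (h.hasDeriv t ht.1.le z hz').hasDerivAt (Ici_mem_nhds ht.1)
    have := HasFDerivAt.comp_hasDerivAt (f := fun s => (X s z, s)) t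
      (hφ.differentiable one_ne_zero (X t z, t)).hasFDerivAt (hX.prodMk (hasDerivAt_id t))
    convert! this using 1
    have e : ((w (∫ y, U V lam (X t z - X t y) ∂unitVolume - lam * z), 1) : ℝ × ℝ) =
        (0, 1) + g t z • ((1, 0) : ℝ × ℝ) := by
      simp [hg]
    rw [e, map_add, map_smul, smul_eq_mul]
  have hcX : ContinuousOn (fun s => φ (X s z, s)) (Icc 0 T) := by
    refine hφ.continuous.comp_continuousOn (ContinuousOn.prodMk (fun t ht => ?_) continuousOn_id)
    exact ((h.hasDeriv t ht.1 z hz').continuousWithinAt).mono Icc_subset_Ici_self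
  have hII : IntervalIntegrable (fun t => fderiv ℝ φ (X t z, t) (0, 1) +
      g t z * fderiv ℝ φ (X t z, t) (1, 0)) volume 0 T := by
    rw [intervalIntegrable_iff_integrableOn_Ioc_of_le hT0.le]
    have hmz : Measurable fun t => fderiv ℝ φ (X t z, t) (0, 1) +
        g t z * fderiv ℝ φ (X t z, t) (1, 0) :=
      (hm2.add (hgm.mul hm1)).comp measurable_prodMk_right
    refine Measure.integrableOn_of_bounded (M := D + G * D) (by simp)
      hmz.aestronglyMeasurable ?_
    filter_upwards [ae_restrict_mem measurableSet_Ioc] with t ht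
    have hg1 := hG t (Ioc_subset_Icc_self ht) z hz'
    refine (norm_add_le _ _).trans (add_le_add (hb2 _) ?_)
    rw [norm_mul]
    exact mul_le_mul hg1 (hb1 _) (norm_nonneg _) ((abs_nonneg _).trans hg1)
  have hFTC := intervalIntegral.integral_eq_sub_of_hasDerivAt_of_le hT0.le hcX hder hII
  rw [intervalIntegral.integral_of_le hT0.le] at hFTC
  refine hFTC.trans ?_
  rw [image_eq_zero_of_notMem_tsupport (hT _ T le_rfl),
    image_eq_zero_of_notMem_tsupport fun hmem => lt_irrefl (0 : ℝ) (hsupp hmem), sub_zero,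
    Pi.zero_apply]

theorem isDissipativeSolution {ρ₀ : Measure ℝ} [IsProbabilityMeasure ρ₀]
    (h : IsQuantileFlow V w lam (quantile ρ₀) c X)
    (hV : InteractionKernel V lam) (hv : Continuous v) (hu : LipschitzWith K (U V lam))
    (hw : LipschitzWith L w) (hwv : ∀ r, (∃ x, V x ≤ r) → w r = v r) (p : ℝ≥0∞) :
    IsDissipativeSolution V v p ρ₀ fun t => unitVolume.map (X t) where
  prob t _ := h.isProbabilityMeasure_map t
  moment t ht := (memLp_map_measure_iff measurable_id.aestronglyMeasurable
    (h.measurable_apply t).aemeasurable).2 (h.memLp p ht)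
  continuous s hs := by
    rw [ENNReal.tendsto_nhds_zero]
    intro ε hε
    obtain ⟨δ, hδ, hδε⟩ : ∃ δ : ℝ, 0 < δ ∧ ENNReal.ofReal δ ≤ ε := by
      rcases eq_or_ne ε ∞ with rfl | htop
      · exact ⟨1, one_pos, le_top⟩
      · exact ⟨ε.toReal, ENNReal.toReal_pos hε.ne' htop, ENNReal.ofReal_toReal_le⟩
    filter_upwards [self_mem_nhdsWithin, nhdsWithin_le_nhds (h.uniform s δ hδ)] with t ht ht'
    exact (h.wassersteinDist_le p ht hs ht').trans hδε
  bounded t ht := by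
    have := h.isProbabilityMeasure_map t
    exact hasBoundedDensity_of_le (inv_nonneg.2 (h.nonneg t ht.le)) (h.map_le ht)
  weak φ hφ hcomp hsupp := h.weak_formulation hV hv hu hw hwv hφ hcomp hsupp
  initial := by
    refine (Measure.map_congr ?_).trans (map_quantile (μ := ρ₀))
    filter_upwards [ae_unitVolume_mem_Ioo] with z hz
    exact h.initial z (Ioo_subset_Icc_self hz)

end IsQuantileFlow

/-! ### Two lemmas of real analysis -/

/-- If `a' = b` in the sense of distributions on `(0, ∞)`, then `a` is a primitive of `b`. -/
theorem sub_eq_integral_of_forall_test {a b : ℝ → ℝ} (ha : Continuous a) (hb : Continuous b)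
    (h : ∀ θ : ℝ → ℝ, ContDiff ℝ 1 θ → HasCompactSupport θ → tsupport θ ⊆ Ioi 0 →
      (∫ t in Ioi (0 : ℝ), deriv θ t * a t) + (∫ t in Ioi (0 : ℝ), θ t * b t) = 0)
    {t₁ t₂ : ℝ} (ht₁ : 0 < t₁) (h12 : t₁ ≤ t₂) : a t₂ - a t₁ = ∫ t in t₁..t₂, b t := by
  obtain ⟨α, hα0, hα1⟩ := exists_between ht₁
  obtain ⟨β, hβ⟩ := exists_gt t₂
  have hαβ : α < β := by linarith
  have hI : ∀ f : ℝ → ℝ, Continuous f → IntervalIntegrable f volume α β :=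
    fun f hf => hf.intervalIntegrable _ _
  set κ : ℝ → ℝ := fun s => max ((s - α) * (β - s)) 0 with hκ
  have hκc : Continuous κ := by fun_prop
  have hκ0 : ∀ s, s ∉ Ioo α β → κ s = 0 := fun s hs => by
    refine max_eq_right ?_
    by_contra hpos
    rcases mul_pos_iff.1 (not_le.1 hpos) with h' | h'
    · exact hs ⟨by linarith [h'.1], by linarith [h'.2]⟩
    · linarith [h'.1, h'.2]
  have hκpos : ∀ s ∈ Ioo α β, 0 < κ s := fun s hs =>
    lt_max_of_lt_left (mul_pos (by linarith [hs.1]) (by linarith [hs.2]))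
  have hκint : 0 < ∫ s in α..β, κ s := by
    refine intervalIntegral.integral_pos hαβ hκc.continuousOn (fun s _ => le_max_right _ _)
      ⟨t₁, ⟨hα1.le, by linarith⟩, hκpos t₁ ⟨hα1, by linarith⟩⟩
  set B : ℝ → ℝ := fun t => ∫ s in α..t, b s with hB
  have hBd : ∀ t, HasDerivAt B (b t) t := fun t => (hb.integral_hasStrictDerivAt α t).hasDerivAt
  have hBc : Continuous B := continuous_iff_continuousAt.2 fun t => (hBd t).continuousAt
  set m : ℝ → ℝ := fun t => a t - B t with hm
  have hmc : Continuous m := ha.sub hBc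
  -- `κ` is a weight, positive exactly on (α, β), and `A` is the weighted mean of `m`. Thus η = κ (m
  -- - A) has integral zero and its primitive `θ` is an admissible test function.
  set A : ℝ := (∫ s in α..β, κ s * m s) / ∫ s in α..β, κ s with hA
  set η : ℝ → ℝ := fun s => κ s * (m s - A) with hη
  have hηc : Continuous η := hκc.mul (hmc.sub continuous_const)
  have hη0 : ∀ s, s ∉ Ioo α β → η s = 0 := fun s hs => by simp only [hη, hκ0 s hs, zero_mul]
  have hηint : ∫ s in α..β, η s = 0 := by
    have h1 : ∫ s in α..β, η s = (∫ s in α..β, κ s * m s) - A * ∫ s in α..β, κ s := by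
      rw [← intervalIntegral.integral_const_mul, ← intervalIntegral.integral_sub
        (hI (fun s => κ s * m s) (hκc.mul hmc)) (hI (fun s => A * κ s) (continuous_const.mul hκc))]
      refine intervalIntegral.integral_congr fun s _ => ?_
      simp only [hη]
      ring
    rw [h1, hA, div_mul_cancel₀ _ hκint.ne', sub_self]
  set θ : ℝ → ℝ := fun t => ∫ s in α..t, η s with hθ
  have hθd : ∀ t, HasDerivAt θ (η t) t := fun t => (hηc.integral_hasStrictDerivAt α t).hasDerivAt
  have hθ0 : ∀ t, t ∉ Icc α β → θ t = 0 := fun t ht => by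
    rcases lt_or_ge t α with h1 | h1
    · refine (intervalIntegral.integral_congr (g := fun _ => 0) fun s hs => ?_).trans (by simp)
      rw [uIcc_of_ge h1.le] at hs
      exact hη0 s fun hs' => absurd hs'.1 (not_lt.2 hs.2)
    · have h2 : β < t := lt_of_not_ge fun h2 => ht ⟨h1, h2⟩
      have h3 : ∫ s in β..t, η s = 0 := by
        refine (intervalIntegral.integral_congr (g := fun _ => 0) fun s hs => ?_).trans (by simp)
        rw [uIcc_of_le h2.le] at hs
        exact hη0 s fun hs' => absurd hs'.2 (not_lt.2 hs.1)
      simp only [hθ]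
      rw [← intervalIntegral.integral_add_adjacent_intervals (hηc.intervalIntegrable α β)
        (hηc.intervalIntegrable β t), hηint, h3, add_zero]
  have hderiv : deriv θ = η := funext fun t => (hθd t).deriv
  have hθC : ContDiff ℝ 1 θ :=
    contDiff_one_iff_deriv.2 ⟨fun t => (hθd t).differentiableAt, hderiv ▸ hηc⟩
  have hsub : Icc α β ⊆ Ioi 0 := fun s hs => hα0.trans_le hs.1
  have htest := h θ hθC (HasCompactSupport.intro isCompact_Icc hθ0)
    ((closure_minimal (fun t ht => by_contra fun h' => Function.mem_support.1 ht (hθ0 t h')) isClosed_Icc).trans hsub)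
  have hsub' : Ioc α β ⊆ Ioi 0 := Ioc_subset_Icc_self.trans hsub
  have hθα : θ α = 0 := intervalIntegral.integral_same
  rw [hderiv, setIntegral_eq_of_subset_of_forall_sdiff_eq_zero measurableSet_Ioi hsub',
    setIntegral_eq_of_subset_of_forall_sdiff_eq_zero measurableSet_Ioi hsub',
    ← intervalIntegral.integral_of_le hαβ.le, ← intervalIntegral.integral_of_le hαβ.le] at htest
  rotate_left
  · intro t ht
    have : θ t = 0 := by
      by_cases h1 : t = α
      · rw [h1, hθα]
      · exact hθ0 t fun h2 => ht.2 ⟨lt_of_le_of_ne h2.1 (Ne.symm h1), h2.2⟩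
    rw [this, zero_mul]
  · intro t ht
    rw [hη0 t fun h2 => ht.2 (Ioo_subset_Ioc_self h2), zero_mul]
  have hθc : Continuous θ := hθC.continuous
  have hparts := intervalIntegral.integral_deriv_mul_eq_sub (a := α) (b := β)
    (fun t _ => hθd t) (fun t _ => hBd t) (hηc.intervalIntegrable _ _) (hb.intervalIntegrable _ _)
  rw [hθα, zero_mul, show θ β = 0 from hηint, zero_mul, sub_zero,
    intervalIntegral.integral_add (hI (fun s => η s * B s) (hηc.mul hBc))
      (hI (fun s => θ s * b s) (hθc.mul hb))] at hparts
  -- Testing with `θ` gives ∫ ηa + ∫ θb = 0, and integration by parts gives ∫ ηB + ∫ θb = 0.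
  -- Subtracting, ∫ ηm = 0, so the weighted variance of `m` is zero.
  have hηm : ∫ s in α..β, η s * m s = 0 := by
    have : ∫ s in α..β, η s * m s = (∫ s in α..β, η s * a s) - ∫ s in α..β, η s * B s := by
      rw [← intervalIntegral.integral_sub (hI (fun s => η s * a s) (hηc.mul ha))
        (hI (fun s => η s * B s) (hηc.mul hBc))]
      refine intervalIntegral.integral_congr fun s _ => ?_
      simp only [hm]
      ring
    rw [this]
    linarith
  have hsq : ∫ s in α..β, κ s * (m s - A) ^ 2 = 0 := by
    have : ∫ s in α..β, κ s * (m s - A) ^ 2 =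
        (∫ s in α..β, η s * m s) - A * ∫ s in α..β, η s := by
      rw [← intervalIntegral.integral_const_mul, ← intervalIntegral.integral_sub
        (hI (fun s => η s * m s) (hηc.mul hmc)) (hI (fun s => A * η s) (continuous_const.mul hηc))]
      refine intervalIntegral.integral_congr fun s _ => ?_
      simp only [hη]
      ring
    rw [this, hηm, hηint, mul_zero, sub_zero]
  have hconst : ∀ t ∈ Ioo α β, m t = A := by
    intro t ht
    by_contra hne
    have hpos : 0 < ∫ s in α..β, κ s * (m s - A) ^ 2 :=
      intervalIntegral.integral_pos hαβ
        (hκc.mul ((hmc.sub continuous_const).pow 2)).continuousOn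
        (fun s _ => mul_nonneg (le_max_right _ _) (sq_nonneg _))
        ⟨t, Ioo_subset_Icc_self ht, mul_pos (hκpos t ht) (pow_two_pos_of_ne_zero (sub_ne_zero.2 hne))⟩
    exact hpos.ne' hsq
  have e1 := hconst t₁ ⟨hα1, by linarith⟩
  have e2 := hconst t₂ ⟨by linarith, hβ⟩
  have e3 : B t₂ - B t₁ = ∫ t in t₁..t₂, b t :=
    intervalIntegral.integral_interval_sub_left (hb.intervalIntegrable _ _)
      (hb.intervalIntegrable _ _)
  simp only [hm] at e1 e2
  linarith

theorem nonpos_of_hasDerivAt_of_forall_le {N : ℝ → ℝ} {d s t : ℝ} (hd : HasDerivAt N d s)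
    (hst : s < t) (h : ∀ r ∈ Icc s t, N r ≤ N s) : d ≤ 0 := by
  have h1 := (hasDerivWithinAt_iff_tendsto_slope' self_notMem_Ioi).1
    (hd.hasDerivWithinAt (s := Ioi s))
  refine le_of_tendsto h1 ?_
  filter_upwards [Ioo_mem_nhdsGT hst] with r hr
  rw [slope_def_field]
  exact div_nonpos_of_nonpos_of_nonneg (sub_nonpos.2 (h r (Ioo_subset_Icc_self hr)))
    (sub_nonneg.2 hr.1.le)

theorem nonneg_of_hasDerivAt_of_forall_le {N : ℝ → ℝ} {d s t : ℝ} (hd : HasDerivAt N d t)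
    (hst : s < t) (h : ∀ r ∈ Icc s t, N r ≤ N t) : 0 ≤ d := by
  have h1 := (hasDerivWithinAt_iff_tendsto_slope' self_notMem_Iio).1
    (hd.hasDerivWithinAt (s := Iio t))
  refine ge_of_tendsto h1 ?_
  filter_upwards [Ioo_mem_nhdsLT hst] with r hr
  rw [slope_def_field]
  exact div_nonneg_of_nonpos (sub_nonpos.2 (h r (Ioo_subset_Icc_self hr)))
    (sub_nonpos.2 hr.2.le)

/-- A continuous function which at every point is touched from below by a function with a
derivative that depends continuously on the point, is continuously differentiable. -/
theorem sub_eq_integral_of_touching_below {ψ c : ℝ → ℝ} (hψ : Continuous ψ) (hc : Continuous c)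
    (h : ∀ t, 0 < t → ∃ H : ℝ → ℝ, HasDerivAt H (c t) t ∧
      ∀ s, 0 < s → H s - H t ≤ ψ s - ψ t) {t₁ t₂ : ℝ} (ht₁ : 0 < t₁) (h12 : t₁ ≤ t₂) :
    ψ t₂ - ψ t₁ = ∫ t in t₁..t₂, c t := by
  rcases h12.eq_or_lt with rfl | hlt
  · simp
  set C : ℝ → ℝ := fun t => ∫ s in t₁..t, c s with hC
  have hCd : ∀ t, HasDerivAt C (c t) t := fun t => (hc.integral_hasStrictDerivAt t₁ t).hasDerivAt
  have hCc : Continuous C := continuous_iff_continuousAt.2 fun t => (hCd t).continuousAt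
  -- As in the mean value theorem, `k` is the slope for which `F` takes equal values at both ends.
  -- At a maximum of `F` the touching function minus `C` and the linear term also has a maximum, and
  -- its derivative there is `-k`.
  set k : ℝ := (ψ t₂ - ψ t₁ - C t₂) / (t₂ - t₁) with hk
  have hk' : k * (t₂ - t₁) = ψ t₂ - ψ t₁ - C t₂ := div_mul_cancel₀ _ (by linarith)
  set F : ℝ → ℝ := fun t => ψ t - C t - k * t with hF
  have hFc : Continuous F := (hψ.sub hCc).sub (continuous_const.mul continuous_id)
  have hC1 : C t₁ = 0 := intervalIntegral.integral_same
  have hF12 : F t₁ = F t₂ := by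
    simp only [hF, hC1]
    linarith
  have hmax : ∀ t ∈ Icc t₁ t₂, (∀ s ∈ Icc t₁ t₂, F s ≤ F t) →
      ∃ N : ℝ → ℝ, HasDerivAt N (-k) t ∧ ∀ s ∈ Icc t₁ t₂, N s ≤ N t := by
    intro t ht hFt
    obtain ⟨H, hHd, hH⟩ := h t (ht₁.trans_le ht.1)
    refine ⟨fun s => H s - C s - k * s, ?_, fun s hs => ?_⟩
    · have := (hHd.sub (hCd t)).sub ((hasDerivAt_id t).const_mul k)
      rw [sub_self, mul_one, zero_sub] at this
      exact this
    · have h1 := hH s (ht₁.trans_le hs.1)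
      have h2 := hFt s hs
      simp only [hF] at h2
      linarith
  obtain ⟨t, ht, hFt⟩ := isCompact_Icc.exists_isMaxOn (nonempty_Icc.2 h12) hFc.continuousOn
  have hFt' : ∀ s ∈ Icc t₁ t₂, F s ≤ F t := fun s hs => hFt hs
  have hk0 : k = 0 := by
    refine le_antisymm ?_ ?_
    -- A maximum at one endpoint is also one at the other, since `F` has the same value there. So a
    -- maximum with room on the left, and one with room on the right, always exist; they give the
    -- two signs of `k`.
    · obtain ⟨t', ht', h1', hFt''⟩ : ∃ t' ∈ Icc t₁ t₂, t₁ < t' ∧ ∀ s ∈ Icc t₁ t₂, F s ≤ F t' := by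
        rcases ht.1.eq_or_lt with h1 | h1
        · exact ⟨t₂, right_mem_Icc.2 h12, hlt, fun s hs => by
            rw [← hF12, h1]; exact hFt' s hs⟩
        · exact ⟨t, ht, h1, hFt'⟩
      obtain ⟨N, hNd, hN⟩ := hmax t' ht' hFt''
      have := nonneg_of_hasDerivAt_of_forall_le hNd h1' fun r hr => hN r ⟨hr.1, hr.2.trans ht'.2⟩
      linarith
    · obtain ⟨t', ht', h1', hFt''⟩ : ∃ t' ∈ Icc t₁ t₂, t' < t₂ ∧ ∀ s ∈ Icc t₁ t₂, F s ≤ F t' := by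
        rcases ht.2.eq_or_lt with h1 | h1
        · exact ⟨t₁, left_mem_Icc.2 h12, hlt, fun s hs => by
            rw [hF12, ← h1]; exact hFt' s hs⟩
        · exact ⟨t, ht, h1, hFt'⟩
      obtain ⟨N, hNd, hN⟩ := hmax t' ht' hFt''
      have := nonpos_of_hasDerivAt_of_forall_le hNd h1' fun r hr => hN r ⟨ht'.1.trans hr.1, hr.2⟩
      linarith
  rw [hk0, zero_mul] at hk'
  simp only [hC] at hk'
  linarith

/-! ### The equation for quantile functions in `L¹(0, 1)` -/

theorem LipschitzWith.integrable_comp {α : Type*} [MeasurableSpace α] {μ : Measure α}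
    [IsFiniteMeasure μ] {u : ℝ → ℝ} {K : ℝ≥0} (hu : LipschitzWith K u) {f : α → ℝ}
    (hf : Integrable f μ) : Integrable (fun x => u (f x)) μ := by
  have h1 : Integrable (fun x => |u 0| + K * |f x|) μ :=
    (integrable_const _).add (hf.abs.const_mul _)
  refine h1.mono' (hu.continuous.comp_aestronglyMeasurable hf.aestronglyMeasurable)
    (ae_of_all _ fun x => ?_)
  have := hu.dist_le_mul (f x) 0
  rw [Real.dist_eq, Real.dist_eq, sub_zero] at this
  rw [Real.norm_eq_abs]
  linarith [abs_sub_abs_le_abs_sub (u (f x)) (u 0)]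

/-- The right-hand side of the equation for quantile functions. -/
noncomputable def quantileField (u w : ℝ → ℝ) (lam : ℝ) (f : ℝ → ℝ) (z : ℝ) : ℝ :=
  w (∫ y, u (f z - f y) ∂unitVolume - lam * z)

section QuantileField

variable {u w : ℝ → ℝ} {K L : ℝ≥0}

theorem abs_integral_comp_sub_sub_le_integral (hu : LipschitzWith K u) {f g : ℝ → ℝ}
    (hf : Integrable f unitVolume) (hg : Integrable g unitVolume) (x y : ℝ) :
    |∫ s, u (x - f s) ∂unitVolume - ∫ s, u (y - g s) ∂unitVolume| ≤
      K * |x - y| + K * ∫ s, |f s - g s| ∂unitVolume := by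
  have hif : Integrable (fun s => u (x - f s)) unitVolume :=
    LipschitzWith.integrable_comp hu ((integrable_const x).sub hf)
  have hig : Integrable (fun s => u (y - g s)) unitVolume :=
    LipschitzWith.integrable_comp hu ((integrable_const y).sub hg)
  have hd : Integrable (fun s => K * |f s - g s|) unitVolume := (hf.sub hg).abs.const_mul _
  rw [← integral_sub hif hig, ← integral_const_mul]
  have h1 : ∫ s, (K * |x - y| + K * |f s - g s|) ∂unitVolume =
      K * |x - y| + ∫ s, K * |f s - g s| ∂unitVolume := by
    rw [integral_add (integrable_const _) hd]
    simp
  rw [← h1, ← Real.norm_eq_abs]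
  refine norm_integral_le_of_norm_le ((integrable_const _).add hd) (ae_of_all _ fun s => ?_)
  have h2 := hu.dist_le_mul (x - f s) (y - g s)
  rw [Real.dist_eq, Real.dist_eq] at h2
  rw [Real.norm_eq_abs]
  refine h2.trans ?_
  rw [← mul_add]
  gcongr
  rw [show x - f s - (y - g s) = (x - y) - (f s - g s) by ring]
  exact abs_sub _ _

theorem integrable_quantileField (hu : LipschitzWith K u) (hw : LipschitzWith L w) (lam : ℝ)
    {f : ℝ → ℝ} (hf : Integrable f unitVolume) :
    Integrable (quantileField u w lam f) unitVolume := by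
  have hA : LipschitzWith K fun x => ∫ y, u (x - f y) ∂unitVolume := by
    refine LipschitzWith.of_dist_le_mul fun x y => ?_
    have := abs_integral_comp_sub_sub_le_integral hu hf hf x y
    simpa [Real.dist_eq] using this
  have hz : Integrable (fun z : ℝ => lam * z) unitVolume :=
    ((continuous_id.integrableOn_Icc (a := (0 : ℝ)) (b := 1)).const_mul lam)
  exact LipschitzWith.integrable_comp hw ((LipschitzWith.integrable_comp hA hf).sub hz)

theorem quantileField_congr {f g : ℝ → ℝ} (lam : ℝ) (h : f =ᵐ[unitVolume] g) :
    quantileField u w lam f =ᵐ[unitVolume] quantileField u w lam g := by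
  filter_upwards [h] with z hz
  have : (fun y => u (f z - f y)) =ᵐ[unitVolume] fun y => u (g z - g y) := by
    filter_upwards [h] with y hy
    rw [hz, hy]
  rw [quantileField, quantileField, integral_congr_ae this]

/-- The right-hand side of the equation for quantile functions, as a vector field on `L¹`. -/
noncomputable def quantileFieldL1 (hu : LipschitzWith K u) (hw : LipschitzWith L w) (lam : ℝ)
    (f : Lp ℝ 1 unitVolume) : Lp ℝ 1 unitVolume :=
  (integrable_quantileField hu hw lam (L1.integrable_coeFn f)).toL1 _

theorem coeFn_quantileFieldL1 (hu : LipschitzWith K u) (hw : LipschitzWith L w) (lam : ℝ)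
    (f : Lp ℝ 1 unitVolume) :
    quantileFieldL1 hu hw lam f =ᵐ[unitVolume] quantileField u w lam f :=
  Integrable.coeFn_toL1 _

/-- The pointwise bound L (K |f z - g z| + K ‖f - g‖₁) integrates to 2LK ‖f - g‖₁. Uniqueness of
solutions rests on this estimate. -/
theorem lipschitzWith_quantileFieldL1 (hu : LipschitzWith K u) (hw : LipschitzWith L w)
    (lam : ℝ) : LipschitzWith (2 * L * K) (quantileFieldL1 hu hw lam) := by
  refine LipschitzWith.of_dist_le_mul fun f g => ?_
  have hf := L1.integrable_coeFn f
  have hg := L1.integrable_coeFn g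
  set D := ∫ s, |f s - g s| ∂unitVolume with hD
  have hD' : dist f g = D := by
    rw [L1.dist_eq_integral_dist]
    rfl
  have hd : Integrable (fun s => |f s - g s|) unitVolume := (hf.sub hg).abs
  have h1 : ∫ z, (L * (K * |f z - g z| + K * D)) ∂unitVolume = 2 * L * K * D := by
    rw [integral_const_mul, integral_add (hd.const_mul _) (integrable_const _), integral_const_mul]
    simp only [integral_const, probReal_univ, one_smul, ← hD]
    ring
  rw [L1.dist_eq_integral_dist, hD']
  push_cast
  rw [← h1]
  have hdist : Integrable (fun z => dist (quantileFieldL1 hu hw lam f z)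
      (quantileFieldL1 hu hw lam g z)) unitVolume := by
    simp only [Real.dist_eq]
    exact ((L1.integrable_coeFn _).sub (L1.integrable_coeFn _)).abs
  refine integral_mono_ae hdist (((hd.const_mul _).add (integrable_const _)).const_mul _) ?_
  filter_upwards [coeFn_quantileFieldL1 hu hw lam f, coeFn_quantileFieldL1 hu hw lam g]
    with z hz₁ hz₂
  rw [hz₁, hz₂]
  refine (hw.dist_le_mul _ _).trans ?_
  gcongr
  rw [Real.dist_eq, sub_sub_sub_cancel_right]
  exact abs_integral_comp_sub_sub_le_integral hu hf hg _ _

end QuantileField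

/-- The pairing of `k ∘ f` and `h f` depends continuously on `f`, where `k` may be discontinuous on
a set that is negligible for the law of `f`. -/
theorem continuousAt_integral_comp_mul {k : ℝ → ℝ} (hk : Measurable k) {M : ℝ}
    (hM : ∀ x, |k x| ≤ M) {h : Lp ℝ 1 unitVolume → Lp ℝ 1 unitVolume} {f₀ : Lp ℝ 1 unitVolume}
    (hh : ContinuousAt h f₀) (hc : ∀ᵐ z ∂unitVolume, ContinuousAt k (f₀ z)) :
    ContinuousAt (fun f : Lp ℝ 1 unitVolume => ∫ z, k (f z) * h f z ∂unitVolume) f₀ := by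
  -- Convergence in L¹ gives almost everywhere convergence along a further subsequence, which
  -- suffices for convergence of the full sequence.
  refine tendsto_of_subseq_tendsto fun ns hns => ?_
  obtain ⟨ms, hms, hae⟩ := (tendstoInMeasure_of_tendsto_Lp hns).exists_seq_tendsto_ae
  refine ⟨ms, ?_⟩
  set F : ℕ → Lp ℝ 1 unitVolume := fun n => ns (ms n)
  have hF : Tendsto F atTop (𝓝 f₀) := hns.comp hms.tendsto_atTop
  have hkm : ∀ f : Lp ℝ 1 unitVolume, AEStronglyMeasurable (fun z => k (f z)) unitVolume :=
    fun f => (hk.comp (Lp.stronglyMeasurable f).measurable).aestronglyMeasurable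
  have hint : ∀ f g : Lp ℝ 1 unitVolume, Integrable (fun z => k (f z) * g z) unitVolume :=
    fun f g => (L1.integrable_coeFn g).bdd_mul (hkm f) (ae_of_all _ fun z => hM _)
  have hM0 : 0 ≤ M := (abs_nonneg _).trans (hM 0)
  have h1 : Tendsto (fun n => ∫ z, k (F n z) * (h (F n) z - h f₀ z) ∂unitVolume) atTop (𝓝 0) := by
    have h2 : Tendsto (fun n => M * dist (h (F n)) (h f₀)) atTop (𝓝 0) := by
      have := (tendsto_iff_dist_tendsto_zero.1 (hh.tendsto.comp hF)).const_mul M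
      rwa [mul_zero] at this
    refine squeeze_zero_norm (fun n => ?_) h2
    rw [L1.dist_eq_integral_dist, ← integral_const_mul]
    refine norm_integral_le_of_norm_le ?_ (ae_of_all _ fun z => ?_)
    · simp only [Real.dist_eq]
      exact (((L1.integrable_coeFn _).sub (L1.integrable_coeFn _)).abs).const_mul M
    · rw [norm_mul, Real.dist_eq]
      exact mul_le_mul_of_nonneg_right (hM _) (abs_nonneg _)
  have h2 : Tendsto (fun n => ∫ z, k (F n z) * h f₀ z ∂unitVolume) atTop
      (𝓝 (∫ z, k (f₀ z) * h f₀ z ∂unitVolume)) := by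
    refine tendsto_integral_of_dominated_convergence (fun z => M * |h f₀ z|)
      (fun n => (hint _ _).aestronglyMeasurable) ((L1.integrable_coeFn (h f₀)).abs.const_mul M)
      (fun n => ae_of_all _ fun z => ?_) ?_
    · rw [norm_mul]
      exact mul_le_mul_of_nonneg_right (hM _) (norm_nonneg _)
    · filter_upwards [hae, hc] with z hz hkz
      exact (hkz.tendsto.comp hz).mul_const _
  have h3 := h1.add h2
  rw [zero_add] at h3
  refine h3.congr fun n => ?_
  have e : ∀ z, k (F n z) * (h (F n) z - h f₀ z) = k (F n z) * h (F n) z - k (F n z) * h f₀ z :=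
    fun z => mul_sub _ _ _
  simp only [e]
  rw [integral_sub (hint _ _) (hint _ _), sub_add_cancel]

theorem continuous_integral_comp {k : ℝ → ℝ} (hk : Continuous k) {M : ℝ} (hM : ∀ x, |k x| ≤ M) :
    Continuous fun f : Lp ℝ 1 unitVolume => ∫ z, k (f z) ∂unitVolume := by
  refine continuous_iff_continuousAt.2 fun f₀ => ?_
  have := continuousAt_integral_comp_mul hk.measurable hM (f₀ := f₀)
    (h := fun _ => (integrable_const (1 : ℝ)).toL1 _) continuousAt_const
    (ae_of_all _ fun z => hk.continuousAt)
  refine this.congr (Eventually.of_forall fun f => integral_congr_ae ?_)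
  filter_upwards [Integrable.coeFn_toL1 (μ := unitVolume) (integrable_const (1 : ℝ))] with z hz
  rw [hz, mul_one]

/-- An integrable function on `[0, 1]` all of whose integrals over `(0, z]` vanish is zero. -/
theorem eq_zero_of_forall_setIntegral_Ioc {f : Lp ℝ 1 unitVolume}
    (h : ∀ z ∈ Ioo (0 : ℝ) 1, ∫ y in Ioc 0 z, f y ∂unitVolume = 0) : f = 0 := by
  have hint : IntervalIntegrable f volume 0 1 := by
    rw [intervalIntegrable_iff_integrableOn_Icc_of_le zero_le_one]
    exact L1.integrable_coeFn f
  have hI : ∀ z ∈ Ioo (0 : ℝ) 1, ∫ y in (0 : ℝ)..z, f y = 0 := fun z hz => by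
    have e : unitVolume.restrict (Ioc 0 z) = volume.restrict (Ioc 0 z) := by
      rw [Measure.restrict_restrict measurableSet_Ioc,
        inter_eq_left.2 (Ioc_subset_Icc_self.trans (Icc_subset_Icc_right hz.2.le))]
    rw [intervalIntegral.integral_of_le hz.1.le, ← e]
    exact h z hz
  refine Lp.eq_zero_iff_ae_eq_zero.2 ?_
  have h1 : ∀ᵐ z ∂unitVolume, z ∈ uIcc (0 : ℝ) 1 → ∀ c ∈ uIcc (0 : ℝ) 1,
      HasDerivAt (fun x => ∫ t in c..x, f t) (f z) z :=
    ae_restrict_of_ae hint.ae_hasDerivAt_integral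
  filter_upwards [h1, ae_unitVolume_mem_Ioo] with z hz hz'
  have h2 := hz (by rw [uIcc_of_le zero_le_one]; exact Ioo_subset_Icc_self hz') 0 (by simp)
  have h3 : (fun x => ∫ t in (0 : ℝ)..x, f t) =ᶠ[𝓝 z] fun _ => 0 := by
    filter_upwards [isOpen_Ioo.mem_nhds hz'] with x hx using hI x hx
  exact (h2.congr_of_eventuallyEq h3.symm).unique (hasDerivAt_const z 0)

/-! ### Weak solutions of the equation for quantile functions -/

/-- Integration over a set, as a continuous linear functional on `L¹(0, 1)`. -/
noncomputable def setIntegralL1 (s : Set ℝ) : Lp ℝ 1 unitVolume →L[ℝ] ℝ where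
  toFun f := ∫ x in s, f x ∂unitVolume
  map_add' f g := by
    rw [← integral_add (L1.integrable_coeFn f).integrableOn (L1.integrable_coeFn g).integrableOn]
    exact integral_congr_ae (ae_restrict_of_ae (Lp.coeFn_add f g))
  map_smul' c f := by
    rw [RingHom.id_apply, ← integral_smul]
    exact integral_congr_ae (ae_restrict_of_ae (Lp.coeFn_smul c f))
  cont := continuous_setIntegral s

theorem setIntegralL1_apply (s : Set ℝ) (f : Lp ℝ 1 unitVolume) :
    setIntegralL1 s f = ∫ x in s, f x ∂unitVolume := rfl

/-- A smooth approximation of `y ↦ max (x - y) 0`. -/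
noncomputable def smoothPosPart (x : ℝ) (n : ℕ) (y : ℝ) : ℝ :=
  ((x - y) + √((x - y) ^ 2 + 1 / ((n : ℝ) + 1))) / 2

/-- The limit of the derivatives of the smooth approximations of `y ↦ max (x - y) 0`. -/
noncomputable def posPartSlope (x y : ℝ) : ℝ := -(1 + (x - y) / |x - y|) / 2

/-! ### Smooth approximation of the positive part -/

section SmoothPosPart

variable (x : ℝ)

theorem smoothPosPart_arg_pos (n : ℕ) (y : ℝ) : 0 < (x - y) ^ 2 + 1 / ((n : ℝ) + 1) := by
  positivity

theorem contDiff_smoothPosPart (n : ℕ) : ContDiff ℝ 1 (smoothPosPart x n) := by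
  have h : ContDiff ℝ 1 fun y : ℝ => (x - y) ^ 2 + 1 / ((n : ℝ) + 1) := by fun_prop
  have h2 := h.sqrt fun y => (smoothPosPart_arg_pos x n y).ne'
  exact ((contDiff_const.sub contDiff_id).add h2).div_const 2

theorem hasDerivAt_smoothPosPart (n : ℕ) (y : ℝ) : HasDerivAt (smoothPosPart x n)
    (-(1 + (x - y) / √((x - y) ^ 2 + 1 / ((n : ℝ) + 1))) / 2) y := by
  have h1 : HasDerivAt (fun y : ℝ => x - y) (-1) y := (hasDerivAt_id y).const_sub x
  have h2 : HasDerivAt (fun y : ℝ => (x - y) ^ 2 + 1 / ((n : ℝ) + 1))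
      (((2 : ℕ) : ℝ) * (x - y) ^ (2 - 1) * (-1)) y := (h1.pow 2).add_const _
  have h3 := (h1.add (h2.sqrt (smoothPosPart_arg_pos x n y).ne')).div_const 2
  refine h3.congr_deriv ?_
  have := (Real.sqrt_pos.2 (smoothPosPart_arg_pos x n y)).ne'
  field_simp
  push_cast
  ring

theorem abs_deriv_smoothPosPart_le (n : ℕ) (y : ℝ) :
    |-(1 + (x - y) / √((x - y) ^ 2 + 1 / ((n : ℝ) + 1))) / 2| ≤ 1 := by
  have h : |(x - y) / √((x - y) ^ 2 + 1 / ((n : ℝ) + 1))| ≤ 1 := by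
    rw [abs_div, abs_of_nonneg (Real.sqrt_nonneg _),
      div_le_one (Real.sqrt_pos.2 (smoothPosPart_arg_pos x n y))]
    refine Real.abs_le_sqrt ?_
    have : (0 : ℝ) < 1 / ((n : ℝ) + 1) := by positivity
    linarith
  rw [abs_le] at h ⊢
  constructor <;> linarith

theorem abs_smoothPosPart_le (n : ℕ) (y : ℝ) : |smoothPosPart x n y| ≤ |x - y| + 1 := by
  have h1 : √((x - y) ^ 2 + 1 / ((n : ℝ) + 1)) ≤ |x - y| + 1 := by
    refine Real.sqrt_le_iff.2 ⟨by positivity, ?_⟩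
    have h2 : 1 / ((n : ℝ) + 1) ≤ 1 := by
      rw [div_le_one (by positivity)]
      linarith [(Nat.cast_nonneg n : (0 : ℝ) ≤ n)]
    have h3 := sq_abs (x - y)
    have h4 := abs_nonneg (x - y)
    calc (x - y) ^ 2 + 1 / ((n : ℝ) + 1) ≤ |x - y| ^ 2 + 1 := by rw [h3]; linarith
      _ ≤ (|x - y| + 1) ^ 2 := by ring_nf; linarith
  have h5 := Real.sqrt_nonneg ((x - y) ^ 2 + 1 / ((n : ℝ) + 1))
  have h6 := le_abs_self (x - y)
  have h7 := neg_abs_le (x - y)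
  rw [smoothPosPart, abs_le]
  constructor <;> linarith

theorem tendsto_sqrt_smoothPosPart (y : ℝ) :
    Tendsto (fun n : ℕ => √((x - y) ^ 2 + 1 / ((n : ℝ) + 1))) atTop (𝓝 |x - y|) := by
  rw [← Real.sqrt_sq_eq_abs]
  refine (Real.continuous_sqrt.tendsto _).comp ?_
  simpa using tendsto_one_div_add_atTop_nhds_zero_nat.const_add ((x - y) ^ 2)

theorem tendsto_smoothPosPart (y : ℝ) :
    Tendsto (fun n : ℕ => smoothPosPart x n y) atTop (𝓝 (max (x - y) 0)) := by
  have h : max (x - y) 0 = ((x - y) + |x - y|) / 2 := by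
    rcases le_total 0 (x - y) with h | h
    · rw [max_eq_left h, abs_of_nonneg h]; ring
    · rw [max_eq_right h, abs_of_nonpos h]; ring
  rw [h]
  exact ((tendsto_sqrt_smoothPosPart x y).const_add _).div_const 2

theorem tendsto_deriv_smoothPosPart (y : ℝ) :
    Tendsto (fun n : ℕ => -(1 + (x - y) / √((x - y) ^ 2 + 1 / ((n : ℝ) + 1))) / 2) atTop
      (𝓝 (posPartSlope x y)) := by
  refine Tendsto.div_const (Tendsto.neg (Tendsto.const_add _ ?_)) 2
  by_cases h : x - y = 0
  -- At the kink the quotient is 0 for every `n`, and 0 / 0 = 0 in the limit formula, so the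
  -- limiting slope is -1/2.
  · simp [h]
  · exact (tendsto_const_nhds).div (tendsto_sqrt_smoothPosPart x y) (abs_ne_zero.2 h)

theorem posPartSlope_of_lt {x y : ℝ} (h : y < x) : posPartSlope x y = -1 := by
  rw [posPartSlope, abs_of_pos (sub_pos.2 h), div_self (sub_pos.2 h).ne']
  norm_num

theorem posPartSlope_of_gt {x y : ℝ} (h : x < y) : posPartSlope x y = 0 := by
  rw [posPartSlope, abs_of_neg (sub_neg.2 h), div_neg, div_self (sub_neg.2 h).ne]
  norm_num

theorem measurable_posPartSlope : Measurable (posPartSlope x) := by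
  unfold posPartSlope
  fun_prop

theorem abs_posPartSlope_le (y : ℝ) : |posPartSlope x y| ≤ 1 :=
  le_of_tendsto (tendsto_deriv_smoothPosPart x y).abs
    (Eventually.of_forall fun n => abs_deriv_smoothPosPart_le x n y)

theorem continuousAt_posPartSlope {y : ℝ} (h : y ≠ x) : ContinuousAt (posPartSlope x) y := by
  have h0 : |x - y| ≠ 0 := abs_ne_zero.2 (sub_ne_zero.2 h.symm)
  have h1 : ContinuousAt (fun y => x - y) y := by fun_prop
  exact ((continuousAt_const.add (h1.div h1.abs h0)).neg).div_const 2

/-- Compactly supported smooth approximations of `y ↦ max (x - y) 0` whose derivatives are uniformly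
bounded and converge everywhere. -/
theorem exists_compactSupport_approx_posPart : ∃ (χ : ℕ → ℝ → ℝ) (M : ℝ),
    (∀ n, ContDiff ℝ 1 (χ n)) ∧ (∀ n, HasCompactSupport (χ n)) ∧
    (∀ n y, |χ n y| ≤ |x - y| + 1) ∧ (∀ n y, |deriv (χ n) y| ≤ M) ∧
    (∀ y, Tendsto (fun n => χ n y) atTop (𝓝 (max (x - y) 0))) ∧
    (∀ y, Tendsto (fun n => deriv (χ n) y) atTop (𝓝 (posPartSlope x y))) := by
  let κ : ContDiffBump (0 : ℝ) := ⟨1, 2, one_pos, one_lt_two⟩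
  have hκC : ContDiff ℝ 1 κ := κ.contDiff
  obtain ⟨D, hD⟩ := κ.hasCompactSupport.deriv.exists_bound_of_continuous
    (hκC.continuous_deriv le_rfl)
  have hD0 : 0 ≤ D := (norm_nonneg _).trans (hD 0)
  have hn : ∀ n : ℕ, (0 : ℝ) < n + 1 := fun n => by positivity
  have hχd : ∀ (n : ℕ) (y : ℝ), HasDerivAt
      (fun y => smoothPosPart x n y * κ (y / ((n : ℝ) + 1)))
      (-(1 + (x - y) / √((x - y) ^ 2 + 1 / ((n : ℝ) + 1))) / 2 * κ (y / ((n : ℝ) + 1)) +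
        smoothPosPart x n y * (deriv κ (y / ((n : ℝ) + 1)) * (1 / ((n : ℝ) + 1)))) y :=
    fun n y => by
      have h1 : HasDerivAt (fun y : ℝ => κ (y / ((n : ℝ) + 1)))
          (deriv κ (y / ((n : ℝ) + 1)) * (1 / ((n : ℝ) + 1))) y :=
        HasDerivAt.comp (h := fun y : ℝ => y / ((n : ℝ) + 1)) y
          (hκC.differentiable one_ne_zero _).hasDerivAt ((hasDerivAt_id y).div_const _)
      exact (hasDerivAt_smoothPosPart x n y).mul h1
  -- The cut-off at scale n + 1 has a derivative of order 1 / (n + 1), which vanishes for |y| > 2(n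
  -- + 1); on the remaining region the function is of order n + 1.
  have hbd : ∀ (n : ℕ) (y : ℝ),
      |smoothPosPart x n y * (deriv κ (y / ((n : ℝ) + 1)) * (1 / ((n : ℝ) + 1)))| ≤
        D * (|x| + 3) := fun n y => by
    by_cases hy : |y| ≤ 2 * (n + 1)
    · have h1 : |smoothPosPart x n y| ≤ (|x| + 3) * (n + 1) := by
        have h2 := abs_sub x y
        have h3 := abs_smoothPosPart_le x n y
        have h4 : |x| * 1 ≤ |x| * (n + 1) := by
          gcongr
          linarith [(Nat.cast_nonneg n : (0 : ℝ) ≤ n)]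
        linarith [(Nat.cast_nonneg n : (0 : ℝ) ≤ n)]
      rw [abs_mul, abs_mul, abs_of_pos (show (0 : ℝ) < 1 / (n + 1) by positivity)]
      calc |smoothPosPart x n y| * (|deriv κ (y / ((n : ℝ) + 1))| * (1 / ((n : ℝ) + 1)))
          ≤ (|x| + 3) * (n + 1) * (D * (1 / ((n : ℝ) + 1))) := by
            gcongr
            exact hD _
        _ = D * (|x| + 3) := by
            have := (hn n).ne'
            field_simp
    · have h1 : deriv κ (y / ((n : ℝ) + 1)) = 0 := by
        by_contra hne
        have h2 := support_deriv_subset (Function.mem_support.2 hne)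
        rw [κ.tsupport_eq, Metric.mem_closedBall, Real.dist_eq, sub_zero, abs_div,
          abs_of_pos (hn n), div_le_iff₀ (hn n)] at h2
        exact hy h2
      rw [h1, zero_mul, mul_zero, abs_zero]
      positivity
  refine ⟨fun n y => smoothPosPart x n y * κ (y / ((n : ℝ) + 1)), 1 + D * (|x| + 3),
    fun n => ?_, fun n => ?_, fun n y => ?_, fun n y => ?_, fun y => ?_, fun y => ?_⟩
  · exact (contDiff_smoothPosPart x n).mul (hκC.comp (contDiff_id.div_const _))
  · refine HasCompactSupport.intro (isCompact_Icc (a := -(2 * ((n : ℝ) + 1)))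
      (b := 2 * ((n : ℝ) + 1))) fun y hy => ?_
    have : κ (y / ((n : ℝ) + 1)) = 0 := by
      refine κ.zero_of_le_dist ?_
      rw [Real.dist_eq, sub_zero, abs_div, abs_of_pos (hn n)]
      change (2 : ℝ) ≤ _
      rw [le_div_iff₀ (hn n)]
      by_contra hlt
      exact hy (abs_le.1 (not_le.1 hlt).le)
    beta_reduce
    rw [this, mul_zero]
  · rw [abs_mul, abs_of_nonneg κ.nonneg]
    exact (mul_le_of_le_one_right (abs_nonneg _) κ.le_one).trans (abs_smoothPosPart_le x n y)
  · rw [(hχd n y).deriv]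
    refine (abs_add_le _ _).trans (add_le_add ?_ (hbd n y))
    rw [abs_mul, abs_of_nonneg κ.nonneg]
    exact (mul_le_of_le_one_right (abs_nonneg _) κ.le_one).trans
      (abs_deriv_smoothPosPart_le x n y)
  all_goals
    have hball : ∀ᶠ n : ℕ in atTop, y / ((n : ℝ) + 1) ∈ Metric.ball (0 : ℝ) 1 := by
      filter_upwards [tendsto_natCast_atTop_atTop.eventually (eventually_ge_atTop |y|)] with n hny
      rw [Metric.mem_ball, Real.dist_eq, sub_zero, abs_div, abs_of_pos (hn n), div_lt_one (hn n)]
      linarith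
  · refine (tendsto_smoothPosPart x y).congr' ?_
    filter_upwards [hball] with n hny
    rw [κ.one_of_mem_closedBall (Metric.ball_subset_closedBall hny), mul_one]
  · refine (tendsto_deriv_smoothPosPart x y).congr' ?_
    filter_upwards [hball] with n hny
    have h1 : deriv κ (y / ((n : ℝ) + 1)) = 0 := by
      rw [(κ.eventuallyEq_one_of_mem_ball hny).deriv_eq]
      exact deriv_const _ _
    rw [(hχd n y).deriv, κ.one_of_mem_closedBall (Metric.ball_subset_closedBall hny), h1, zero_mul,
      mul_zero, add_zero, mul_one]

end SmoothPosPart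

/-- A continuous curve of quantile functions in `L¹(0, 1)` whose laws solve the continuity equation
with velocity `G` in the weak sense. -/
structure IsWeakQuantileCurve (G : Lp ℝ 1 unitVolume → Lp ℝ 1 unitVolume)
    (y : ℝ → Lp ℝ 1 unitVolume) : Prop where
  continuous : Continuous y
  strictMono : ∀ t, 0 < t → ∃ Y : ℝ → ℝ, StrictMonoOn Y (Ioo 0 1) ∧ y t =ᵐ[unitVolume] Y
  weak : ∀ χ : ℝ → ℝ, ContDiff ℝ 1 χ → HasCompactSupport χ → ∀ t₁ t₂, 0 < t₁ → t₁ ≤ t₂ →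
    ∫ z, χ (y t₂ z) ∂unitVolume - ∫ z, χ (y t₁ z) ∂unitVolume =
      ∫ s in t₁..t₂, ∫ z, deriv χ (y s z) * G (y s) z ∂unitVolume

/-! ### From the weak formulation to a differential equation in L¹ -/

namespace IsWeakQuantileCurve

variable {G : Lp ℝ 1 unitVolume → Lp ℝ 1 unitVolume} {y : ℝ → Lp ℝ 1 unitVolume}

theorem integrable_posPart (f : Lp ℝ 1 unitVolume) (x : ℝ) :
    Integrable (fun z => max (x - f z) 0) unitVolume :=
  ((integrable_const x).sub (L1.integrable_coeFn f)).pos_part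

theorem aestronglyMeasurable_comp (f : Lp ℝ 1 unitVolume) {k : ℝ → ℝ} (hk : Measurable k) :
    AEStronglyMeasurable (fun z => k (f z)) unitVolume :=
  (hk.comp (Lp.stronglyMeasurable f).measurable).aestronglyMeasurable

/-- Dominated convergence extends the weak identity from compactly supported test functions to (x -
·)⁺: the approximations grow at most linearly, against integrable quantile functions, and their
slopes are uniformly bounded. -/
theorem integral_posPart_sub (h : IsWeakQuantileCurve G y) (hG : Continuous G) (x : ℝ)
    {t₁ t₂ : ℝ} (ht₁ : 0 < t₁) (h12 : t₁ ≤ t₂) :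
    ∫ z, max (x - y t₂ z) 0 ∂unitVolume - ∫ z, max (x - y t₁ z) 0 ∂unitVolume =
      ∫ s in t₁..t₂, ∫ z, posPartSlope x (y s z) * G (y s) z ∂unitVolume := by
  obtain ⟨χ, M, hC, hsupp, hb, hbd, hlim, hlimd⟩ := exists_compactSupport_approx_posPart x
  have hM0 : 0 ≤ M := (abs_nonneg _).trans (hbd 0 0)
  have hL : ∀ t, Tendsto (fun n => ∫ z, χ n (y t z) ∂unitVolume) atTop
      (𝓝 (∫ z, max (x - y t z) 0 ∂unitVolume)) := fun t => by
    refine tendsto_integral_of_dominated_convergence (fun z => |x - y t z| + 1)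
      (fun n => aestronglyMeasurable_comp _ (hC n).continuous.measurable)
      ((((integrable_const x).sub (L1.integrable_coeFn (y t))).abs).add (integrable_const _))
      (fun n => ae_of_all _ fun z => hb n _) (ae_of_all _ fun z => hlim _)
  have hR : Tendsto (fun n => ∫ s in t₁..t₂, ∫ z, deriv (χ n) (y s z) * G (y s) z ∂unitVolume)
      atTop (𝓝 (∫ s in t₁..t₂, ∫ z, posPartSlope x (y s z) * G (y s) z ∂unitVolume)) := by
    have hdc : ∀ n, Continuous (deriv (χ n)) := fun n => (hC n).continuous_deriv le_rfl
    have hGy : Continuous fun s => M * ‖G (y s)‖ :=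
      continuous_const.mul (hG.comp h.continuous).norm
    have hbound : ∀ n s z, ‖deriv (χ n) (y s z) * G (y s) z‖ ≤ M * ‖G (y s) z‖ := fun n s z => by
      rw [norm_mul]
      exact mul_le_mul_of_nonneg_right (hbd n _) (norm_nonneg _)
    refine intervalIntegral.tendsto_integral_filter_of_dominated_convergence
      (fun s => M * ‖G (y s)‖) (Eventually.of_forall fun n => ?_)
      (Eventually.of_forall fun n => ae_of_all _ fun s _ => ?_) (hGy.intervalIntegrable _ _)
      (ae_of_all _ fun s _ => ?_)
    · have h1 : Continuous fun f : Lp ℝ 1 unitVolume =>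
          ∫ z, deriv (χ n) (f z) * G f z ∂unitVolume :=
        continuous_iff_continuousAt.2 fun f => continuousAt_integral_comp_mul
          (hdc n).measurable (hbd n) hG.continuousAt (ae_of_all _ fun z => (hdc n).continuousAt)
      exact (h1.comp h.continuous).aestronglyMeasurable
    · rw [L1.norm_eq_integral_norm, ← integral_const_mul]
      exact norm_integral_le_of_norm_le ((L1.integrable_coeFn (G (y s))).norm.const_mul M)
        (ae_of_all _ fun z => hbound n s z)
    · exact tendsto_integral_of_dominated_convergence (fun z => M * ‖G (y s) z‖)
        (fun n => (aestronglyMeasurable_comp _ (hdc n).measurable).mul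
          (L1.integrable_coeFn _).aestronglyMeasurable)
        ((L1.integrable_coeFn (G (y s))).norm.const_mul M)
        (fun n => ae_of_all _ fun z => hbound n s z)
        (ae_of_all _ fun z => (hlimd _).mul_const _)
  refine tendsto_nhds_unique ((hL t₂).sub (hL t₁)) (hR.congr fun n => ?_)
  exact (h.weak (χ n) (hC n) (hsupp n) t₁ t₂ ht₁ h12).symm

theorem setIntegral_Ioc_const_sub (f : Lp ℝ 1 unitVolume) (x : ℝ) {z : ℝ}
    (hz : z ∈ Ioo (0 : ℝ) 1) :
    ∫ s in Ioc 0 z, (x - f s) ∂unitVolume = x * z - ∫ s in Ioc 0 z, f s ∂unitVolume := by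
  rw [integral_sub (integrable_const _) (L1.integrable_coeFn f).integrableOn, setIntegral_const,
    measureReal_def, unitVolume_Ioc_zero hz.2.le, ENNReal.toReal_ofReal hz.1.le, smul_eq_mul,
    mul_comm]

/-- With `young_eq` this says that z ↦ ∫₀ᶻ f and x ↦ ∫ (x - f)⁺ are Legendre conjugates when `f` is
monotone, equality holding at x = f(z). -/
theorem young_le (f : Lp ℝ 1 unitVolume) (x : ℝ) {z : ℝ} (hz : z ∈ Ioo (0 : ℝ) 1) :
    x * z - ∫ s in Ioc 0 z, f s ∂unitVolume ≤ ∫ s, max (x - f s) 0 ∂unitVolume := by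
  rw [← setIntegral_Ioc_const_sub f x hz]
  have h1 := integrable_posPart f x
  refine (integral_mono (((integrable_const x).sub (L1.integrable_coeFn f)).integrableOn)
    h1.integrableOn fun s => le_max_left _ _).trans ?_
  exact setIntegral_le_integral h1 (ae_of_all _ fun s => le_max_right _ _)

theorem young_eq {f : Lp ℝ 1 unitVolume} {Y : ℝ → ℝ} (hY : MonotoneOn Y (Ioo 0 1))
    (hf : f =ᵐ[unitVolume] Y) {z : ℝ} (hz : z ∈ Ioo (0 : ℝ) 1) :
    Y z * z - ∫ s in Ioc 0 z, f s ∂unitVolume = ∫ s, max (Y z - f s) 0 ∂unitVolume := by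
  rw [← setIntegral_Ioc_const_sub f _ hz, ← integral_indicator measurableSet_Ioc]
  refine integral_congr_ae ?_
  filter_upwards [hf, ae_unitVolume_mem_Ioo] with s hs hs'
  by_cases h : s ≤ z
  · rw [indicator_of_mem (show s ∈ Ioc 0 z from ⟨hs'.1, h⟩), hs,
      max_eq_left (sub_nonneg.2 (hY hs' hz h))]
  · rw [indicator_of_notMem (fun hs'' => h hs''.2), hs,
      max_eq_right (sub_nonpos.2 (hY hz hs' (not_le.1 h).le))]

/-- Fix t and x = Y(z). By duality s ↦ xz - ∫ (x - y_s)⁺ lies below s ↦ ∫₀ᶻ y_s and touches it at s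
= t. Its derivative at t is known from the weak formulation and equals ∫₀ᶻ G(y_t), because the slope
of (x - ·)⁺ at Y(r) is -1 for r < z and 0 for r > z. -/
theorem setIntegral_sub (h : IsWeakQuantileCurve G y) (hG : Continuous G) {z : ℝ}
    (hz : z ∈ Ioo (0 : ℝ) 1) {t₁ t₂ : ℝ} (ht₁ : 0 < t₁) (h12 : t₁ ≤ t₂) :
    ∫ s in Ioc 0 z, y t₂ s ∂unitVolume - ∫ s in Ioc 0 z, y t₁ s ∂unitVolume =
      ∫ t in t₁..t₂, ∫ s in Ioc 0 z, G (y t) s ∂unitVolume := by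
  refine sub_eq_integral_of_touching_below
    (ψ := fun t => ∫ s in Ioc 0 z, y t s ∂unitVolume)
    (c := fun t => ∫ s in Ioc 0 z, G (y t) s ∂unitVolume)
    ((continuous_setIntegral _).comp h.continuous)
    ((continuous_setIntegral _).comp (hG.comp h.continuous)) (fun t ht => ?_) ht₁ h12
  obtain ⟨Y, hY, hyY⟩ := h.strictMono t ht
  set x := Y z with hx
  set Φ : ℝ → ℝ := fun s => ∫ r, max (x - y s r) 0 ∂unitVolume with hΦ
  set β : ℝ → ℝ := fun s => ∫ r, posPartSlope x (y s r) * G (y s) r ∂unitVolume with hβ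
  -- The constant xz of the touching function cancels in differences.
  refine ⟨fun s => -Φ s, ?_, fun s _ => ?_⟩
  · have hβc : ∀ s, 0 < s → ContinuousAt β s := fun s hs => by
      obtain ⟨Y', hY', hyY'⟩ := h.strictMono s hs
      refine ContinuousAt.comp (f := y) (continuousAt_integral_comp_mul (measurable_posPartSlope x)
        (abs_posPartSlope_le x) hG.continuousAt ?_) h.continuous.continuousAt
      -- Strict monotonicity makes this level set at most one point, so the discontinuity of the
      -- slope at `x` is not seen by the integral.
      have hcount : {r | r ∈ Ioo (0 : ℝ) 1 ∧ Y' r = x}.Subsingleton := fun a ha b hb =>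
        hY'.injOn ha.1 hb.1 (ha.2.trans hb.2.symm)
      filter_upwards [hyY', ae_unitVolume_mem_Ioo, hcount.countable.ae_notMem unitVolume]
        with r hr hr' hne
      refine continuousAt_posPartSlope x ?_
      rw [hr]
      exact fun heq => hne ⟨hr', heq⟩
    have hβon : ContinuousOn β (Ioi 0) := fun s hs => (hβc s hs).continuousWithinAt
    have hmeas : StronglyMeasurableAtFilter β (𝓝 t) volume :=
      hβon.stronglyMeasurableAtFilter isOpen_Ioi t ht
    have hβt : β t = -∫ s in Ioc 0 z, G (y t) s ∂unitVolume := by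
      rw [← integral_indicator measurableSet_Ioc, ← integral_neg]
      refine integral_congr_ae ?_
      filter_upwards [hyY, ae_unitVolume_mem_Ioo,
        (countable_singleton z).ae_notMem unitVolume] with r hr hr' hne
      rw [hr]
      rcases lt_or_gt_of_ne (show r ≠ z from hne) with hlt | hlt
      · rw [posPartSlope_of_lt (hY hr' hz hlt),
          indicator_of_mem (show r ∈ Ioc 0 z from ⟨hr'.1, hlt.le⟩), neg_one_mul]
      · rw [posPartSlope_of_gt (hY hz hr' hlt),
          indicator_of_notMem (fun hr'' => absurd hr''.2 (not_le.2 hlt)), zero_mul, neg_zero]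
    have hd := intervalIntegral.integral_hasDerivAt_right
      (IntervalIntegrable.refl (f := β) (μ := volume) (a := t)) hmeas (hβc t ht)
    have hd2 : HasDerivAt (fun s => -Φ t - ∫ r in t..s, β r) (-β t) t := by
      simpa using hd.const_sub (-Φ t)
    rw [hβt, neg_neg] at hd2
    refine hd2.congr_of_eventuallyEq ?_
    filter_upwards [Ioi_mem_nhds ht] with s hs
    rcases le_total t s with hts | hts
    · have := h.integral_posPart_sub hG x ht hts
      simp only [hΦ, hβ]
      linarith
    · have := h.integral_posPart_sub hG x hs hts
      rw [intervalIntegral.integral_symm]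
      simp only [hΦ, hβ]
      linarith
  · have h1 := young_le (y s) x hz
    have h2 := young_eq hY.monotoneOn hyY hz
    simp only [hΦ]
    rw [← h2]
    linarith

theorem sub_eq_integral (h : IsWeakQuantileCurve G y) (hG : Continuous G)
    {t₁ t₂ : ℝ} (ht₁ : 0 < t₁) (h12 : t₁ ≤ t₂) : y t₂ - y t₁ = ∫ t in t₁..t₂, G (y t) := by
  rw [← sub_eq_zero]
  refine eq_zero_of_forall_setIntegral_Ioc fun z hz => ?_
  rw [← setIntegralL1_apply, map_sub, map_sub, sub_eq_zero]
  have hII : IntervalIntegrable (fun t => G (y t)) volume t₁ t₂ :=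
    (hG.comp h.continuous).intervalIntegrable _ _
  rw [← (setIntegralL1 (Ioc 0 z)).intervalIntegral_comp_comm hII]
  exact h.setIntegral_sub hG hz ht₁ h12

/-- The integrated equation is known between positive times; continuity of the curve extends it to
time 0, where the measure may be singular. -/
theorem hasDerivWithinAt (h : IsWeakQuantileCurve G y) (hG : Continuous G) {t : ℝ} (ht : 0 ≤ t) :
    HasDerivWithinAt y (G (y t)) (Ici 0) t := by
  have hGy : Continuous fun s => G (y s) := hG.comp h.continuous
  have hGI : ∀ a b, IntervalIntegrable (fun s => G (y s)) volume a b :=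
    fun a b => hGy.intervalIntegrable a b
  have hFTC : ∀ s, HasDerivAt (fun s => ∫ r in (0 : ℝ)..s, G (y r)) (G (y s)) s :=
    fun s => (hGy.integral_hasStrictDerivAt 0 s).hasDerivAt
  set E : ℝ → Lp ℝ 1 unitVolume := fun s => y s - ∫ r in (0 : ℝ)..s, G (y r) with hE
  have hEc : Continuous E := h.continuous.sub
    (continuous_iff_continuousAt.2 fun s => (hFTC s).continuousAt)
  have hE1 : ∀ s, 0 < s → E s = E 1 := by
    have key : ∀ a b, 0 < a → a ≤ b → E a = E b := fun a b ha hab => by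
      have h1 := h.sub_eq_integral hG ha hab
      rw [← intervalIntegral.integral_interval_sub_left (hGI 0 b) (hGI 0 a)] at h1
      simp only [hE]
      rw [sub_eq_sub_iff_add_eq_add] at h1 ⊢
      rw [add_comm (y a), h1, add_comm]
    intro s hs
    rcases le_total s 1 with h1 | h1
    · exact key s 1 hs h1
    · exact (key 1 s one_pos h1).symm
  have hE0 : ∀ s, 0 ≤ s → E s = E 1 := by
    have hcl : IsClosed {s | E s = E 1} := isClosed_eq hEc continuous_const
    have : Ici (0 : ℝ) ⊆ {s | E s = E 1} := by
      rw [← closure_Ioi]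
      exact hcl.closure_subset_iff.2 fun s hs => hE1 s hs
    exact fun s hs => this hs
  have hyE : ∀ s ∈ Ici (0 : ℝ), y s = (∫ r in (0 : ℝ)..s, G (y r)) + E 1 := fun s hs => by
    rw [← hE0 s hs]
    simp only [hE]
    abel
  exact ((hFTC t).add_const (E 1)).hasDerivWithinAt.congr hyE (hyE t ht)

end IsWeakQuantileCurve

/-! ### Uniqueness of dissipative solutions -/

open scoped Classical in
/-- The quantile function as an element of `L¹(0, 1)`. -/
noncomputable def quantileL1 (μ : Measure ℝ) : Lp ℝ 1 unitVolume :=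
  if h : MemLp (quantile μ) 1 unitVolume then h.toLp _ else 0

theorem coeFn_quantileL1 {μ : Measure ℝ} (h : MemLp (quantile μ) 1 unitVolume) :
    quantileL1 μ =ᵐ[unitVolume] quantile μ := by
  rw [quantileL1, dif_pos h]
  exact h.coeFn_toLp

theorem HasBoundedDensity.measure_singleton {μ : Measure ℝ} (h : HasBoundedDensity μ) (x : ℝ) :
    μ {x} = 0 := by
  obtain ⟨f, -, -, rfl⟩ := h
  exact withDensity_absolutelyContinuous _ _ (MeasureTheory.measure_singleton x)

namespace IsDissipativeSolution

variable {V v w : ℝ → ℝ} {lam : ℝ} {K L : ℝ≥0} {p : ℝ≥0∞} {ρ₀ : Measure ℝ} {μ : ℝ → Measure ℝ}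

theorem memLp_quantile_one (h : IsDissipativeSolution V v p ρ₀ μ) (hp : 1 ≤ p) {t : ℝ}
    (ht : 0 ≤ t) : MemLp (quantile (μ t)) 1 unitVolume := by
  have := h.prob t ht
  exact (memLp_quantile (h.moment t ht)).mono_exponent hp

theorem edist_quantileL1_le (h : IsDissipativeSolution V v p ρ₀ μ) (hp : 1 ≤ p) {s t : ℝ}
    (ht : 0 ≤ t) (hs : 0 ≤ s) :
    edist (quantileL1 (μ t)) (quantileL1 (μ s)) ≤ wassersteinDist p (μ t) (μ s) := by
  have h1 := h.memLp_quantile_one hp ht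
  have h2 := h.memLp_quantile_one hp hs
  rw [quantileL1, quantileL1, dif_pos h1, dif_pos h2, Lp.edist_toLp_toLp]
  exact eLpNorm_le_eLpNorm_of_exponent_le hp (h1.sub h2).aestronglyMeasurable

theorem continuous_quantileL1 (h : IsDissipativeSolution V v p ρ₀ μ) (hp : 1 ≤ p) :
    Continuous fun t => quantileL1 (μ (max t 0)) := by
  refine continuous_iff_continuousAt.2 fun s => ?_
  have hmax : Tendsto (fun t : ℝ => max t 0) (𝓝 s) (𝓝[Ici 0] (max s 0)) :=
    tendsto_nhdsWithin_iff.2 ⟨(continuous_id.max continuous_const).continuousAt,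
      Eventually.of_forall fun t => mem_Ici.2 (le_max_right _ _)⟩
  refine tendsto_iff_edist_tendsto_0.2 ?_
  exact tendsto_of_tendsto_of_tendsto_of_le_of_le tendsto_const_nhds
    ((h.continuous _ (le_max_right s 0)).comp hmax) (fun _ => zero_le)
    fun t => h.edist_quantileL1_le hp (le_max_right _ _) (le_max_right _ _)

theorem strictMonoOn_quantile (h : IsDissipativeSolution V v p ρ₀ μ) {t : ℝ} (ht : 0 < t) :
    StrictMonoOn (quantile (μ t)) (Ioo 0 1) := by
  have := h.prob t ht.le
  refine strictMonoOn_of_map_noAtoms monotoneOn_quantile fun x => ?_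
  rw [map_quantile]
  exact (h.bounded t ht).measure_singleton x

theorem W_quantile_eq (h : IsDissipativeSolution V v p ρ₀ μ) (hp : 1 ≤ p)
    (hV : InteractionKernel V lam) (hwv : ∀ r, (∃ x, V x ≤ r) → w r = v r)
    {t : ℝ} (ht : 0 < t) {z : ℝ} (hz : z ∈ Ioo (0 : ℝ) 1) :
    W V v (μ t) (quantile (μ t) z) = quantileField (U V lam) w lam (quantile (μ t)) z := by
  have := h.prob t ht.le
  rw [W, ← hwv _ (exists_le_integral_kernel hV (μ t) _), quantileField,
    ← integral_kernel_eq hV (h.strictMonoOn_quantile ht)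
      (memLp_one_iff_integrable.1 (h.memLp_quantile_one hp ht.le)) hz, map_quantile]

/-- Test functions of product form χ(x) θ(t) turn the space-time equation into a distributional
equation in time for each χ, which `sub_eq_integral_of_forall_test` integrates. -/
theorem isWeakQuantileCurve (h : IsDissipativeSolution V v p ρ₀ μ) (hp : 1 ≤ p)
    (hV : InteractionKernel V lam) (hv : Continuous v) (hu : LipschitzWith K (U V lam))
    (hw : LipschitzWith L w) (hwv : ∀ r, (∃ x, V x ≤ r) → w r = v r) :
    IsWeakQuantileCurve (quantileFieldL1 hu hw lam) fun t => quantileL1 (μ (max t 0)) where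
  continuous := h.continuous_quantileL1 hp
  strictMono t ht := by
    rw [max_eq_left ht.le]
    exact ⟨_, h.strictMonoOn_quantile ht, coeFn_quantileL1 (h.memLp_quantile_one hp ht.le)⟩
  weak χ hχ hχc t₁ t₂ ht₁ h12 := by
    have hdχ := hχ.continuous_deriv le_rfl
    obtain ⟨A, hA⟩ := hχ.continuous.bounded_above_of_compact_support hχc
    obtain ⟨B, hB⟩ := hdχ.bounded_above_of_compact_support hχc.deriv
    have hy := h.continuous_quantileL1 hp
    refine sub_eq_integral_of_forall_test
      (a := fun t => ∫ z, χ (quantileL1 (μ (max t 0)) z) ∂unitVolume)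
      (b := fun t => ∫ z, deriv χ (quantileL1 (μ (max t 0)) z) *
        quantileFieldL1 hu hw lam (quantileL1 (μ (max t 0))) z ∂unitVolume)
      ((continuous_integral_comp hχ.continuous hA).comp hy) ?_ (fun θ hθ hθc hθs => ?_) ht₁ h12
    · refine continuous_iff_continuousAt.2 fun s => ContinuousAt.comp
        (f := fun t => quantileL1 (μ (max t 0))) (continuousAt_integral_comp_mul hdχ.measurable hB
          (lipschitzWith_quantileFieldL1 hu hw lam).continuous.continuousAt
          (ae_of_all _ fun z => hdχ.continuousAt)) hy.continuousAt
    · have hφ : ContDiff ℝ 1 fun q : ℝ × ℝ => χ q.1 * θ q.2 :=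
        (hχ.comp contDiff_fst).mul (hθ.comp contDiff_snd)
      have hsub : tsupport (fun q : ℝ × ℝ => χ q.1 * θ q.2) ⊆ tsupport χ ×ˢ tsupport θ := by
        refine closure_minimal (fun q hq => ?_)
          ((isClosed_tsupport χ).prod (isClosed_tsupport θ))
        exact ⟨subset_tsupport _ (left_ne_zero_of_mul hq),
          subset_tsupport _ (right_ne_zero_of_mul hq)⟩
      have hφc : HasCompactSupport fun q : ℝ × ℝ => χ q.1 * θ q.2 :=
        (hχc.isCompact.prod hθc.isCompact).of_isClosed_subset (isClosed_tsupport _) hsub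
      have hweak := h.weak _ hφ hφc fun q hq => hθs (hsub hq).2
      refine (congrArg₂ (· + ·) ?_ ?_).trans hweak
      · refine setIntegral_congr_fun measurableSet_Ioi fun t ht => ?_
        have ht' : (0 : ℝ) < t := ht
        have := h.prob t ht'.le
        rw [max_eq_left ht'.le, ← integral_const_mul,
          integral_eq_integral_quantile
            (f := fun x => deriv (fun s => χ x * θ s) t) ?_]
        · refine integral_congr_ae ?_
          filter_upwards [coeFn_quantileL1 (h.memLp_quantile_one hp ht'.le)] with z hz
          rw [hz, deriv_const_mul_field, mul_comm]
        · simp only [deriv_const_mul_field]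
          exact hχ.continuous.measurable.mul_const _
      · refine setIntegral_congr_fun measurableSet_Ioi fun t ht => ?_
        have ht' : (0 : ℝ) < t := ht
        have := h.prob t ht'.le
        have hq := coeFn_quantileL1 (h.memLp_quantile_one hp ht'.le)
        rw [max_eq_left ht'.le, ← integral_const_mul,
          integral_eq_integral_quantile
            (f := fun x => W V v (μ t) x * deriv (fun s => χ s * θ t) x) ?_]
        · refine integral_congr_ae ?_
          filter_upwards [hq, coeFn_quantileFieldL1 hu hw lam (quantileL1 (μ t)),
            quantileField_congr (u := U V lam) (w := w) lam hq, ae_unitVolume_mem_Ioo]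
            with z hz hz₁ hz₂ hz₃
          rw [hz₁, hz₂, hz, h.W_quantile_eq hp hV hwv ht' hz₃, deriv_mul_const_field]
          ring
        · simp only [deriv_mul_const_field]
          exact (hv.measurable.comp (measurable_integral_kernel hV _)).mul
            (hdχ.measurable.mul_const _)

/-- Both families of quantile functions solve the same Lipschitz equation in L¹ with the same
initial value. The exponents may differ because only L¹ continuity enters. -/
theorem unique {μ' : ℝ → Measure ℝ} {p' : ℝ≥0∞} (h : IsDissipativeSolution V v p ρ₀ μ)
    (h' : IsDissipativeSolution V v p' ρ₀ μ') (hp : 1 ≤ p) (hp' : 1 ≤ p')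
    (hV : InteractionKernel V lam) (hv : VelocityMap V v) {t : ℝ} (ht : 0 ≤ t) : μ t = μ' t := by
  obtain ⟨K, hu⟩ := hV.exists_lipschitzWith_U
  obtain ⟨w, ⟨L, hw⟩, -, hwv⟩ := hv.exists_strongly_decreasing
  obtain ⟨_, hvL⟩ := hv.lipschitz
  have hG := lipschitzWith_quantileFieldL1 hu hw lam
  have hy := h.isWeakQuantileCurve hp hV hvL.continuous hu hw hwv
  have hy' := h'.isWeakQuantileCurve hp' hV hvL.continuous hu hw hwv
  have heq := eq_of_hasDerivWithinAt_Ici hG (fun s hs => hy.hasDerivWithinAt hG.continuous hs)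
    (fun s hs => hy'.hasDerivWithinAt hG.continuous hs) (by simp [h.initial, h'.initial]) ht
  rw [max_eq_left ht] at heq
  have := h.prob t ht
  have := h'.prob t ht
  rw [← map_quantile (μ := μ t), ← map_quantile (μ := μ' t)]
  refine Measure.map_congr ((coeFn_quantileL1 (h.memLp_quantile_one hp ht)).symm.trans ?_)
  rw [heq]
  exact coeFn_quantileL1 (h'.memLp_quantile_one hp' ht)

end IsDissipativeSolution

/-! ### The particle system -/

/-- `x` is a solution of the particle system with velocity `w` that starts from the values of `q`;
`c` is a lower bound for its expansion. -/
structure IsParticleFlow (V w : ℝ → ℝ) (lam : ℝ) (q c : ℝ → ℝ) (N : ℕ)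
    (x : Fin (N + 1) → ℝ → ℝ) : Prop where
  continuous : ∀ i, Continuous (x i)
  initial : ∀ i, x i 0 = q ((i : ℝ) / N)
  nonneg : ∀ t, 0 ≤ t → 0 ≤ c t
  pos : ∀ t, 0 < t → 0 < c t
  mono : ∀ s t, s ≤ t → c s ≤ c t
  expanding : ∀ t, 0 ≤ t → ∀ i j : Fin (N + 1), i ≤ j → c t * (((j : ℝ) - i) / N) ≤ x j t - x i t
  hasDeriv : ∀ i, ∀ t, 0 ≤ t → HasDerivWithinAt (x i)
    (w ((1 / (N : ℝ)) * ∑ k, U V lam (x i t - x k t) - (1 / (N : ℝ)) * lam * ((i : ℝ) + 1)))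
    (Ici 0) t

/-- The label of the `i`-th particle. -/
noncomputable def particleLabel {R : ℝ} (hR : -R ≤ R) (q : ℝ → ℝ) (N i : ℕ) : Label R :=
  Label.mk hR (q ((i : ℝ) / N)) (((i : ℝ) + 1) / N)

/-- The distribution of the labels of the particles `0, …, N`, each of mass `1 / N`. -/
noncomputable def particleMeasure {R : ℝ} (hR : -R ≤ R) (q : ℝ → ℝ) (N : ℕ) :
    Measure (Label R) :=
  (N : ℝ≥0)⁻¹ • ∑ k ∈ Finset.range (N + 1), Measure.dirac (particleLabel hR q N k)

section ParticleMeasure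

variable {R : ℝ} {hR : -R ≤ R} {q : ℝ → ℝ} {N : ℕ}

theorem natCast_div_mem_Icc {i : ℕ} (hi : i ≤ N) : (i : ℝ) / N ∈ Icc (0 : ℝ) 1 :=
  ⟨by positivity, div_le_one_of_le₀ (by exact_mod_cast hi) (by positivity)⟩

theorem natCast_add_one_div_mem_Icc (hN : 1 ≤ N) {i : ℕ} (hi : i ≤ N) :
    ((i : ℝ) + 1) / N ∈ Icc (0 : ℝ) 2 := by
  have hN' : (1 : ℝ) ≤ N := by exact_mod_cast hN
  have hi' : (i : ℝ) ≤ N := by exact_mod_cast hi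
  refine ⟨by positivity, ?_⟩
  rw [div_le_iff₀ (by linarith)]
  linarith

instance : IsFiniteMeasure (particleMeasure hR q N) := by
  unfold particleMeasure
  infer_instance

theorem integral_particleMeasure {f : Label R → ℝ} (hf : Continuous f) :
    ∫ s, f s ∂(particleMeasure hR q N) =
      (1 / (N : ℝ)) * ∑ k ∈ Finset.range (N + 1), f (particleLabel hR q N k) := by
  rw [particleMeasure, integral_smul_nnreal_measure, integral_finsetSum_measure
    fun _ _ => integrable_of_continuous_compactSpace _ hf]
  simp [NNReal.smul_def]

theorem particleMeasure_real_univ_le (hN : 1 ≤ N) :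
    (particleMeasure hR q N).real univ ≤ 2 := by
  have hN' : (1 : ℝ) ≤ N := by exact_mod_cast hN
  have := integral_particleMeasure (hR := hR) (q := q) (N := N) (f := fun _ => 1) continuous_const
  rw [integral_const, smul_eq_mul, mul_one] at this
  rw [this]
  simp only [Finset.sum_const, Finset.card_range, nsmul_eq_mul, mul_one]
  push_cast
  rw [one_div, inv_mul_le_iff₀ (by linarith)]
  linarith

variable {V w : ℝ → ℝ} {lam b : ℝ} {K L : ℝ≥0} {Φ : ℝ → C(Label R, ℝ)}

/-- The mass coordinate (i + 1)/N reproduces the subtracted term λ(i + 1)/N and, being at most 2,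
explains the range of labels. It differs by 1/N between neighbours, which separates particles that
start at the same point. -/
theorem isParticleFlow_of_isMeanFieldFlow (hN : 1 ≤ N) (hq : MonotoneOn q (Icc 0 1))
    (hqR : ∀ z ∈ Icc (0 : ℝ) 1, q z ∈ Icc (-R) R)
    (hu : LipschitzWith K (U V lam)) (hw : LipschitzWith L w) (hb : 0 < b) (hlam : 0 < lam)
    (hdec : ∀ r₁ r₂ : ℝ, r₁ ≤ r₂ → b * (r₂ - r₁) ≤ w r₁ - w r₂)
    (hΦ : IsMeanFieldFlow (U V lam) w (particleMeasure hR q N) (Label.mass R lam)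
      (Label.position R) Φ) :
    IsParticleFlow V w lam q
      (fun t => b * lam / (2 * (2 * L * K + 1)) * (1 - Real.exp (-((2 * L * K + 1) * t)))) N
      (fun i t => Φ t (particleLabel hR q N i)) := by
  have hN' : (0 : ℝ) < N := by exact_mod_cast hN
  have hM : (0 : ℝ) < 2 * L * K + 1 := by positivity
  have hpos : ∀ i ≤ N, Label.position R (particleLabel hR q N i) = q ((i : ℝ) / N) := fun i hi =>
    Label.position_mk hR _ (hqR _ (natCast_div_mem_Icc hi))
  have hmass : ∀ i ≤ N, Label.mass R lam (particleLabel hR q N i) = lam * (((i : ℝ) + 1) / N) :=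
    fun i hi => Label.mass_mk lam hR _ (natCast_add_one_div_mem_Icc hN hi)
  refine ⟨fun i => ?_, fun i => ?_, fun t ht => ?_, fun t ht => ?_, fun s t hst => ?_,
    fun t ht i j hij => ?_, fun i t ht => ?_⟩
  · exact hΦ.continuous_uncurry.comp (continuous_id.prodMk continuous_const)
  · rw [hΦ.initial, hpos _ (Nat.lt_succ_iff.1 i.2)]
  · have : Real.exp (-((2 * L * K + 1) * t)) ≤ 1 := Real.exp_le_one_iff.2 (by
      have := mul_nonneg hM.le ht
      linarith)
    exact mul_nonneg (by positivity) (by linarith)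
  · have : Real.exp (-((2 * L * K + 1) * t)) < 1 := Real.exp_lt_one_iff.2 (by nlinarith)
    exact mul_pos (by positivity) (by linarith)
  · gcongr
  · rcases hij.eq_or_lt with rfl | hlt
    · simp
    · have hi := Nat.lt_succ_iff.1 i.2
      have hj := Nat.lt_succ_iff.1 j.2
      have hij' : ((i : ℕ) : ℝ) < (j : ℕ) := by exact_mod_cast hlt
      have := hΦ.sub_ge hu hw (particleMeasure_real_univ_le hN) hb hdec
        (s₁ := particleLabel hR q N i) (s₂ := particleLabel hR q N j)
        (by
          rw [hpos _ hi, hpos _ hj]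
          exact hq (natCast_div_mem_Icc hi) (natCast_div_mem_Icc hj) (by gcongr))
        (by
          rw [hmass _ hi, hmass _ hj]
          gcongr) ht
      refine le_trans (le_of_eq ?_) this
      rw [hmass _ hi, hmass _ hj]
      ring
  · have := hΦ.hasDerivWithinAt_apply ht (particleLabel hR q N i)
    rw [integral_particleMeasure (f := fun s => U V lam (Φ t (particleLabel hR q N i) - Φ t s))
      (hu.continuous.comp (by fun_prop)), hmass _ (Nat.lt_succ_iff.1 i.2),
      Finset.sum_range fun k => U V lam (Φ t (particleLabel hR q N i) -
        Φ t (particleLabel hR q N k))] at this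
    convert! this using 3
    ring

end ParticleMeasure

/-- `v` and `U` are Lipschitz, so the system is an equation in ℝ^(N+1) with a Lipschitz field; no
ordering of the particles is involved. -/
theorem SolvesDPAU.unique {V v : ℝ → ℝ} {lam : ℝ} (hV : InteractionKernel V lam)
    (hv : VelocityMap V v) {ρ₀ : Measure ℝ} {N : ℕ} {x y : Fin (N + 1) → ℝ → ℝ}
    (hx : SolvesDPAU V v lam ρ₀ N x) (hy : SolvesDPAU V v lam ρ₀ N y) (i : Fin (N + 1)) {t : ℝ}
    (ht : 0 ≤ t) : x i t = y i t := by
  obtain ⟨K, hK⟩ := hV.exists_lipschitzWith_U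
  obtain ⟨L, hL⟩ := hv.lipschitz
  set f : (Fin (N + 1) → ℝ) → Fin (N + 1) → ℝ := fun y i =>
    v ((1 / (N : ℝ)) * ∑ k, U V lam (y i - y k) - (1 / (N : ℝ)) * lam * ((i : ℝ) + 1))
  have hf : LipschitzWith (L * ((1 / N) * ((N + 1 : ℕ) * (K * 2)))) f := by
    refine LipschitzWith.of_dist_le_mul fun y z => (dist_pi_le_iff (by positivity)).2 fun i => ?_
    refine (hL.dist_le_mul _ _).trans ?_
    rw [Real.dist_eq, sub_sub_sub_cancel_right, ← mul_sub, abs_mul, abs_of_nonneg (by positivity),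
      ← Finset.sum_sub_distrib]
    have h1 : ∀ k, |U V lam (y i - y k) - U V lam (z i - z k)| ≤ K * (2 * dist y z) := fun k => by
      refine (hK.dist_le_mul _ _).trans ?_
      gcongr
      refine (dist_sub_sub_le _ _ _ _).trans ?_
      linarith [dist_le_pi_dist y z i, dist_le_pi_dist y z k]
    have h2 := (Finset.abs_sum_le_sum_abs (fun k => U V lam (y i - y k) - U V lam (z i - z k))
      Finset.univ).trans (Finset.sum_le_sum fun k _ => h1 k)
    simp only [Finset.sum_const, Finset.card_univ, Fintype.card_fin, nsmul_eq_mul] at h2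
    push_cast at h2 ⊢
    calc _ ≤ (L : ℝ) * (1 / N * ((N + 1) * (K * (2 * dist y z)))) := by gcongr
      _ = _ := by ring
  have hd : ∀ {x : Fin (N + 1) → ℝ → ℝ}, SolvesDPAU V v lam ρ₀ N x → ∀ t, 0 ≤ t →
      HasDerivWithinAt (fun t i => x i t) (f fun i => x i t) (Ici 0) t :=
    fun hx t ht => hasDerivWithinAt_pi.2 fun i => (hx i).2 t ht
  exact congrFun (eq_of_hasDerivWithinAt_Ici hf (hd hx) (hd hy)
    (funext fun i => (hx i).1.trans (hy i).1.symm) ht) i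

/-! ### Ordering, the two forms of the system and the density bound -/

namespace IsParticleFlow

variable {V v w : ℝ → ℝ} {lam : ℝ} {q c : ℝ → ℝ} {N : ℕ} {x : Fin (N + 1) → ℝ → ℝ}

theorem div_le_sub_succ (h : IsParticleFlow V w lam q c N x) {t : ℝ} (ht : 0 < t) (i : Fin N) :
    c t / N ≤ x i.succ t - x i.castSucc t := by
  refine le_trans (le_of_eq ?_) (h.expanding t ht.le i.castSucc i.succ (Fin.castSucc_le_succ i))
  rw [Fin.val_succ, Fin.val_castSucc]
  push_cast
  ring

theorem lt_succ (h : IsParticleFlow V w lam q c N x) {t : ℝ} (ht : 0 < t) (i : Fin N) :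
    x i.castSucc t < x i.succ t := by
  have hN : (0 : ℝ) < N := by exact_mod_cast i.pos
  have := h.div_le_sub_succ ht i
  have := div_pos (h.pos t ht) hN
  linarith

theorem monotone (h : IsParticleFlow V w lam q c N x) {t : ℝ} (ht : 0 ≤ t) :
    Monotone fun i => x i t := fun i j hij => by
  have hij' : ((i : ℕ) : ℝ) ≤ (j : ℕ) := by exact_mod_cast hij
  have h1 := h.expanding t ht i j hij
  have h2 := mul_nonneg (h.nonneg t ht)
    (div_nonneg (sub_nonneg.2 hij') (Nat.cast_nonneg (α := ℝ) N))
  exact sub_nonneg.1 (h2.trans h1)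

/-- By ordering, each of the i + 1 particles k ≤ i, the particle i included since U(0) = λ,
contributes λ to the sum. These contributions cancel the subtracted term. -/
theorem drift_eq (h : IsParticleFlow V w lam q c N x) (hV : InteractionKernel V lam) {t : ℝ}
    (ht : 0 ≤ t) (i : Fin (N + 1)) :
    (1 / (N : ℝ)) * ∑ k, U V lam (x i t - x k t) - (1 / (N : ℝ)) * lam * ((i : ℝ) + 1) =
      (1 / (N : ℝ)) * ∑ k ∈ Finset.Ioi i, V (x i t - x k t) := by
  have hle : ∀ k ∈ Finset.Iic i, U V lam (x i t - x k t) = lam := fun k hk =>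
    hV.U_of_nonneg (sub_nonneg.2 (h.monotone ht (Finset.mem_Iic.1 hk)))
  have hgt : ∀ k ∈ Finset.Ioi i, U V lam (x i t - x k t) = V (x i t - x k t) := fun k hk =>
    InteractionKernel.U_of_nonpos V lam
      (sub_nonpos.2 (h.monotone ht (Finset.mem_Ioi.1 hk).le))
  have hdisj : Disjoint (Finset.Iic i) (Finset.Ioi i) := by
    rw [Finset.disjoint_left]
    exact fun k hk hk' => absurd (Finset.mem_Iic.1 hk) (not_le.2 (Finset.mem_Ioi.1 hk'))
  have huniv : (Finset.univ : Finset (Fin (N + 1))) = Finset.Iic i ∪ Finset.Ioi i := by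
    ext k
    simp [le_or_gt]
  rw [huniv, Finset.sum_union hdisj, Finset.sum_congr rfl hle, Finset.sum_congr rfl hgt,
    Finset.sum_const, Fin.card_Iic, nsmul_eq_mul]
  push_cast
  ring

/-- The sum has at most `N` terms, so it is an average once the missing weight is filled with the
value 0, which `V` takes on (0, ∞). -/
theorem exists_le_drift (hV : InteractionKernel V lam) (i : Fin (N + 1)) (a : Fin (N + 1) → ℝ) :
    ∃ y, V y ≤ (1 / (N : ℝ)) * ∑ k ∈ Finset.Ioi i, V (a k) := by
  by_contra! hlt
  set S := (1 / (N : ℝ)) * ∑ k ∈ Finset.Ioi i, V (a k) with hS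
  have hS0 : S < 0 := hV.eq_zero_of_pos one_pos ▸ hlt 1
  have hne : (Finset.Ioi i).Nonempty := by
    rw [Finset.nonempty_iff_ne_empty]
    intro he
    rw [he, Finset.sum_empty, mul_zero] at hS
    exact hS0.ne hS
  have hcard : ((Finset.Ioi i).card : ℝ) ≤ N := by
    have : (Finset.Ioi i).card ≤ N := by
      rw [Fin.card_Ioi]
      omega
    exact_mod_cast this
  have hN : (0 : ℝ) < N := lt_of_lt_of_le (by exact_mod_cast hne.card_pos) hcard
  have hsum : (Finset.Ioi i).card * S < ∑ k ∈ Finset.Ioi i, V (a k) := by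
    rw [← nsmul_eq_mul, ← Finset.sum_const]
    exact Finset.sum_lt_sum_of_nonempty hne fun k _ => hlt (a k)
  have hNS : ∑ k ∈ Finset.Ioi i, V (a k) = N * S := by
    rw [hS]
    field_simp
  nlinarith

theorem solvesDPAV {ρ₀ : Measure ℝ} (h : IsParticleFlow V w lam (quantile ρ₀) c N x)
    (hV : InteractionKernel V lam) (hwv : ∀ r, (∃ x, V x ≤ r) → w r = v r) :
    SolvesDPAV V v ρ₀ N x := fun i => ⟨h.initial i, fun t ht => by
  have := h.hasDeriv i t ht
  rwa [h.drift_eq hV ht, hwv _ (exists_le_drift hV i _)] at this⟩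

/-- The form with `V` serves as intermediate step, because it shows that the drift lies where `w`
and `v` agree. -/
theorem solvesDPAU {ρ₀ : Measure ℝ} (h : IsParticleFlow V w lam (quantile ρ₀) c N x)
    (hV : InteractionKernel V lam) (hwv : ∀ r, (∃ x, V x ≤ r) → w r = v r) :
    SolvesDPAU V v lam ρ₀ N x := fun i => ⟨h.initial i, fun t ht => by
  have := (h.solvesDPAV hV hwv i).2 t ht
  rwa [← h.drift_eq hV ht] at this⟩

theorem reconstruction_nonneg (h : IsParticleFlow V w lam q c N x) {t : ℝ} (ht : 0 < t) (ξ : ℝ) :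
    0 ≤ reconstruction N x (ξ, t) :=
  Finset.sum_nonneg fun i _ => indicator_nonneg (fun _ _ =>
    div_nonneg (by positivity) (sub_nonneg.2 (h.lt_succ ht i).le)) _

/-- Ordered particles have disjoint cells, so at most one summand is nonzero, and its height is at
most (1/N) / (c/N). -/
theorem abs_reconstruction_le (h : IsParticleFlow V w lam q c N x) {δ t : ℝ} (hδ : 0 < δ)
    (ht : δ ≤ t) (ξ : ℝ) : |reconstruction N x (ξ, t)| ≤ (c δ)⁻¹ := by
  have ht0 := hδ.trans_le ht
  have hc := h.pos δ hδ
  rw [abs_of_nonneg (h.reconstruction_nonneg ht0 ξ), reconstruction]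
  by_cases hex : ∃ i : Fin N, ξ ∈ Ico (x i.castSucc t) (x i.succ t)
  · obtain ⟨i, hi⟩ := hex
    rw [Finset.sum_eq_single i, indicator_of_mem hi]
    · have hN : (0 : ℝ) < N := by exact_mod_cast i.pos
      have h1 := h.div_le_sub_succ ht0 i
      have h2 : c δ / N ≤ c t / N := by
        gcongr
        exact h.mono _ _ ht
      have h3 : 0 < c δ / N := div_pos hc hN
      calc 1 / (N : ℝ) / (x i.succ t - x i.castSucc t) ≤ 1 / (N : ℝ) / (c δ / N) := by
            gcongr
            exact h2.trans h1
        _ = (c δ)⁻¹ := by field_simp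
    · intro j _ hji
      refine indicator_of_notMem (fun hj => hji ?_) _
      rcases lt_trichotomy j i with hlt | heq | hlt
      · have := h.monotone ht0.le (show j.succ ≤ i.castSucc from hlt)
        exact absurd hj.2 (not_lt.2 (this.trans hi.1))
      · exact heq
      · have := h.monotone ht0.le (show i.succ ≤ j.castSucc from hlt)
        exact absurd hi.2 (not_lt.2 (this.trans hj.1))
    · simp
  · rw [Finset.sum_eq_zero]
    · exact (inv_pos.2 hc).le
    · exact fun i _ => indicator_of_notMem (fun hi => hex ⟨i, hi⟩) _

end IsParticleFlow

/-! ### Convergence of the particle flows -/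

section Quadrature

variable {R : ℝ} {hR : -R ≤ R} {q : ℝ → ℝ} {N : ℕ}

theorem integral_unitVolume_eq_sum (hN : 1 ≤ N) {g : ℝ → ℝ} (hg : Integrable g unitVolume) :
    ∫ z, g z ∂unitVolume =
      ∑ k ∈ Finset.range N, ∫ z in ((k : ℝ) / N)..(((k + 1 : ℕ) : ℝ) / N), g z := by
  have hN' : (N : ℝ) ≠ 0 := by
    have : (1 : ℝ) ≤ N := by exact_mod_cast hN
    linarith
  rw [intervalIntegral.sum_integral_adjacent_intervals (a := fun k : ℕ => (k : ℝ) / N)]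
  · rw [Nat.cast_zero, zero_div, div_self hN', intervalIntegral.integral_of_le zero_le_one,
      integral_Icc_eq_integral_Ioc]
  · intro k hk
    have h0 : IntervalIntegrable g volume 0 1 := by
      rw [intervalIntegrable_iff_integrableOn_Icc_of_le zero_le_one]
      exact hg
    refine h0.mono_set ?_
    rw [uIcc_of_le zero_le_one]
    exact uIcc_subset_Icc (natCast_div_mem_Icc hk.le) (natCast_div_mem_Icc hk)

/-- On the cell (k/N, (k+1)/N] the label differs from that of particle k by at most the increment of
`q` in position and λ/N in mass. The increments telescope to q(1) - q(0) ≤ 2R, so jumps of `q` do no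
harm. The error `ε` admits integrands that are only Lipschitz up to a small constant. -/
theorem abs_integral_quantileLabel_sub_le (hN : 1 ≤ N) (hq : MonotoneOn q (Icc 0 1))
    (hqR : ∀ z ∈ Icc (0 : ℝ) 1, q z ∈ Icc (-R) R) {F : Label R → ℝ} (hF : Continuous F)
    {ε D lam : ℝ} (hD : 0 ≤ D) (hlam : 0 ≤ lam)
    (h : ∀ s s', |F s - F s'| ≤ ε + D * (|Label.position R s - Label.position R s'| +
      |Label.mass R lam s - Label.mass R lam s'|)) :
    |∫ s, F s ∂(unitVolume.map (quantileLabel hR q)) -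
      (1 / (N : ℝ)) * ∑ k ∈ Finset.range N, F (particleLabel hR q N k)| ≤
      ε + D * (2 * R + lam) / N := by
  have hN' : (1 : ℝ) ≤ N := by exact_mod_cast hN
  have hN0 : (0 : ℝ) < N := by linarith
  have hmeas := measurable_quantileLabel (hR := hR) hq
  have hprob : IsProbabilityMeasure (unitVolume.map (quantileLabel hR q)) :=
    Measure.isProbabilityMeasure_map hmeas.aemeasurable
  have hint : Integrable (fun z => F (quantileLabel hR q z)) unitVolume :=
    (integrable_of_continuous_compactSpace (unitVolume.map (quantileLabel hR q)) hF).comp_measurable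
      hmeas
  rw [integral_map hmeas.aemeasurable hF.aestronglyMeasurable, integral_unitVolume_eq_sum hN hint,
    Finset.mul_sum, ← Finset.sum_sub_distrib]
  have hlen : ∀ k : ℕ, ((k + 1 : ℕ) : ℝ) / N - (k : ℝ) / N = 1 / N := fun k => by
    push_cast
    ring
  have hterm : ∀ k ∈ Finset.range N,
      |(∫ z in ((k : ℝ) / N)..(((k + 1 : ℕ) : ℝ) / N), F (quantileLabel hR q z)) -
        1 / (N : ℝ) * F (particleLabel hR q N k)| ≤
      (ε + D * lam / N) / N + D / N * (q (((k + 1 : ℕ) : ℝ) / N) - q ((k : ℝ) / N)) := by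
    intro k hk
    have hkN := Finset.mem_range.1 hk
    have hk0 := natCast_div_mem_Icc hkN.le
    have hk1 := natCast_div_mem_Icc hkN
    have hle : (k : ℝ) / N ≤ ((k + 1 : ℕ) : ℝ) / N := by
      gcongr
      exact k.le_succ
    have hI : IntervalIntegrable (fun z => F (quantileLabel hR q z)) volume
        ((k : ℝ) / N) (((k + 1 : ℕ) : ℝ) / N) := by
      have h0 : IntervalIntegrable (fun z => F (quantileLabel hR q z)) volume 0 1 := by
        rw [intervalIntegrable_iff_integrableOn_Icc_of_le zero_le_one]
        exact hint
      refine h0.mono_set ?_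
      rw [uIcc_of_le zero_le_one]
      exact uIcc_subset_Icc hk0 hk1
    have hc : 1 / (N : ℝ) * F (particleLabel hR q N k) =
        ∫ _ in ((k : ℝ) / N)..(((k + 1 : ℕ) : ℝ) / N), F (particleLabel hR q N k) := by
      rw [intervalIntegral.integral_const, hlen, smul_eq_mul]
    rw [hc, ← intervalIntegral.integral_sub hI intervalIntegrable_const, ← Real.norm_eq_abs]
    refine (intervalIntegral.norm_integral_le_of_norm_le_const
      (C := ε + D * (q (((k + 1 : ℕ) : ℝ) / N) - q ((k : ℝ) / N) + lam / N)) fun z hz => ?_).trans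
      (le_of_eq ?_)
    · rw [uIoc_of_le hle] at hz
      have hz01 : z ∈ Icc (0 : ℝ) 1 := ⟨hk0.1.trans hz.1.le, hz.2.trans hk1.2⟩
      rw [Real.norm_eq_abs]
      refine (h _ _).trans ?_
      rw [quantileLabel_of_mem hz01, particleLabel, Label.position_mk hR _ (hqR _ hz01),
        Label.position_mk hR _ (hqR _ hk0),
        Label.mass_mk lam hR _ (Icc_subset_Icc_right one_le_two hz01),
        Label.mass_mk lam hR _ (natCast_add_one_div_mem_Icc hN hkN.le),
        abs_of_nonneg (sub_nonneg.2 (hq hk0 hz01 hz.1.le)), ← mul_sub, abs_mul,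
        abs_of_nonneg hlam, div_eq_mul_one_div lam]
      gcongr
      · exact hq hz01 hk1 hz.2
      · rw [abs_le]
        have h1 := hlen k
        have h2 := hz.1
        have h3 := hz.2
        push_cast at h1 h2 h3 ⊢
        constructor <;> linarith
    · rw [hlen, abs_of_nonneg (by positivity)]
      ring
  refine (Finset.abs_sum_le_sum_abs _ _).trans ((Finset.sum_le_sum hterm).trans ?_)
  rw [Finset.sum_add_distrib, ← Finset.mul_sum, Finset.sum_range_sub (fun k : ℕ => q ((k : ℝ) / N)),
    Finset.sum_const, Finset.card_range, nsmul_eq_mul, Nat.cast_zero, zero_div, div_self hN0.ne']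
  have h1 := (hqR 1 (right_mem_Icc.2 zero_le_one)).2
  have h0 := (hqR 0 (left_mem_Icc.2 zero_le_one)).1
  have h2 : D / N * (q 1 - q 0) ≤ D / N * (2 * R) := by
    gcongr
    linarith
  calc _ ≤ (N : ℝ) * ((ε + D * lam / N) / N) + D / N * (2 * R) := by linarith
    _ = ε + D * (2 * R + lam) / N := by field_simp; ring

end Quadrature

section Convergence

variable {R : ℝ} {hR : -R ≤ R} {q : ℝ → ℝ} {u w : ℝ → ℝ} {lam : ℝ} {K L : ℝ≥0}
  {Φ : ℝ → C(Label R, ℝ)} {Ψ : ℕ → ℝ → C(Label R, ℝ)}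

theorem IsMeanFieldFlow.abs_sub_le_label {σ : Measure (Label R)} [IsFiniteMeasure σ]
    (h : IsMeanFieldFlow u w σ (Label.mass R lam) (Label.position R) Φ) (hu : LipschitzWith K u)
    (hw : LipschitzWith L w) (hσ : σ.real univ ≤ 2) (s s' : Label R) {t : ℝ} (ht : 0 ≤ t) :
    |Φ t s - Φ t s'| ≤ (1 + L) * Real.exp ((2 * L * K + 1) * t) *
      (|Label.position R s - Label.position R s'| +
        |Label.mass R lam s - Label.mass R lam s'|) := by
  refine (h.abs_sub_le hu hw hσ s' s ht).trans ?_
  have h1 := abs_nonneg (Label.position R s - Label.position R s')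
  have h2 := abs_nonneg (Label.mass R lam s - Label.mass R lam s')
  have h3 : |Label.position R s - Label.position R s'| +
      L * |Label.mass R lam s - Label.mass R lam s'| ≤
      (1 + L) * (|Label.position R s - Label.position R s'| +
        |Label.mass R lam s - Label.mass R lam s'|) := by
    nlinarith [mul_nonneg L.coe_nonneg h1, L.coe_nonneg]
  refine (mul_le_mul_of_nonneg_right h3 (Real.exp_nonneg _)).trans (le_of_eq ?_)
  ring

theorem Label.abs_sub_add_abs_sub_le (hlam : 0 ≤ lam) (s s' : Label R) :
    |Label.position R s - Label.position R s'| + |Label.mass R lam s - Label.mass R lam s'| ≤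
      2 * R + 2 * lam := by
  have h1 : |(s.1 : ℝ) - s'.1| ≤ 2 * R := by
    rw [abs_le]
    constructor <;> linarith [s.1.2.1, s.1.2.2, s'.1.2.1, s'.1.2.2]
  have h2 : |(s.2 : ℝ) - s'.2| ≤ 2 := by
    rw [abs_le]
    constructor <;> linarith [s.2.2.1, s.2.2.2, s'.2.2.1, s'.2.2.2]
  have h3 : |lam * (s.2 : ℝ) - lam * s'.2| ≤ lam * 2 := by
    rw [← mul_sub, abs_mul, abs_of_nonneg hlam]
    gcongr
  have h4 := add_le_add h1 h3
  simp only [Label.position, Label.mass, ContinuousMap.coe_mk]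
  linarith

/-- Along the limit flow the two convolutions differ by the quadrature error and by the contribution
of the last, extra atom. Both are O(1/N) uniformly on [0, T], so the Grönwall bound tends to 0. -/
theorem tendsto_particle_flow (hq : MonotoneOn q (Icc 0 1))
    (hqR : ∀ z ∈ Icc (0 : ℝ) 1, q z ∈ Icc (-R) R) (hu : LipschitzWith K u)
    (hw : LipschitzWith L w) (hlam : 0 ≤ lam)
    (hΦ : IsMeanFieldFlow u w (unitVolume.map (quantileLabel hR q)) (Label.mass R lam)
      (Label.position R) Φ)
    (hΨ : ∀ N, 1 ≤ N → IsMeanFieldFlow u w (particleMeasure hR q N) (Label.mass R lam)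
      (Label.position R) (Ψ N)) {T : ℝ} (hT : 0 ≤ T) :
    Tendsto (fun N => dist (Φ T) (Ψ N T)) atTop (𝓝 0) := by
  have hmeas := measurable_quantileLabel (hR := hR) hq
  have hprob : IsProbabilityMeasure (unitVolume.map (quantileLabel hR q)) :=
    Measure.isProbabilityMeasure_map hmeas.aemeasurable
  have hσ : (unitVolume.map (quantileLabel hR q)).real univ ≤ 2 := by
    rw [probReal_univ]; norm_num
  have hR0 : 0 ≤ R := by linarith
  set E : ℝ := (1 + L) * Real.exp ((2 * L * K + 1) * T) with hE
  have hE0 : 0 ≤ E := by positivity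
  set C : ℝ := K * E * (2 * R + lam) + (|u 0| + K * (E * (2 * R + 2 * lam))) with hC
  have hC0 : 0 ≤ C := by positivity
  have hbound : ∀ N : ℕ, 1 ≤ N → dist (Φ T) (Ψ N T) ≤
      gronwallBound 0 (4 * L * K : ℝ≥0) (L * (C / N) + 0) T := by
    intro N hN
    refine hΦ.dist_le (hΨ N hN) hu hw (particleMeasure_real_univ_le hN) hT (by positivity)
      fun t ht s => ?_
    have hEt : ∀ s s', |Φ t s - Φ t s'| ≤ E * (|Label.position R s - Label.position R s'| +
        |Label.mass R lam s - Label.mass R lam s'|) := fun s s' => by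
      refine (hΦ.abs_sub_le_label hu hw hσ s s' ht.1).trans ?_
      rw [hE]
      gcongr
      exact ht.2
    have hcont : Continuous fun s' => u (Φ t s - Φ t s') := hu.continuous.comp (by fun_prop)
    have hlast : |u (Φ t s - Φ t (particleLabel hR q N N))| ≤
        |u 0| + K * (E * (2 * R + 2 * lam)) := by
      have h1 := hu.dist_le_mul (Φ t s - Φ t (particleLabel hR q N N)) 0
      rw [Real.dist_eq, Real.dist_eq, sub_zero] at h1
      have h2 : |Φ t s - Φ t (particleLabel hR q N N)| ≤ E * (2 * R + 2 * lam) :=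
        (hEt _ _).trans (mul_le_mul_of_nonneg_left (Label.abs_sub_add_abs_sub_le hlam _ _) hE0)
      have h3 := mul_le_mul_of_nonneg_left h2 K.coe_nonneg
      linarith [abs_sub_abs_le_abs_sub (u (Φ t s - Φ t (particleLabel hR q N N))) (u 0)]
    have hquad := abs_integral_quantileLabel_sub_le (hR := hR) hN hq hqR hcont (ε := 0)
      (D := K * E) (lam := lam) (by positivity) hlam fun s₁ s₂ => by
        have h1 := hu.dist_le_mul (Φ t s - Φ t s₁) (Φ t s - Φ t s₂)
        rw [Real.dist_eq, Real.dist_eq, sub_sub_sub_cancel_left, abs_sub_comm (Φ t s₂)] at h1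
        have h2 := mul_le_mul_of_nonneg_left (hEt s₁ s₂) K.coe_nonneg
        rw [zero_add, mul_assoc]
        exact h1.trans h2
    rw [zero_add] at hquad
    rw [integral_particleMeasure hcont, Finset.sum_range_succ, mul_add, ← sub_sub]
    refine (abs_sub _ _).trans ?_
    rw [abs_mul, abs_of_nonneg (show (0 : ℝ) ≤ 1 / N by positivity), hC, add_div]
    refine add_le_add hquad ?_
    rw [one_div_mul_eq_div]
    gcongr
  have hlim : Tendsto (fun N : ℕ => gronwallBound 0 (4 * L * K : ℝ≥0) (L * (C / N) + 0) T) atTop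
      (𝓝 0) := by
    have h1 : Tendsto (fun N : ℕ => (L : ℝ) * (C / N) + 0) atTop (𝓝 0) := by
      simpa using (tendsto_const_div_atTop_nhds_zero_nat C).const_mul (L : ℝ)
    have h2 := ((gronwallBound_continuous_ε 0 (4 * L * K : ℝ≥0) T).tendsto 0).comp h1
    rwa [gronwallBound_ε0_δ0] at h2
  refine tendsto_of_tendsto_of_tendsto_of_le_of_le' tendsto_const_nhds hlim
    (Eventually.of_forall fun N => dist_nonneg) ?_
  filter_upwards [eventually_ge_atTop 1] with N hN using hbound N hN

end Convergence

/-! ### Convergence of the reconstructed densities at a fixed time -/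

namespace IsParticleFlow

variable {V w : ℝ → ℝ} {lam : ℝ} {q c : ℝ → ℝ} {N : ℕ} {x : Fin (N + 1) → ℝ → ℝ}

theorem integral_reconstruction_mul (h : IsParticleFlow V w lam q c N x) {t : ℝ} (ht : 0 < t)
    {g : ℝ → ℝ} (hg : Continuous g) :
    ∫ ξ, reconstruction N x (ξ, t) * g ξ =
      ∑ i : Fin N, 1 / (N : ℝ) / (x i.succ t - x i.castSucc t) *
        ∫ ξ in (x i.castSucc t)..(x i.succ t), g ξ := by
  have e : ∀ ξ, reconstruction N x (ξ, t) * g ξ =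
      ∑ i : Fin N, (Ico (x i.castSucc t) (x i.succ t)).indicator
        (fun ξ => 1 / (N : ℝ) / (x i.succ t - x i.castSucc t) * g ξ) ξ := fun ξ => by
    rw [reconstruction, Finset.sum_mul]
    exact Finset.sum_congr rfl fun i _ => (indicator_mul_left _ _ _).symm
  simp only [e]
  rw [integral_finsetSum]
  · refine Finset.sum_congr rfl fun i _ => ?_
    rw [integral_indicator measurableSet_Ico, integral_const_mul, integral_Ico_eq_integral_Ioc,
      intervalIntegral.integral_of_le (h.lt_succ ht i).le]
  · intro i _
    refine IntegrableOn.integrable_indicator ?_ measurableSet_Ico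
    exact (((continuous_const.mul hg).integrableOn_Icc).mono_set Ico_subset_Icc_self)

/-- The pairing is 1/N times the sum of the averages of `g` over the cells. Replacing each average
by g(y i) costs the cell length plus `d` in the argument, and the cell lengths telescope. -/
theorem abs_integral_reconstruction_mul_sub_le (h : IsParticleFlow V w lam q c N x) (hN : 1 ≤ N)
    {t : ℝ} (ht : 0 < t) {g : ℝ → ℝ} (hg : Continuous g) {ε M : ℝ} (hM : 0 ≤ M)
    (hgM : ∀ x y, |g x - g y| ≤ ε + M * |x - y|) {y : ℕ → ℝ} {d : ℝ}
    (hd : ∀ i : Fin (N + 1), |x i t - y i| ≤ d) :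
    |(∫ ξ, reconstruction N x (ξ, t) * g ξ) - 1 / (N : ℝ) * ∑ k ∈ Finset.range N, g (y k)| ≤
      ε + M * ((x (Fin.last N) t - x 0 t) / N + d) := by
  have hN0 : (0 : ℝ) < N := by exact_mod_cast hN
  rw [h.integral_reconstruction_mul ht hg, Finset.sum_range, Finset.mul_sum,
    ← Finset.sum_sub_distrib]
  have hterm : ∀ i ∈ (Finset.univ : Finset (Fin N)),
      |1 / (N : ℝ) / (x i.succ t - x i.castSucc t) *
        (∫ ξ in (x i.castSucc t)..(x i.succ t), g ξ) - 1 / (N : ℝ) * g (y i)| ≤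
      (ε + M * d) / N + M / N * (x i.succ t - x i.castSucc t) := by
    intro i _
    have hlt := h.lt_succ ht i
    set a := x i.castSucc t with ha
    set b := x i.succ t
    have hpos : 0 < b - a := sub_pos.2 hlt
    have e : 1 / (N : ℝ) / (b - a) * (∫ ξ in a..b, g ξ) - 1 / (N : ℝ) * g (y i) =
        1 / (N : ℝ) / (b - a) * ∫ ξ in a..b, (g ξ - g (y i)) := by
      rw [intervalIntegral.integral_sub (hg.intervalIntegrable _ _) intervalIntegrable_const,
        intervalIntegral.integral_const, smul_eq_mul]
      field_simp
    have hI : |∫ ξ in a..b, (g ξ - g (y i))| ≤ (ε + M * ((b - a) + d)) * |b - a| := by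
      rw [← Real.norm_eq_abs]
      refine intervalIntegral.norm_integral_le_of_norm_le_const fun ξ hξ => ?_
      rw [uIoc_of_le hlt.le] at hξ
      rw [Real.norm_eq_abs]
      refine (hgM _ _).trans ?_
      gcongr
      have h1 : |a - y i| ≤ d := hd i.castSucc
      have h2 : |ξ - a| ≤ b - a := by
        rw [abs_of_nonneg (by linarith [hξ.1])]
        linarith [hξ.2]
      exact (abs_sub_le ξ a (y i)).trans (add_le_add h2 h1)
    rw [e, abs_mul, abs_of_nonneg (by positivity)]
    refine (mul_le_mul_of_nonneg_left hI (by positivity)).trans (le_of_eq ?_)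
    rw [abs_of_pos hpos]
    field_simp
    ring
  refine (Finset.abs_sum_le_sum_abs _ _).trans ((Finset.sum_le_sum hterm).trans (le_of_eq ?_))
  have htel : ∑ i : Fin N, (x i.succ t - x i.castSucc t) = x (Fin.last N) t - x 0 t := by
    have h1 := Fin.sum_univ_succ fun i => x i t
    have h2 := Fin.sum_univ_castSucc fun i => x i t
    rw [Finset.sum_sub_distrib]
    linarith
  rw [Finset.sum_add_distrib, ← Finset.mul_sum, htel, Finset.sum_const, Finset.card_univ,
    Fintype.card_fin, nsmul_eq_mul]
  field_simp
  ring

theorem measurable_reconstruction (h : IsParticleFlow V w lam q c N x) :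
    Measurable (reconstruction N x) := by
  refine Finset.measurable_sum _ fun i _ => ?_
  have h0 : Measurable fun p : ℝ × ℝ => x i.castSucc p.2 :=
    (h.continuous _).measurable.comp measurable_snd
  have h1 : Measurable fun p : ℝ × ℝ => x i.succ p.2 :=
    (h.continuous _).measurable.comp measurable_snd
  have hs : MeasurableSet {p : ℝ × ℝ | p.1 ∈ Ico (x i.castSucc p.2) (x i.succ p.2)} :=
    (measurableSet_le h0 measurable_fst).inter (measurableSet_lt measurable_fst h1)
  exact ((measurable_const.div (h1.sub h0)).indicator hs)

end IsParticleFlow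

/-- A continuous function with compact support is Lipschitz up to an arbitrarily small error. -/
theorem exists_abs_sub_le_add_mul {g : ℝ → ℝ} (hg : Continuous g) (hgc : HasCompactSupport g)
    {ε : ℝ} (hε : 0 < ε) : ∃ M, 0 ≤ M ∧ ∀ x y, |g x - g y| ≤ ε + M * |x - y| := by
  obtain ⟨B, hB⟩ := hg.bounded_above_of_compact_support hgc
  obtain ⟨δ, hδ, hu⟩ := Metric.uniformContinuous_iff.1 (hgc.uniformContinuous_of_continuous hg) ε hε
  have hB0 : 0 ≤ B := (norm_nonneg _).trans (hB 0)
  -- For points closer than `δ` uniform continuity gives `ε`; for points farther apart the trivial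
  -- bound 2B is at most 2B/δ times their distance.
  refine ⟨2 * B / δ, by positivity, fun x y => ?_⟩
  rcases lt_or_ge (dist x y) δ with hlt | hge
  · have h1 := hu hlt
    rw [Real.dist_eq] at h1
    have : 0 ≤ 2 * B / δ * |x - y| := by positivity
    linarith
  · rw [Real.dist_eq] at hge
    have h1 : 2 * B ≤ 2 * B / δ * |x - y| := by
      rw [div_mul_eq_mul_div, le_div_iff₀ hδ]
      gcongr
    have h2 := abs_sub (g x) (g y)
    have h3 := hB x
    have h4 := hB y
    rw [Real.norm_eq_abs] at h3 h4
    linarith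

section Convergence

variable {R : ℝ} {hR : -R ≤ R} {q c : ℝ → ℝ} {V u w : ℝ → ℝ} {lam : ℝ} {K L : ℝ≥0}
  {Φ : ℝ → C(Label R, ℝ)} {Ψ : ℕ → ℝ → C(Label R, ℝ)}

/-- The sum (1/N) ∑ g(Φ t s_k) over the particle labels s_k is compared with the pairing on one side
and with the limiting integral on the other. The approximate Lipschitz property of `g` costs η/4
each time, and the remaining terms tend to 0. -/
theorem tendsto_integral_reconstruction_mul (hq : MonotoneOn q (Icc 0 1))
    (hqR : ∀ z ∈ Icc (0 : ℝ) 1, q z ∈ Icc (-R) R) (hu : LipschitzWith K u)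
    (hw : LipschitzWith L w) (hlam : 0 ≤ lam)
    (hΦ : IsMeanFieldFlow u w (unitVolume.map (quantileLabel hR q)) (Label.mass R lam)
      (Label.position R) Φ)
    (hΨ : ∀ N, 1 ≤ N → IsMeanFieldFlow u w (particleMeasure hR q N) (Label.mass R lam)
      (Label.position R) (Ψ N))
    (hP : ∀ N, 1 ≤ N → IsParticleFlow V w lam q c N fun i t => Ψ N t (particleLabel hR q N i))
    {t : ℝ} (ht : 0 < t) {g : ℝ → ℝ} (hg : Continuous g) (hgc : HasCompactSupport g) :
    Tendsto (fun N => ∫ ξ, reconstruction N (fun i t => Ψ N t (particleLabel hR q N i)) (ξ, t) * g ξ)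
      atTop (𝓝 (∫ s, g (Φ t s) ∂(unitVolume.map (quantileLabel hR q)))) := by
  have hmeas := measurable_quantileLabel (hR := hR) hq
  have hprob : IsProbabilityMeasure (unitVolume.map (quantileLabel hR q)) :=
    Measure.isProbabilityMeasure_map hmeas.aemeasurable
  have hσ : (unitVolume.map (quantileLabel hR q)).real univ ≤ 2 := by
    rw [probReal_univ]; norm_num
  have hd := tendsto_particle_flow hq hqR hu hw hlam hΦ hΨ ht.le
  set E : ℝ := (1 + L) * Real.exp ((2 * L * K + 1) * t) with hE
  have hE0 : 0 ≤ E := by positivity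
  rw [Metric.tendsto_atTop]
  intro η hη
  obtain ⟨M, hM, hgM⟩ := exists_abs_sub_le_add_mul hg hgc (ε := η / 4) (by linarith)
  have hlim : Tendsto (fun N : ℕ => M * (E * (2 * R + 2 * lam) / N + dist (Φ t) (Ψ N t)) +
      M * E * (2 * R + lam) / N) atTop (𝓝 0) := by
    have h1 := ((tendsto_const_div_atTop_nhds_zero_nat (E * (2 * R + 2 * lam))).add hd).const_mul M
    simpa using h1.add (tendsto_const_div_atTop_nhds_zero_nat (M * E * (2 * R + lam)))
  obtain ⟨N₀, hN₀⟩ := eventually_atTop.1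
    ((hlim.eventually (gt_mem_nhds (show 0 < η / 2 by linarith))).and (eventually_ge_atTop 1))
  refine ⟨N₀, fun N hNN₀ => ?_⟩
  obtain ⟨hsmall, hN⟩ := hN₀ N hNN₀
  have hFc : Continuous fun s => g (Φ t s) := hg.comp (Φ t).continuous
  have h1 := (hP N hN).abs_integral_reconstruction_mul_sub_le hN ht hg hM hgM
    (y := fun k => Φ t (particleLabel hR q N k)) (d := dist (Φ t) (Ψ N t)) fun i => by
      rw [dist_comm, ← Real.dist_eq]
      exact ContinuousMap.dist_apply_le_dist _
  have h2 := abs_integral_quantileLabel_sub_le (hR := hR) hN hq hqR hFc (ε := η / 4) (D := M * E)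
    (lam := lam) (by positivity) hlam fun s s' => by
      refine (hgM _ _).trans ?_
      rw [mul_assoc]
      gcongr
      exact hΦ.abs_sub_le_label hu hw hσ s s' ht.le
  have h3 : Ψ N t (particleLabel hR q N (Fin.last N)) - Ψ N t (particleLabel hR q N (0 : Fin (N + 1)))
      ≤ E * (2 * R + 2 * lam) := by
    refine (le_abs_self _).trans (((hΨ N hN).abs_sub_le_label hu hw
      (particleMeasure_real_univ_le hN) _ _ ht.le).trans ?_)
    exact mul_le_mul_of_nonneg_left (Label.abs_sub_add_abs_sub_le hlam _ _) hE0
  have h4 : M * ((Ψ N t (particleLabel hR q N (Fin.last N)) -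
      Ψ N t (particleLabel hR q N (0 : Fin (N + 1)))) / N + dist (Φ t) (Ψ N t)) ≤
      M * (E * (2 * R + 2 * lam) / N + dist (Φ t) (Ψ N t)) := by
    gcongr
  rw [Real.dist_eq]
  refine (abs_sub_le _ (1 / (N : ℝ) * ∑ k ∈ Finset.range N, g (Φ t (particleLabel hR q N k)))
    _).trans_lt ?_
  rw [abs_sub_comm] at h2
  linarith

end Convergence

/-! ### Weak-star convergence -/

theorem tendsto_integral_mul_of_forall_continuous {f : ℕ → ℝ → ℝ} {r h : ℝ → ℝ} {C : ℝ}
    (hfm : ∀ N, Measurable (f N)) (hrm : Measurable r) (hf : ∀ N x, |f N x| ≤ C)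
    (hr : ∀ x, |r x| ≤ C) (hlim : ∀ g : ℝ → ℝ, Continuous g → HasCompactSupport g →
      Tendsto (fun N => ∫ x, f N x * g x) atTop (𝓝 (∫ x, r x * g x))) (hh : Integrable h) :
    Tendsto (fun N => ∫ x, f N x * h x) atTop (𝓝 (∫ x, r x * h x)) := by
  have hC : 0 ≤ C := (abs_nonneg _).trans (hr 0)
  have hI : ∀ {k : ℝ → ℝ}, Measurable k → (∀ x, |k x| ≤ C) → ∀ {g : ℝ → ℝ}, Integrable g →
      Integrable fun x => k x * g x := fun hk hkC _ hg =>
    hg.bdd_mul hk.aestronglyMeasurable (ae_of_all _ hkC)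
  rw [Metric.tendsto_atTop]
  intro η hη
  -- The uniform bound `C` turns L¹ approximation of `h` into an error of at most η/4 in both
  -- pairings; C + 1 avoids dividing by zero.
  obtain ⟨g, hgc, hgη, hg, hgi⟩ := hh.exists_hasCompactSupport_integral_sub_le
    (show 0 < η / (4 * (C + 1)) by positivity)
  have hclose : ∀ {k : ℝ → ℝ}, Measurable k → (∀ x, |k x| ≤ C) →
      |(∫ x, k x * h x) - ∫ x, k x * g x| ≤ η / 4 := fun {k} hk hkC => by
    rw [← integral_sub (hI hk hkC hh) (hI hk hkC hgi), ← Real.norm_eq_abs]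
    refine (norm_integral_le_of_norm_le (((hh.sub hgi).norm).const_mul C)
      (ae_of_all _ fun x => ?_)).trans ?_
    · rw [← mul_sub, norm_mul]
      exact mul_le_mul_of_nonneg_right (hkC x) (norm_nonneg _)
    · rw [integral_const_mul]
      calc C * ∫ x, ‖h x - g x‖ ≤ (C + 1) * (η / (4 * (C + 1))) :=
            mul_le_mul (by linarith) hgη (integral_nonneg fun _ => norm_nonneg _) (by linarith)
        _ = η / 4 := by field_simp
  obtain ⟨N₀, hN₀⟩ := Metric.tendsto_atTop.1 (hlim g hg hgc) (η / 4) (by linarith)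
  refine ⟨N₀, fun N hN => ?_⟩
  have h1 := hN₀ N hN
  have h2 := hclose (hfm N) (hf N)
  have h3 := hclose hrm hr
  rw [Real.dist_eq] at h1 ⊢
  rw [abs_lt] at h1 ⊢
  rw [abs_le] at h2 h3
  constructor <;> linarith

/-- Almost every time slice of an integrable function is integrable, so the slices of the pairing
converge by density of continuous functions; the bound C ∫ |h(x, t)| dx allows dominated convergence
in time. -/
theorem tendstoWeakStar_of_forall_continuous {f : ℕ → ℝ × ℝ → ℝ} {r : ℝ × ℝ → ℝ} {C δ : ℝ}
    (hfm : ∀ N, Measurable (f N)) (hrm : Measurable r)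
    (hf : ∀ N t, δ ≤ t → ∀ x, |f N (x, t)| ≤ C) (hr : ∀ t, δ ≤ t → ∀ x, |r (x, t)| ≤ C)
    (hlim : ∀ t, δ ≤ t → ∀ g : ℝ → ℝ, Continuous g → HasCompactSupport g →
      Tendsto (fun N => ∫ x, f N (x, t) * g x) atTop (𝓝 (∫ x, r (x, t) * g x))) :
    TendstoWeakStar (univ ×ˢ Ici δ) f r := by
  have hS : MeasurableSet ((univ : Set ℝ) ×ˢ Ici δ) := MeasurableSet.univ.prod measurableSet_Ici
  have hae : ∀ {k : ℝ × ℝ → ℝ}, (∀ t, δ ≤ t → ∀ x, |k (x, t)| ≤ C) →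
      ∀ᵐ p ∂(volume.restrict ((univ : Set ℝ) ×ˢ Ici δ)), ‖k p‖ ≤ C := fun hk => by
    filter_upwards [ae_restrict_mem hS] with p hp
    exact hk p.2 hp.2 p.1
  have hvol : (volume : Measure (ℝ × ℝ)).restrict (univ ×ˢ Ici δ) =
      (volume : Measure ℝ).prod (volume.restrict (Ici δ)) := by
    rw [Measure.volume_eq_prod, ← Measure.prod_restrict, Measure.restrict_univ]
  refine ⟨fun N => memLp_top_of_bound (hfm N).aestronglyMeasurable C (hae (hf N)),
    memLp_top_of_bound hrm.aestronglyMeasurable C (hae hr), fun h hh => ?_⟩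
  have hI : ∀ {k : ℝ × ℝ → ℝ}, Measurable k → (∀ t, δ ≤ t → ∀ x, |k (x, t)| ≤ C) →
      Integrable (fun p => k p * h p) ((volume : Measure ℝ).prod (volume.restrict (Ici δ))) :=
    fun hk hkC => by
      rw [← hvol]
      exact Integrable.bdd_mul hh hk.aestronglyMeasurable (hae hkC)
  rw [IntegrableOn, hvol] at hh
  rw [hvol, integral_prod_symm _ (hI hrm hr)]
  have e : ∀ N, ∫ p, f N p * h p ∂((volume : Measure ℝ).prod (volume.restrict (Ici δ))) =
      ∫ t in Ici δ, ∫ x, f N (x, t) * h (x, t) := fun N => integral_prod_symm _ (hI (hfm N) (hf N))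
  simp only [e]
  refine tendsto_integral_of_dominated_convergence (fun t => C * ∫ x, ‖h (x, t)‖)
    (fun N => (hI (hfm N) (hf N)).swap.integral_prod_left.aestronglyMeasurable)
    (hh.integral_norm_prod_right.const_mul C) (fun N => ?_) ?_
  · filter_upwards [ae_restrict_mem measurableSet_Ici, hh.prod_left_ae] with t ht hti
    rw [← integral_const_mul]
    refine norm_integral_le_of_norm_le (hti.norm.const_mul C) (ae_of_all _ fun x => ?_)
    rw [norm_mul]
    exact mul_le_mul_of_nonneg_right (hf N t ht x) (norm_nonneg _)
  · filter_upwards [ae_restrict_mem measurableSet_Ici, hh.prod_left_ae] with t ht hti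
    exact tendsto_integral_mul_of_forall_continuous (fun N => (hfm N).comp measurable_prodMk_right)
      (hrm.comp measurable_prodMk_right) (fun N => hf N t ht) (hr t ht) (hlim t ht) hti

theorem integral_withDensity_ofReal {μ : Measure ℝ} {f : ℝ → ℝ} (hf : Measurable f)
    (hf0 : ∀ x, 0 ≤ f x) (h : μ = volume.withDensity fun x => ENNReal.ofReal (f x)) (g : ℝ → ℝ) :
    ∫ x, g x ∂μ = ∫ x, f x * g x := by
  rw [h, integral_withDensity_eq_integral_toReal_smul hf.ennreal_ofReal
    (ae_of_all _ fun _ => ENNReal.ofReal_lt_top)]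
  simp only [ENNReal.toReal_ofReal (hf0 _), smul_eq_mul]

theorem reconstruction_zero (x : Fin (0 + 1) → ℝ → ℝ) : reconstruction 0 x = 0 := by
  funext p
  simp [reconstruction]

/-- The continuum flow and the particle flows issued from a monotone bounded function `q`, with a
common lower bound for their expansion, and the convergence of the latter to the former. -/
theorem exists_quantileFlow_particleFlow {V w q : ℝ → ℝ} {lam R b : ℝ} {K L : ℝ≥0} (hR : -R ≤ R)
    (hq : MonotoneOn q (Icc 0 1)) (hqR : ∀ z ∈ Icc (0 : ℝ) 1, q z ∈ Icc (-R) R)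
    (hu : LipschitzWith K (U V lam)) (hw : LipschitzWith L w) (hb : 0 < b) (hlam : 0 < lam)
    (hdec : ∀ r₁ r₂ : ℝ, r₁ ≤ r₂ → b * (r₂ - r₁) ≤ w r₁ - w r₂) :
    ∃ (c : ℝ → ℝ) (X : ℝ → ℝ → ℝ) (x : (N : ℕ) → Fin (N + 1) → ℝ → ℝ),
      IsQuantileFlow V w lam q c X ∧ (∀ N, 1 ≤ N → IsParticleFlow V w lam q c N (x N)) ∧
      ∀ t, 0 < t → ∀ g : ℝ → ℝ, Continuous g → HasCompactSupport g →
        Tendsto (fun N => ∫ ξ, reconstruction N (x N) (ξ, t) * g ξ) atTop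
          (𝓝 (∫ z, g (X t z) ∂unitVolume)) := by
  have hmeas := measurable_quantileLabel (hR := hR) hq
  have hprob : IsProbabilityMeasure (unitVolume.map (quantileLabel hR q)) :=
    Measure.isProbabilityMeasure_map hmeas.aemeasurable
  obtain ⟨Φ, hΦ⟩ := exists_isMeanFieldFlow hu hw (unitVolume.map (quantileLabel hR q))
    (by rw [probReal_univ]; norm_num) (Label.mass R lam) (Label.position R)
  have hex : ∀ N : ℕ, ∃ Ψ : ℝ → C(Label R, ℝ), 1 ≤ N →
      IsMeanFieldFlow (U V lam) w (particleMeasure hR q N) (Label.mass R lam)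
        (Label.position R) Ψ := fun N => by
    by_cases hN : 1 ≤ N
    · obtain ⟨Ψ, hΨ⟩ := exists_isMeanFieldFlow hu hw (particleMeasure hR q N)
        (particleMeasure_real_univ_le hN) (Label.mass R lam) (Label.position R)
      exact ⟨Ψ, fun _ => hΨ⟩
    · exact ⟨0, fun h => absurd h hN⟩
  choose Ψ hΨ using hex
  have hP := fun N hN => isParticleFlow_of_isMeanFieldFlow (hR := hR) hN hq hqR hu hw hb hlam hdec
    (hΨ N hN)
  refine ⟨_, _, fun N i t => Ψ N t (particleLabel hR q N i),
    isQuantileFlow_of_isMeanFieldFlow (hR := hR) hq hqR hu hw hb hlam hdec hΦ, hP,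
    fun t ht g hg hgc => ?_⟩
  have h1 := tendsto_integral_reconstruction_mul hq hqR hu hw hlam.le hΦ hΨ hP ht hg hgc
  have h2 : AEStronglyMeasurable (fun s => g (Φ t s)) (unitVolume.map (quantileLabel hR q)) :=
    (hg.comp (Φ t).continuous).aestronglyMeasurable
  rwa [integral_map hmeas.aemeasurable h2] at h1

end NonlocalCL
-- Assembly of the theorem
theorem theorem2p6 (V v : ℝ → ℝ) (lam : ℝ)
    (hV : NonlocalCL.InteractionKernel V lam) (hv : NonlocalCL.VelocityMap V v)
    (ρ₀ : Measure ℝ) [IsProbabilityMeasure ρ₀] (hρ₀ : IsCompact ρ₀.support) :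
    ∃ x : (N : ℕ) → Fin (N + 1) → ℝ → ℝ,
      -- for every `N ≥ 1`, `x N` is the unique global solution of the system with `U`; its particles
      -- are strictly ordered at positive times and also solve the system with `V`
      (∀ N : ℕ, 1 ≤ N →
        NonlocalCL.SolvesDPAU V v lam ρ₀ N (x N) ∧
        (∀ y : Fin (N + 1) → ℝ → ℝ, NonlocalCL.SolvesDPAU V v lam ρ₀ N y →
          ∀ i, ∀ t, 0 ≤ t → y i t = x N i t) ∧
        (∀ t, 0 < t → ∀ i : Fin N, x N i.castSucc t < x N i.succ t) ∧
        NonlocalCL.SolvesDPAV V v ρ₀ N (x N)) ∧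
      -- bound uniform in `N` for positive times
      (∀ δ : ℝ, 0 < δ → ∃ C : ℝ, ∀ N : ℕ, 1 ≤ N → ∀ t, δ ≤ t → ∀ ξ : ℝ,
        |NonlocalCL.reconstruction N (x N) (ξ, t)| ≤ C) ∧
      -- convergence to the unique dissipative measure solution `ρ`, with density `r` for `t > 0`
      ∃ (ρ : ℝ → Measure ℝ) (r : ℝ × ℝ → ℝ),
        (∀ p : ℝ≥0∞, 1 ≤ p →
          NonlocalCL.IsDissipativeSolution V v p ρ₀ ρ ∧
          ∀ μ : ℝ → Measure ℝ, NonlocalCL.IsDissipativeSolution V v p ρ₀ μ →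
            ∀ t, 0 ≤ t → μ t = ρ t) ∧
        Measurable r ∧ (∀ q, 0 ≤ r q) ∧
        (∀ t, 0 < t → ρ t = volume.withDensity (fun ξ => ENNReal.ofReal (r (ξ, t)))) ∧
        ∀ δ : ℝ, 0 < δ →
          NonlocalCL.TendstoWeakStar (univ ×ˢ Ici δ)
            (fun N => NonlocalCL.reconstruction N (x N)) r := by
  obtain ⟨R, hqR, hq⟩ := NonlocalCL.exists_quantile_mem_Icc hρ₀
  have hR : -R ≤ R := by
    have := hqR 0 (left_mem_Icc.2 zero_le_one)
    exact this.1.trans this.2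
  obtain ⟨K, hu⟩ := hV.exists_lipschitzWith_U
  obtain ⟨w, ⟨L, hw⟩, ⟨b, hb, hdec⟩, hwv⟩ := hv.exists_strongly_decreasing
  obtain ⟨_, hvL⟩ := hv.lipschitz
  obtain ⟨c, X, x, hX, hP, hlim⟩ :=
    NonlocalCL.exists_quantileFlow_particleFlow hR hq hqR hu hw hb hV.lam_pos hdec
  have hXP := hX.isProbabilityMeasure_map
  have hsol := hX.isDissipativeSolution hV hvL.continuous hu hw hwv
  have hdens : ∀ t, 0 < t → NonlocalCL.unitVolume.map (X t) = volume.withDensity fun ξ =>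
      ENNReal.ofReal (NonlocalCL.rightDensity (NonlocalCL.unitVolume.map (X t)) ξ) := fun t ht =>
    NonlocalCL.eq_withDensity_rightDensity (Measure.absolutelyContinuous_of_le_smul (hX.map_le ht))
  have hrm : Measurable fun p : ℝ × ℝ =>
      NonlocalCL.rightDensity (NonlocalCL.unitVolume.map (X p.2)) p.1 :=
    NonlocalCL.measurable_rightDensity (μ := fun t => NonlocalCL.unitVolume.map (X t))
      hX.measurable_cdf
  refine ⟨x, fun N hN => ⟨(hP N hN).solvesDPAU hV hwv, fun y hy i t ht =>
      hy.unique hV hv ((hP N hN).solvesDPAU hV hwv) i ht, fun t ht i => (hP N hN).lt_succ ht i,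
      (hP N hN).solvesDPAV hV hwv⟩,
    fun δ hδ => ⟨(c δ)⁻¹, fun N hN t ht ξ => (hP N hN).abs_reconstruction_le hδ ht ξ⟩,
    fun t => NonlocalCL.unitVolume.map (X t),
    fun p => NonlocalCL.rightDensity (NonlocalCL.unitVolume.map (X p.2)) p.1,
    fun p hp => ⟨hsol p, fun μ hμ t ht => hμ.unique (hsol p) hp hp hV hv ht⟩, hrm,
    fun p => NonlocalCL.rightDensity_nonneg _ _, hdens, fun δ hδ => ?_⟩
  refine NonlocalCL.tendstoWeakStar_of_forall_continuous (C := (c δ)⁻¹) (fun N => ?_) hrm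
    (fun N t ht ξ => ?_) (fun t ht ξ => ?_) fun t ht g hg hgc => ?_
  -- The sequence also has an index N = 0, for which there is no particle flow; its reconstruction
  -- is an empty sum.
  · rcases Nat.eq_zero_or_pos N with rfl | hN
    · rw [NonlocalCL.reconstruction_zero]
      exact measurable_zero
    · exact (hP N hN).measurable_reconstruction
  · rcases Nat.eq_zero_or_pos N with rfl | hN
    · rw [NonlocalCL.reconstruction_zero, Pi.zero_apply, abs_zero]
      exact inv_nonneg.2 (hX.nonneg δ hδ.le)
    · exact (hP N hN).abs_reconstruction_le hδ ht ξ
  · rw [abs_of_nonneg (NonlocalCL.rightDensity_nonneg _ _)]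
    -- All flows share the same `c`, whose monotonicity is recorded with the particle flows; N = 1
    -- supplies it.
    exact (NonlocalCL.rightDensity_le (inv_nonneg.2 (hX.nonneg t (hδ.le.trans ht)))
      (hX.map_le (hδ.trans_le ht)) ξ).trans
        (inv_anti₀ (hX.pos δ hδ) ((hP 1 le_rfl).mono δ t ht))
  · have ht0 := hδ.trans_le ht
    have h1 : ∫ y, g y ∂(NonlocalCL.unitVolume.map (X t)) = ∫ ξ,
        NonlocalCL.rightDensity (NonlocalCL.unitVolume.map (X t)) ξ * g ξ :=
      NonlocalCL.integral_withDensity_ofReal (hrm.comp measurable_prodMk_right)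
        (fun ξ => NonlocalCL.rightDensity_nonneg _ ξ) (hdens t ht0) g
    rw [← h1, integral_map (hX.measurable_apply t).aemeasurable hg.aestronglyMeasurable]
    exact hlim t ht0 g hg hgc
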